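/- **Theorem (Convexity of the squared distance).** Let $\mathcal A$ be a finite-dimensional unital $C^*$-algebra with a faithful positive tracial linear functional $\tau$, and let $\langle a,b\rangle=\tau[a^*b]$. Let $\mathfrak P=\{\rho\in\mathcal A:\rho\ge 0,\ \tau[\rho]=1\}$, and let $\mathfrak P_+$ be the set of positive definite $\rho\in\mathfrak P$. A differential structure on $(\mathcal A,\tau)$ consists of: a finite index set $\mathcal J$ with an involution $j\mapsto j^*$; for each $j$ a finite-dimensional unital $C^*$-algebra $\mathcal B_j$ with faithful positive tracial functional $\tau_j$, where $(\mathcal B_{j^*},\tau_{j^*})=(\mathcal B_j,\tau_j)$; unital $*$-homomorphisms $\ell_j,r_j:\mathcal A\to\mathcal B_j$ with $\tau_j\circ\ell_j=\tau_j\circ r_j=\tau$; non-zero $V_j\in\mathcal B_j$ with $V_{j^*}=V_j^*$ and $$\tau_j[V_j^*\ell_j(a_1)V_jr_j(a_2)]=\tau_j[V_j^*r_{j^*}(a_1)V_j\ell_{j^*}(a_2)]\qquad (a_1,a_2\in\mathcal A);$$ and $\sigma\in\mathfrak P_+$, $\omega_j\in\mathbb R$ with $\ell_j(\sigma)V_jr_j(\sigma)^{-1}=e^{-\omega_j}V_j$.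 Put $\partial_ja=V_jr_j(a)-\ell_j(a)V_j$, and let $\dagger$ denote adjoints with respect to $\tau,\tau_j$. Let $\mathscr L:\mathcal A\to\mathcal A$ be the linear map determined by $$-\tau[a^*\sigma^{1/2}(\mathscr Lb)\sigma^{1/2}]=\sum_j\tau_j[(\partial_ja)^*\ell_j(\sigma^{1/2})(\partial_jb)\,r_j(\sigma^{1/2})]\qquad (a,b\in\mathcal A).$$ Assume ergodicity: $\ker\mathscr L=\mathbb C\mathbf 1$. Let $\mathcal A_0$ be the set of hermitian elements of $\operatorname{Ran}(\mathscr L^\dagger)$. Let $\theta_j:[0,\infty)^2\to\mathbb R$ be continuous, and $C^\infty$ and strictly positive on $(0,\infty)^2$, with $\theta_j(r,s)=\theta_{j^*}(s,r)$. Assume that each $\theta_j$ is $1$-homogeneous, i.e. $\theta_j(\lambda r,\lambda s)=\lambda\theta_j(r,s)$ for $\lambda,r,s>0$, and that $f_j(t)=\theta_j(t,1)$ is operator monotone on $(0,\infty)$, i.e. $f_j(X)\le f_j(Y)$ for all positive definite complex matrices $X\le Y$ of any size. For $\rho\in\mathfrak P_+$ set $$\mathscr K_\rho a=\sum_j\partial_j^\dagger\Big(\sum_{\lambda,\mu}\theta_j(\lambda,\mu)\,P^j_\lambda\,(\partial_ja)\,Q^j_\mu\Big),$$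 where $\ell_j(\rho)=\sum_\lambda\lambda P^j_\lambda$ and $r_j(\rho)=\sum_\mu\mu Q^j_\mu$ are the spectral decompositions. For $\rho_0,\rho_1\in\mathfrak P_+$ let $$\mathscr W(\rho_0,\rho_1)^2=\inf\int_0^1\langle\mathscr K_{\rho_t}a_t,a_t\rangle\,dt,$$ the infimum being over all $C^\infty$ curves $\rho:[0,1]\to\mathfrak P_+$ and $a:[0,1]\to\mathcal A_0$ with $\partial_t\rho_t=\mathscr K_{\rho_t}a_t$ that connect $\rho_0$ to $\rho_1$. Then this infimum is over a non-empty set, $\mathscr W$ extends continuously from $\mathfrak P_+\times\mathfrak P_+$ to $\mathfrak P\times\mathfrak P$, and the extension $\mathscr W$ satisfies: for all $\rho_0^0,\rho_1^0,\rho_0^1,\rho_1^1\in\mathfrak P$ and all $s\in[0,1]$, with $\rho_0^s=(1-s)\rho_0^0+s\rho_0^1$ and $\rho_1^s=(1-s)\rho_1^0+s\rho_1^1$, $$\mathscr W(\rho_0^s,\rho_1^s)^2\le(1-s)\,\mathscr W(\rho_0^0,\rho_1^0)^2+s\,\mathscr W(\rho_0^1,\rho_1^1)^2 .$$ -/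

import Mathlib

open scoped ComplexOrder ContDiff Topology

noncomputable section

namespace QTransport

/-! ### Finite-dimensional tracial C*-algebras -/

/-- A faithful positive tracial linear functional on a unital C*-algebra. -/
structure FaithfulTrace (A : Type*) [CStarAlgebra A] where
  toLin : A →ₗ[ℂ] ℂ
  nonneg : ∀ a : A, 0 ≤ toLin (star a * a)
  tracial : ∀ a b : A, toLin (a * b) = toLin (b * a)
  faithful : ∀ a : A, toLin (star a * a) = 0 → a = 0

/-- The scalar product `⟨a, b⟩ = τ[a* b]` of `L²(A, τ)`. -/
def FaithfulTrace.ip {A : Type*} [CStarAlgebra A] (τ : FaithfulTrace A) (a b : A) : ℂ :=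
  τ.toLin (star a * b)

/-- The bilinear form `(a, b) ↦ τ[a b]`. -/
def FaithfulTrace.bilin {A : Type*} [CStarAlgebra A] (τ : FaithfulTrace A) :
    LinearMap.BilinForm ℂ A :=
  (LinearMap.mul ℂ A).compr₂ τ.toLin

theorem FaithfulTrace.bilin_apply {A : Type*} [CStarAlgebra A] (τ : FaithfulTrace A) (a b : A) :
    τ.bilin a b = τ.toLin (a * b) := rfl

theorem FaithfulTrace.bilin_nondegenerate {A : Type*} [CStarAlgebra A] (τ : FaithfulTrace A) :
    τ.bilin.Nondegenerate := by
  refine ⟨fun a ha => ?_, fun a ha => ?_⟩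
  · have h := ha (star a)
    rw [τ.bilin_apply, τ.tracial] at h
    exact τ.faithful a h
  · exact τ.faithful a (ha (star a))

/-- The linear map `a ↦ (T a*)*`. -/
def conjMap {A B : Type*} [CStarAlgebra A] [CStarAlgebra B] (T : A →ₗ[ℂ] B) : A →ₗ[ℂ] B where
  toFun a := star (T (star a))
  map_add' a b := by simp
  map_smul' c a := by simp

/-- The adjoint `T† : L²(B, τ') → L²(A, τ)` of a linear map `T : L²(A, τ) → L²(B, τ')`;
it is characterized by `ip_adjoint` below. -/
def adjoint {A B : Type*} [CStarAlgebra A] [FiniteDimensional ℂ A] [CStarAlgebra B]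
    (τ : FaithfulTrace A) (τ' : FaithfulTrace B) (T : A →ₗ[ℂ] B) : B →ₗ[ℂ] A :=
  (τ.bilin.flip.toDual τ.bilin_nondegenerate.flip).symm.toLinearMap ∘ₗ
    (τ'.bilin.compl₁₂ (conjMap T) LinearMap.id).flip

theorem ip_adjoint {A B : Type*} [CStarAlgebra A] [FiniteDimensional ℂ A] [CStarAlgebra B]
    (τ : FaithfulTrace A) (τ' : FaithfulTrace B) (T : A →ₗ[ℂ] B) (a : A) (b : B) :
    τ.ip a (adjoint τ τ' T b) = τ'.ip (T a) b := by
  have h := LinearMap.BilinForm.apply_toDual_symm_apply (B := τ.bilin.flip)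
    (hB := τ.bilin_nondegenerate.flip)
    ((τ'.bilin.compl₁₂ (conjMap T) LinearMap.id).flip b) (star a)
  have h2 : ((τ'.bilin.compl₁₂ (conjMap T) LinearMap.id).flip b) (star a)
      = τ'.toLin (star (T a) * b) := by
    simp [conjMap, FaithfulTrace.bilin_apply]
  rw [h2] at h
  exact h

/-- Hermitian elements. -/
def herm (A : Type*) [CStarAlgebra A] : Set A := {a | IsSelfAdjoint a}

/-- Density matrices: positive semidefinite elements of trace one. -/
def density {A : Type*} [CStarAlgebra A] (τ : FaithfulTrace A) : Set A :=
  {ρ | IsSelfAdjoint ρ ∧ spectrum ℝ ρ ⊆ Set.Ici 0 ∧ τ.toLin ρ = 1}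

/-- Positive definite density matrices. -/
def densityPos {A : Type*} [CStarAlgebra A] (τ : FaithfulTrace A) : Set A :=
  {ρ | IsSelfAdjoint ρ ∧ spectrum ℝ ρ ⊆ Set.Ioi 0 ∧ τ.toLin ρ = 1}

/-! ### Double operator sums -/

theorem finite_real_spectrum {A : Type*} [CStarAlgebra A] [FiniteDimensional ℂ A] (a : A) :
    (spectrum ℝ a).Finite := by
  have hint : IsIntegral ℂ a := Algebra.IsIntegral.isIntegral a
  have hne : minpoly ℂ a ≠ 0 := minpoly.ne_zero hint
  have hfin : (spectrum ℂ a).Finite := by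
    refine Set.Finite.subset ((minpoly ℂ a).roots.toFinset.finite_toSet) ?_
    intro x hx
    have h1 : (minpoly ℂ a).eval x ∈ spectrum ℂ (Polynomial.aeval a (minpoly ℂ a)) :=
      spectrum.subset_polynomial_aeval a _ ⟨x, hx, rfl⟩
    rw [minpoly.aeval] at h1
    have : Nontrivial A := by
      by_contra hn
      rw [not_nontrivial_iff_subsingleton] at hn
      simp [spectrum.of_subsingleton] at hx
    rw [spectrum.zero_eq] at h1
    simp only [Finset.mem_coe, Multiset.mem_toFinset]
    exact (Polynomial.mem_roots hne).2 h1
  have hpre : spectrum ℝ a ⊆ (algebraMap ℝ ℂ) ⁻¹' spectrum ℂ a := fun x hx =>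
    (spectrum.algebraMap_mem_iff ℂ).2 hx
  exact (hfin.preimage (FaithfulSMul.algebraMap_injective ℝ ℂ).injOn).subset hpre

/-- The spectrum of a (hermitian) element, as a finite set of reals. -/
def specFinset {A : Type*} [CStarAlgebra A] [FiniteDimensional ℂ A] (a : A) : Finset ℝ :=
  (finite_real_spectrum a).toFinset

/-- The spectral projection of a hermitian element `a` for the eigenvalue `x`. -/
def specProj {A : Type*} [CStarAlgebra A] (a : A) (x : ℝ) : A :=
  cfc (Set.indicator {x} (1 : ℝ → ℝ)) a

/-- The contracted double operator sum
`c ↦ θ(a, b) # c = ∑ θ(λ, μ) P_λ c Q_μ`, where `a = ∑ λ P_λ` and `b = ∑ μ Q_μ` are the spectral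
decompositions of the hermitian elements `a` and `b`. -/
def doubleOpSum {A : Type*} [CStarAlgebra A] [FiniteDimensional ℂ A] (θ : ℝ → ℝ → ℝ) (a b : A) :
    A →ₗ[ℂ] A :=
  ∑ x ∈ specFinset a, ∑ y ∈ specFinset b,
    (θ x y : ℂ) • (LinearMap.mulLeft ℂ (specProj a x) ∘ₗ LinearMap.mulRight ℂ (specProj b y))

/-- The relative modular operator `Δ_{σ,ρ}(b) = σ b ρ⁻¹`. -/
def relModular {B : Type*} [CStarAlgebra B] (σ ρ b : B) : B := σ * b * Ring.inverse ρ

/-! ### Differential structures -/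

/-- A differential structure on the finite-dimensional tracial C*-algebra `(A, τ)`.
The index set is the disjoint union of the sets `J k`: the indices in `J k` are those whose
tracial algebra is `(B k, traceB k)`, so that an index `j` and its partner `j*` share
their tracial algebra. -/
structure DifferentialStructure {A : Type*} [CStarAlgebra A] (τ : FaithfulTrace A)
    {K : Type*} (J : K → Type*) (B : K → Type*) [∀ k, CStarAlgebra (B k)] where
  /-- the traces `τ_j` -/
  traceB : ∀ k, FaithfulTrace (B k)
  /-- the unital *-homomorphisms `ℓ_j` -/
  left : ∀ k, J k → (A →⋆ₐ[ℂ] B k)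
  /-- the unital *-homomorphisms `r_j` -/
  right : ∀ k, J k → (A →⋆ₐ[ℂ] B k)
  trace_left : ∀ k (j : J k) (a : A), (traceB k).toLin (left k j a) = τ.toLin a
  trace_right : ∀ k (j : J k) (a : A), (traceB k).toLin (right k j a) = τ.toLin a
  /-- the elements `V_j` -/
  V : ∀ k, J k → B k
  V_ne_zero : ∀ k (j : J k), V k j ≠ 0
  /-- the involution `j ↦ j*` -/
  inv : ∀ k, J k → J k
  inv_inv : ∀ k (j : J k), inv k (inv k j) = j
  V_inv : ∀ k (j : J k), V k (inv k j) = star (V k j)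
  symm : ∀ k (j : J k) (a₁ a₂ : A),
    (traceB k).toLin (star (V k j) * left k j a₁ * V k j * right k j a₂) =
      (traceB k).toLin
        (star (V k j) * right k (inv k j) a₁ * V k j * left k (inv k j) a₂)
  /-- the reference density matrix -/
  σ : A
  σ_mem : σ ∈ densityPos τ
  /-- the real numbers `ω_j` -/
  freq : ∀ k, J k → ℝ
  modular : ∀ k (j : J k),
    relModular (left k j σ) (right k j σ) (V k j) = (Real.exp (-freq k j) : ℂ) • V k j

namespace DifferentialStructure

variable {A : Type*} [CStarAlgebra A] {τ : FaithfulTrace A}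
  {K : Type*} {J : K → Type*} {B : K → Type*} [∀ k, CStarAlgebra (B k)]

/-- The derivative `∂_j a = V_j r_j(a) - ℓ_j(a) V_j`. -/
def partialD (D : DifferentialStructure τ J B) (k : K) (j : J k) : A →ₗ[ℂ] B k :=
  LinearMap.mulLeft ℂ (D.V k j) ∘ₗ (D.right k j).toAlgHom.toLinearMap -
    LinearMap.mulRight ℂ (D.V k j) ∘ₗ (D.left k j).toAlgHom.toLinearMap

theorem partialD_apply (D : DifferentialStructure τ J B) (k : K) (j : J k) (a : A) :
    D.partialD k j a = D.V k j * D.right k j a - D.left k j a * D.V k j := rfl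

/-- The square root `σ^{1/2}`. -/
def sqrtσ (D : DifferentialStructure τ J B) : A := cfc Real.sqrt D.σ

/-- The KMS scalar product `τ[a* σ^{1/2} b σ^{1/2}]`. -/
def kms (D : DifferentialStructure τ J B) (a b : A) : ℂ :=
  τ.toLin (star a * D.sqrtσ * b * D.sqrtσ)

/-- The KMS scalar product `τ_j[b* ℓ_j(σ^{1/2}) c r_j(σ^{1/2})]` on `B_j`. -/
def kmsB (D : DifferentialStructure τ J B) (k : K) (j : J k) (b c : B k) : ℂ :=
  (D.traceB k).toLin (star b * D.left k j D.sqrtσ * c * D.right k j D.sqrtσ)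

/-- The Dirichlet form `𝓔(a, b) = ∑_j ⟨∂_j a, ∂_j b⟩_KMS`. -/
def dirichlet [Fintype K] [∀ k, Fintype (J k)] (D : DifferentialStructure τ J B) (a b : A) : ℂ :=
  ∑ k, ∑ j : J k, D.kmsB k j (D.partialD k j a) (D.partialD k j b)

/-- The generator `𝓛` associated with the Dirichlet form, i.e. the linear map with
`𝓔(a, b) = -⟨a, 𝓛 b⟩_KMS`; see `dirichlet_eq`. -/
def generator [FiniteDimensional ℂ A] [Fintype K] [∀ k, Fintype (J k)]
    (D : DifferentialStructure τ J B) : A →ₗ[ℂ] A :=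
  -(LinearMap.mulLeft ℂ (Ring.inverse D.sqrtσ) ∘ₗ LinearMap.mulRight ℂ (Ring.inverse D.sqrtσ) ∘ₗ
    ∑ k, ∑ j : J k, adjoint τ (D.traceB k) (D.partialD k j) ∘ₗ
      LinearMap.mulLeft ℂ (D.left k j D.sqrtσ) ∘ₗ LinearMap.mulRight ℂ (D.right k j D.sqrtσ) ∘ₗ
        D.partialD k j)

theorem isUnit_sqrtσ (D : DifferentialStructure τ J B) : IsUnit D.sqrtσ := by
  obtain ⟨hsa, hpos, -⟩ := D.σ_mem
  refine (isUnit_cfc_iff Real.sqrt D.σ Real.continuous_sqrt.continuousOn hsa).2 ?_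
  intro x hx
  exact (Real.sqrt_pos.2 (hpos hx)).ne'

theorem dirichlet_eq [FiniteDimensional ℂ A] [Fintype K] [∀ k, Fintype (J k)]
    (D : DifferentialStructure τ J B) (a b : A) :
    D.dirichlet a b = -D.kms a (D.generator b) := by
  have hu := D.isUnit_sqrtσ
  have key : D.sqrtσ * D.generator b * D.sqrtσ =
      -∑ k, ∑ j : J k, adjoint τ (D.traceB k) (D.partialD k j)
        (D.left k j D.sqrtσ * (D.partialD k j b * D.right k j D.sqrtσ)) := by
    simp only [generator, LinearMap.neg_apply, LinearMap.comp_apply, LinearMap.mulLeft_apply,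
      LinearMap.mulRight_apply, LinearMap.sum_apply]
    rw [mul_neg, neg_mul, ← mul_assoc, Ring.mul_inverse_cancel _ hu, one_mul, mul_assoc,
      Ring.inverse_mul_cancel _ hu, mul_one]
  have h1 : D.kms a (D.generator b) = τ.toLin (star a * (D.sqrtσ * D.generator b * D.sqrtσ)) := by
    simp only [kms, mul_assoc]
  rw [h1, key, mul_neg, map_neg, neg_neg, Finset.mul_sum, map_sum, dirichlet]
  refine Finset.sum_congr rfl fun k _ => ?_
  rw [Finset.mul_sum, map_sum]
  refine Finset.sum_congr rfl fun j _ => ?_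
  have := ip_adjoint τ (D.traceB k) (D.partialD k j) a
    (D.left k j D.sqrtσ * (D.partialD k j b * D.right k j D.sqrtσ))
  simp only [FaithfulTrace.ip] at this
  rw [this, kmsB]
  simp only [mul_assoc]

/-- Ergodicity: `Ker 𝓛 = lin {1}`. -/
def Ergodic [FiniteDimensional ℂ A] [Fintype K] [∀ k, Fintype (J k)]
    (D : DifferentialStructure τ J B) : Prop :=
  LinearMap.ker D.generator = Submodule.span ℂ {(1 : A)}

/-- The tangent space `A₀ = Ran(𝓛†) ∩ A_h`. -/
def tangent [FiniteDimensional ℂ A] [Fintype K] [∀ k, Fintype (J k)]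
    (D : DifferentialStructure τ J B) : Set A :=
  (LinearMap.range (adjoint τ τ D.generator) : Set A) ∩ herm A

/-- The operator `𝓚_ρ a = ∑_j ∂_j† (θ_j(ℓ_j(ρ), r_j(ρ)) # ∂_j a)`. -/
def opK [FiniteDimensional ℂ A] [∀ k, FiniteDimensional ℂ (B k)] [Fintype K] [∀ k, Fintype (J k)]
    (D : DifferentialStructure τ J B) (θ : ∀ k, J k → ℝ → ℝ → ℝ) (ρ : A) : A →ₗ[ℂ] A :=
  ∑ k, ∑ j : J k, adjoint τ (D.traceB k) (D.partialD k j) ∘ₗ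
    doubleOpSum (θ k j) (D.left k j ρ) (D.right k j ρ) ∘ₗ D.partialD k j

/-- Admissible curves: smooth curves `ρ : [0,1] → 𝔓₊` and `a : [0,1] → A₀` with
`∂_t ρ_t = 𝓚_{ρ_t} a_t`, where `ρ` connects `ρ₀` to `ρ₁`. -/
structure IsAdmissible [FiniteDimensional ℂ A] [∀ k, FiniteDimensional ℂ (B k)] [Fintype K]
    [∀ k, Fintype (J k)] (D : DifferentialStructure τ J B) (θ : ∀ k, J k → ℝ → ℝ → ℝ)
    (ρ₀ ρ₁ : A) (ρ a : ℝ → A) : Prop where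
  smooth_density : ContDiffOn ℝ ∞ ρ (Set.Icc 0 1)
  smooth_potential : ContDiffOn ℝ ∞ a (Set.Icc 0 1)
  mem_density : ∀ t ∈ Set.Icc (0 : ℝ) 1, ρ t ∈ densityPos τ
  mem_tangent : ∀ t ∈ Set.Icc (0 : ℝ) 1, a t ∈ D.tangent
  continuity_eq : ∀ t ∈ Set.Icc (0 : ℝ) 1,
    HasDerivWithinAt ρ (D.opK θ (ρ t) (a t)) (Set.Icc 0 1) t
  start : ρ 0 = ρ₀
  finish : ρ 1 = ρ₁

/-- The set of the actions `∫₀¹ ⟨𝓚_{ρ_t} a_t, a_t⟩ dt` of all admissible curves from `ρ₀` to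
`ρ₁`. -/
def actions [FiniteDimensional ℂ A] [∀ k, FiniteDimensional ℂ (B k)] [Fintype K]
    [∀ k, Fintype (J k)] (D : DifferentialStructure τ J B) (θ : ∀ k, J k → ℝ → ℝ → ℝ)
    (ρ₀ ρ₁ : A) : Set ℝ :=
  {E | ∃ ρ a : ℝ → A, D.IsAdmissible θ ρ₀ ρ₁ ρ a ∧
    E = ∫ t in (0 : ℝ)..1, (τ.ip (D.opK θ (ρ t) (a t)) (a t)).re}

/-- The Riemannian distance `𝓦` on positive definite density matrices. -/
def distPos [FiniteDimensional ℂ A] [∀ k, FiniteDimensional ℂ (B k)] [Fintype K]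
    [∀ k, Fintype (J k)] (D : DifferentialStructure τ J B) (θ : ∀ k, J k → ℝ → ℝ → ℝ)
    (ρ₀ ρ₁ : A) : ℝ :=
  Real.sqrt (sInf (D.actions θ ρ₀ ρ₁))

/-- The extension by continuity of `𝓦` from `𝔓₊ × 𝔓₊` to `𝔓 × 𝔓`. -/
def transportDist [FiniteDimensional ℂ A] [∀ k, FiniteDimensional ℂ (B k)] [Fintype K]
    [∀ k, Fintype (J k)] (D : DifferentialStructure τ J B) (θ : ∀ k, J k → ℝ → ℝ → ℝ)
    (ρ₀ ρ₁ : A) : ℝ :=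
  extendFrom (densityPos τ ×ˢ densityPos τ) (fun p : A × A => D.distPos θ p.1 p.2) (ρ₀, ρ₁)

/-- The standing assumptions on the functions `θ_j : [0,∞) × [0,∞) → ℝ`. -/
structure IsMeanFamily (D : DifferentialStructure τ J B) (θ : ∀ k, J k → ℝ → ℝ → ℝ) : Prop where
  continuousOn : ∀ k (j : J k),
    ContinuousOn (fun p : ℝ × ℝ => θ k j p.1 p.2) (Set.Ici 0 ×ˢ Set.Ici 0)
  smooth : ∀ k (j : J k),
    ContDiffOn ℝ ∞ (fun p : ℝ × ℝ => θ k j p.1 p.2) (Set.Ioi 0 ×ˢ Set.Ioi 0)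
  pos : ∀ k (j : J k) (r s : ℝ), 0 < r → 0 < s → 0 < θ k j r s
  symm : ∀ k (j : J k) (r s : ℝ), 0 ≤ r → 0 ≤ s → θ k j r s = θ k (D.inv k j) s r

end DifferentialStructure

/-- `θ(λ r, λ s) = λ θ(r, s)` for all `λ, r, s > 0`. -/
def IsOneHomogeneous (θ : ℝ → ℝ → ℝ) : Prop :=
  ∀ c r s : ℝ, 0 < c → 0 < r → 0 < s → θ (c * r) (c * s) = c * θ r s

/-- Operator monotonicity of a function on `(0,∞)`: `f(X) ≤ f(Y)` for all positive definite
complex matrices `X ≤ Y` of every size. -/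
def IsOperatorMonotone (f : ℝ → ℝ) : Prop :=
  ∀ (n : ℕ) (X Y : Matrix (Fin n) (Fin n) ℂ), X.PosDef → Y.PosDef → (Y - X).PosSemidef →
    (cfc f Y - cfc f X).PosSemidef

end QTransport

end

open QTransport

/-!
On positive definite density matrices, `𝓦` is the distance of a Riemannian metric, and the theorem
is a consequence of the joint convexity of the metric tensor.

By ergodicity, the tangent space `A₀` consists of the hermitian elements of trace zero
(`mem_tangent_iff`), and `𝓚_ρ` is a positive definite operator on it. Hence every smooth path `ρ_t`
of positive definite density matrices solves the continuity equation for exactly one potential,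
`a_t = 𝓚_{ρ_t}⁻¹ ρ_t'`, and its action is the energy for the metric tensor
`q_ρ(v) = ⟨v, 𝓚_ρ⁻¹ v⟩` (`actions_eq_energies`). That `a_t` depends smoothly on `t` rests on the
smoothness of the functional calculus `T ↦ f(T)` for smooth `f` (`contDiffAt_cfc`). After
truncation and rescaling, `f` is a Fourier series with rapidly decaying coefficients. The series of
operator exponentials can then be differentiated term by term, since the `n`-th exponential is an
`|n|`-th power of one of three fixed smooth functions and its derivatives of order `k` are
`O(|n|ᵏ)`.

On `L²(B_j, τ_j)` let `L` and `R` be the commuting operators of left multiplication by `ℓ_j(ρ)`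
and of right multiplication by `r_j(ρ)`. As `θ_j` is `1`-homogeneous, the double operator sum is
the operator mean `R^{1/2} f_j(R^{-1/2} L R^{-1/2}) R^{1/2}` (`toMat_doubleOpSum_eq_mean`). Operator
monotone functions on `(0,∞)` satisfy Jensen's inequality (`posSemidef_cfc_jensen`), which makes
this mean jointly concave in `(L, R)` (`posSemidef_doubleOpSum_sub`). So `ρ ↦ 𝓚_ρ` is concave, and
`q_ρ(v) = sup_b (2 Re ⟨v, b⟩ - ⟨b, 𝓚_ρ b⟩)` is jointly convex in `(ρ, v)` (`metric_convex`).

The remaining argument uses only this convexity (`IsConvexMetric`). Convex combinations of paths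
give the convexity of `𝓦²` on positive definite density matrices. Joint convexity also yields
`q_{(1-s)ρ+sσ}(v) ≤ q_σ(v) / s`. By integrating this bound along segments, the distance from `ρ` to
`(1-ε)ρ + εσ` is `O(√ε)`, even near the boundary, and the distance from `(1-ε)ρ + εσ` to
`(1-ε)ρ' + εσ` is `O(‖ρ - ρ'‖ / √ε)`. With the triangle inequality, obtained by concatenating
paths extended to rest at their end points, `𝓦` is therefore uniformly continuous on bounded sets
(`exists_pathDist_lt`). It extends continuously to the boundary (`tendsto_extendFrom`), and the
convexity inequality passes to the limit along `(1-ε)ρ + εσ` as `ε → 0`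
(`extendFrom_sq_convex`).
-/

/-! ### Functional calculus of a finite spectral decomposition -/

namespace QTransport

section SpectralDecomposition

variable {ι R 𝕜 : Type*} [Fintype ι]

theorem sum_smul_mul_sum_smul [CommSemiring 𝕜] [Ring R] [Algebra 𝕜 R] {E : ι → R}
    (hE : CompleteOrthogonalIdempotents E) (u v : ι → 𝕜) :
    (∑ i, u i • E i) * (∑ i, v i • E i) = ∑ i, (u i * v i) • E i := by
  classical
  rw [Finset.sum_mul_sum]
  refine Finset.sum_congr rfl fun i _ => ?_
  rw [Finset.sum_eq_single i]
  · rw [smul_mul_smul_comm, (hE.idem i).eq]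
  · intro j _ hj
    rw [smul_mul_smul_comm, hE.ortho (Ne.symm hj), smul_zero]
  · simp

theorem pow_sum_smul [CommSemiring 𝕜] [Ring R] [Algebra 𝕜 R] {E : ι → R}
    (hE : CompleteOrthogonalIdempotents E) (u : ι → 𝕜) (n : ℕ) :
    (∑ i, u i • E i) ^ n = ∑ i, (u i ^ n) • E i := by
  induction n with
  | zero => simp [hE.complete]
  | succ n ih => rw [pow_succ, ih, sum_smul_mul_sum_smul hE]; simp [pow_succ]

theorem aeval_sum_smul [CommSemiring 𝕜] [Ring R] [Algebra 𝕜 R] {E : ι → R}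
    (hE : CompleteOrthogonalIdempotents E) (u : ι → 𝕜) (p : Polynomial 𝕜) :
    Polynomial.aeval (∑ i, u i • E i) p = ∑ i, (p.eval (u i)) • E i := by
  induction p using Polynomial.induction_on' with
  | add p q hp hq => simp [hp, hq, add_smul, Finset.sum_add_distrib]
  | monomial n a =>
    rw [Polynomial.aeval_monomial, pow_sum_smul hE, ← Algebra.smul_def, Finset.smul_sum]
    simp [Polynomial.eval_monomial, smul_smul]

theorem spectrum_sum_smul_subset [Field 𝕜] [Ring R] [Algebra 𝕜 R] {E : ι → R}
    (hE : CompleteOrthogonalIdempotents E) (u : ι → 𝕜) :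
    spectrum 𝕜 (∑ i, u i • E i) ⊆ Set.range u := by
  intro z hz
  by_contra hn
  apply hz
  have h1 : algebraMap 𝕜 R z - ∑ i, u i • E i = ∑ i, (z - u i) • E i := by
    simp only [sub_smul, Finset.sum_sub_distrib, ← Finset.smul_sum, hE.complete,
      Algebra.algebraMap_eq_smul_one]
  have hne : ∀ i, z - u i ≠ 0 := fun i h => hn ⟨i, (sub_eq_zero.1 h).symm⟩
  rw [spectrum.mem_resolventSet_iff, h1]
  refine ⟨⟨∑ i, (z - u i) • E i, ∑ i, (z - u i)⁻¹ • E i, ?_, ?_⟩, rfl⟩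
  · rw [sum_smul_mul_sum_smul hE]; simp [hne, hE.complete]
  · rw [sum_smul_mul_sum_smul hE]; simp [hne, hE.complete]

/-- A function on a finite set of points agrees there with a polynomial. -/
theorem exists_polynomial_eqOn [Field 𝕜] {s : Set 𝕜} (hs : s.Finite) (f : 𝕜 → 𝕜) :
    ∃ p : Polynomial 𝕜, ∀ x ∈ s, p.eval x = f x := by
  classical
  refine ⟨Lagrange.interpolate hs.toFinset id f, fun x hx => ?_⟩
  have := Lagrange.eval_interpolate_at_node (s := hs.toFinset) (v := id) f
    (Function.injective_id.injOn) (i := x) (by simpa using hx)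
  simpa using this

theorem isSelfAdjoint_sum_smul [Ring R] [StarRing R] [Algebra ℝ R] [StarModule ℝ R] {E : ι → R}
    (hsa : ∀ i, IsSelfAdjoint (E i)) (u : ι → ℝ) : IsSelfAdjoint (∑ i, u i • E i) := by
  rw [isSelfAdjoint_iff, star_sum]
  exact Finset.sum_congr rfl fun i _ => by rw [star_smul, (hsa i).star_eq, star_trivial]

theorem cfc_sum_smul [Ring R] [StarRing R] [Algebra ℝ R] [StarModule ℝ R] [TopologicalSpace R]
    [ContinuousFunctionalCalculus ℝ R IsSelfAdjoint] {E : ι → R}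
    (hE : CompleteOrthogonalIdempotents E) (hsa : ∀ i, IsSelfAdjoint (E i)) (u : ι → ℝ)
    (f : ℝ → ℝ) :
    cfc f (∑ i, u i • E i) = ∑ i, f (u i) • E i := by
  obtain ⟨p, hp⟩ := exists_polynomial_eqOn (Set.finite_range u) f
  have h1 : cfc f (∑ i, u i • E i) = cfc p.eval (∑ i, u i • E i) :=
    cfc_congr fun x hx => (hp x (spectrum_sum_smul_subset hE u hx)).symm
  rw [h1, cfc_polynomial p _ (isSelfAdjoint_sum_smul hsa u), aeval_sum_smul hE]
  exact Finset.sum_congr rfl fun i _ => by rw [hp _ ⟨i, rfl⟩]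

theorem exp_sum_smul [NormedRing R] [NormedAlgebra ℂ R] [CompleteSpace R] {E : ι → R}
    (hE : CompleteOrthogonalIdempotents E) (u : ι → ℂ) :
    NormedSpace.exp (∑ i, u i • E i) = ∑ i, Complex.exp (u i) • E i := by
  have h1 := NormedSpace.exp_series_hasSum_exp' (𝕂 := ℂ) (∑ i, u i • E i)
  have h2 : HasSum (fun n : ℕ => ((n.factorial : ℂ)⁻¹) • (∑ i, u i • E i) ^ n)
      (∑ i, Complex.exp (u i) • E i) := by
    have : (fun n : ℕ => ((n.factorial : ℂ)⁻¹) • (∑ i, u i • E i) ^ n) =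
        fun n : ℕ => ∑ i, (((n.factorial : ℂ)⁻¹) • u i ^ n) • E i := by
      funext n
      rw [pow_sum_smul hE, Finset.smul_sum]
      simp [smul_smul]
    rw [this]
    refine hasSum_sum fun i _ => ?_
    rw [Complex.exp_eq_exp_ℂ]
    exact (NormedSpace.exp_series_hasSum_exp' (𝕂 := ℂ) (u i)).smul_const (E i)
  exact h1.unique h2

end SpectralDecomposition

section SpecProj

variable {A : Type*} [CStarAlgebra A] [FiniteDimensional ℂ A]

theorem mem_specFinset {a : A} {x : ℝ} : x ∈ specFinset a ↔ x ∈ spectrum ℝ a := by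
  simp [specFinset]

theorem continuousOn_spectrum (a : A) (f : ℝ → ℝ) : ContinuousOn f (spectrum ℝ a) :=
  (finite_real_spectrum a).continuousOn f

theorem isSelfAdjoint_specProj {A : Type*} [CStarAlgebra A] (a : A) (x : ℝ) :
    IsSelfAdjoint (specProj a x) :=
  cfc_predicate _ a

theorem completeOrthogonalIdempotents_specProj {a : A} (ha : IsSelfAdjoint a) :
    CompleteOrthogonalIdempotents (fun x : specFinset a => specProj a (x : ℝ)) := by
  classical
  refine ⟨⟨fun x => ?_, fun x y hxy => ?_⟩, ?_⟩
  · rw [IsIdempotentElem, specProj, ← cfc_mul _ _ a (continuousOn_spectrum a _)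
      (continuousOn_spectrum a _)]
    congr 1
    ext y
    by_cases h : y = x <;> simp [h]
  · change specProj a x * specProj a y = 0
    rw [specProj, specProj, ← cfc_mul _ _ a (continuousOn_spectrum a _)
      (continuousOn_spectrum a _)]
    rw [← cfc_zero ℝ a]
    congr 1
    ext z
    by_cases h : z = x
    · have : z ≠ y := fun h' => hxy (Subtype.ext (h.symm.trans h'))
      simp [this]
    · simp [h]
  · simp only [specProj]
    rw [← cfc_sum_univ _ a (fun _ => continuousOn_spectrum a _), ← cfc_one ℝ a]
    refine cfc_congr fun z hz => ?_
    rw [Finset.sum_apply, Finset.sum_eq_single ⟨z, mem_specFinset.2 hz⟩]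
    · simp
    · intro y _ hy
      have : z ≠ y := fun h => hy (Subtype.ext h.symm)
      simp [this]
    · simp

theorem sum_smul_specProj {a : A} (ha : IsSelfAdjoint a) :
    ∑ x : specFinset a, (x : ℝ) • specProj a (x : ℝ) = a := by
  classical
  conv_rhs => rw [← cfc_id ℝ a]
  simp only [specProj]
  have : ∀ x : specFinset a, (x : ℝ) • cfc (Set.indicator {(x : ℝ)} (1 : ℝ → ℝ)) a =
      cfc (fun z => (x : ℝ) • Set.indicator {(x : ℝ)} (1 : ℝ → ℝ) z) a := fun x =>
    (cfc_smul (x : ℝ) _ a (continuousOn_spectrum a _)).symm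
  simp_rw [this]
  rw [← cfc_sum_univ _ a (fun _ => continuousOn_spectrum a _)]
  refine cfc_congr fun z hz => ?_
  rw [Finset.sum_apply, Finset.sum_eq_single ⟨z, mem_specFinset.2 hz⟩]
  · simp
  · intro y _ hy
    have : z ≠ y := fun h => hy (Subtype.ext h.symm)
    simp [this]
  · simp

end SpecProj

end QTransport

/-! ### Smoothness of the functional calculus -/

namespace QTransport

section SmoothCalculus

open Real in
/-- A smooth function with compact support in `(0,1)` is the sum of its Fourier series there, and
its Fourier coefficients decay rapidly. -/
theorem exists_hasSum_fourier {g : ℝ → ℂ} (hg : ContDiff ℝ ∞ g) (hc : HasCompactSupport g)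
    (hs : ∀ x, x ∉ Set.Ioo (0 : ℝ) 1 → g x = 0) :
    ∃ c : ℤ → ℂ, (∀ k : ℕ, Summable fun n : ℤ => ‖c n‖ * |(n : ℝ)| ^ k) ∧
      ∀ x ∈ Set.Ioo (0 : ℝ) 1,
        HasSum (fun n : ℤ => c n * Complex.exp (2 * π * Complex.I * n * x)) (g x) := by
  set F : SchwartzMap ℝ ℂ := hc.toSchwartzMap hg with hF
  have hFg : ∀ x, F x = g x := fun x => rfl
  set G : SchwartzMap ℝ ℂ := FourierTransform.fourier F with hG
  have hsum : ∀ k : ℕ, Summable fun n : ℤ => ‖G n‖ * |(n : ℝ)| ^ k := by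
    intro k
    obtain ⟨C, hC⟩ := G.decay' (k + 2) 0
    have h2 : Summable fun n : ℤ => C * (|(n : ℝ)| ^ (-2 : ℝ)) :=
      (Real.summable_abs_int_rpow (by norm_num)).mul_left C
    refine Summable.of_norm_bounded_eventually h2 ?_
    have hfin : {n : ℤ | ¬ (n ≠ 0)}.Finite := by simp
    refine (Filter.eventually_cofinite.2 hfin).mono fun n hn => ?_
    have hn' : (0 : ℝ) < |(n : ℝ)| := by positivity
    have := hC n
    rw [norm_iteratedFDeriv_zero, pow_add] at this
    rw [Real.norm_of_nonneg (by positivity), Real.rpow_neg hn'.le]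
    rw [← div_eq_mul_inv, le_div_iff₀ (by positivity)]
    simp only [Real.norm_eq_abs] at this
    calc _ = |(n : ℝ)| ^ k * |(n : ℝ)| ^ 2 * ‖G n‖ := by
          rw [show (2 : ℝ) = ((2 : ℕ) : ℝ) by norm_num, Real.rpow_natCast]; ring
      _ ≤ C := this
  refine ⟨fun n => G n, hsum, fun x hx => ?_⟩
  have h1 := SchwartzMap.tsum_eq_tsum_fourier F x
  have h2 : ∑' n : ℤ, F (x + n) = g x := by
    rw [tsum_eq_single 0]
    · simp [hFg]
    · intro n hn
      rw [hFg]
      apply hs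
      rintro ⟨ha, hb⟩
      rcases lt_or_gt_of_ne hn with h | h
      · have : (n : ℝ) ≤ -1 := by exact_mod_cast Int.le_sub_one_of_lt h
        linarith [hx.2]
      · have : (1 : ℝ) ≤ n := by exact_mod_cast h
        linarith [hx.1]
  have hterm : ∀ n : ℤ, G n * fourier n (x : UnitAddCircle) =
      G n * Complex.exp (2 * π * Complex.I * n * x) := by
    intro n
    rw [fourier_coe_apply]
    simp
  have h3 : Summable fun n : ℤ => G n * Complex.exp (2 * π * Complex.I * n * x) := by
    refine Summable.of_norm ?_
    refine (hsum 0).congr fun n => ?_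
    have : 2 * π * Complex.I * n * x = ((2 * π * n * x : ℝ) : ℂ) * Complex.I := by
      push_cast; ring
    rw [norm_mul, this, Complex.norm_exp_ofReal_mul_I]
    simp
  have h4 := h3.hasSum
  rwa [← tsum_congr hterm, ← h1, h2] at h4

/-- If the derivatives of `W` of order at most `K` satisfy `‖DᵏW‖ ≤ Cᵏ`, then
`‖Dᵏ(Wⁿ)‖ ≤ (n C)ᵏ`: by the Leibniz rule and the binomial theorem. -/
theorem norm_iteratedFDeriv_pow_le {E R : Type*} [NormedAddCommGroup E] [NormedSpace ℝ E]
    [NormedRing R] [NormedAlgebra ℝ R] (h1 : ‖(1 : R)‖ ≤ 1) {W : E → R} (hW : ContDiff ℝ ∞ W)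
    {C : ℝ} (hC : 0 ≤ C) {K : ℕ} (hb : ∀ k ≤ K, ∀ x, ‖iteratedFDeriv ℝ k W x‖ ≤ C ^ k)
    (n : ℕ) : ∀ k ≤ K, ∀ x, ‖iteratedFDeriv ℝ k (fun y => W y ^ n) x‖ ≤ (n * C) ^ k := by
  induction n with
  | zero =>
    intro k _ x
    rcases Nat.eq_zero_or_pos k with rfl | hk
    · simpa using h1
    · simp [iteratedFDeriv_const_of_ne hk.ne', pow_nonneg]
  | succ n ih =>
    intro k hk x
    simp_rw [pow_succ]
    have := norm_iteratedFDeriv_mul_le (hW.pow n) hW x (n := k) (by exact_mod_cast le_top)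
    refine this.trans ?_
    have h2 : ((n + 1 : ℕ) * C : ℝ) ^ k =
        ∑ i ∈ Finset.range (k + 1), (k.choose i : ℝ) * (n * C) ^ i * C ^ (k - i) := by
      rw [show ((n + 1 : ℕ) * C : ℝ) = n * C + C by push_cast; ring, add_pow]
      exact Finset.sum_congr rfl fun i _ => by ring
    rw [h2]
    refine Finset.sum_le_sum fun i hi => ?_
    have hi' : i ≤ k := Nat.lt_succ_iff.1 (Finset.mem_range.1 hi)
    gcongr
    · exact ih i (hi'.trans hk) x
    · exact hb (k - i) ((Nat.sub_le _ _).trans hk) x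

variable {A : Type*} [CStarAlgebra A]

/-- The hermitian part `(Z + Z*) / 2` as a continuous real-linear map `A → A`. -/
noncomputable def reCLM (A : Type*) [CStarAlgebra A] : A →L[ℝ] A :=
  (2⁻¹ : ℝ) • (ContinuousLinearMap.id ℝ A + (starL' ℝ : A ≃L[ℝ] A).toContinuousLinearMap)

theorem reCLM_apply (Z : A) : reCLM A Z = (2⁻¹ : ℝ) • (Z + star Z) := rfl

theorem isSelfAdjoint_reCLM (Z : A) : IsSelfAdjoint (reCLM A Z) := by
  rw [isSelfAdjoint_iff, reCLM_apply, star_smul, star_add, star_star, add_comm, star_trivial]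

theorem reCLM_of_isSelfAdjoint {Z : A} (h : IsSelfAdjoint Z) : reCLM A Z = Z := by
  rw [reCLM_apply, h.star_eq, ← two_smul ℝ Z, smul_smul]; norm_num

theorem norm_exp_I_smul_le {T : A} (hT : IsSelfAdjoint T) (s : ℝ) :
    ‖NormedSpace.exp ((s * Complex.I : ℂ) • T)‖ ≤ 1 := by
  rcases subsingleton_or_nontrivial A with _ | _
  · simp [Subsingleton.elim (NormedSpace.exp ((s * Complex.I : ℂ) • T)) 0]
  let _ : NormedAlgebra ℚ A := NormedAlgebra.restrictScalars ℚ ℂ A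
  have h : (s * Complex.I : ℂ) • T ∈ skewAdjoint A := by
    rw [skewAdjoint.mem_iff, star_smul, hT.star_eq]
    simp
  exact (CStarRing.norm_of_mem_unitary (NormedSpace.exp_mem_unitary_of_mem_skewAdjoint h)).le

theorem norm_one_le_one (A : Type*) [CStarAlgebra A] : ‖(1 : A)‖ ≤ 1 := by
  rcases subsingleton_or_nontrivial A with _ | _
  · simp [Subsingleton.elim (1 : A) 0]
  · simp

/-- A smooth function equal to a constant outside a compact set has bounded derivatives. -/
theorem exists_bound_iteratedFDeriv {E F : Type*} [NormedAddCommGroup E] [NormedSpace ℝ E]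
    [NormedAddCommGroup F] [NormedSpace ℝ F] {W : E → F} (hW : ContDiff ℝ ∞ W) (w : F)
    (hc : HasCompactSupport fun x => W x - w) {k : ℕ} (hk : k ≠ 0) :
    ∃ M, ∀ x, ‖iteratedFDeriv ℝ k W x‖ ≤ M := by
  have h1 : ContDiff ℝ ∞ (fun x => W x - w) := hW.sub contDiff_const
  obtain ⟨M, hM⟩ := (hc.iteratedFDeriv (𝕜 := ℝ) k).exists_bound_of_continuous
    (h1.continuous_iteratedFDeriv (by exact_mod_cast le_top))
  refine ⟨M, fun x => ?_⟩
  have h2 : iteratedFDeriv ℝ k (fun x => W x - w) x = iteratedFDeriv ℝ k W x := by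
    have := iteratedFDeriv_sub_apply (𝕜 := ℝ) (i := k) (x := x) (f := W) (g := fun _ => w)
      ((hW.of_le (by exact_mod_cast le_top)).contDiffAt) contDiff_const.contDiffAt
    rw [iteratedFDeriv_const_of_ne hk, Pi.zero_apply, sub_zero] at this
    exact this
  rw [← h2]
  exact hM x

/-- Truncation: a smooth function of `Z` can be made constant far away from a given point. -/
theorem exists_truncation {E : Type*} [NormedAddCommGroup E] [NormedSpace ℝ E]
    [FiniteDimensional ℝ E] (x₀ : E) :
    ∃ Φ : E → E, ContDiff ℝ ∞ Φ ∧ (∀ᶠ x in 𝓝 x₀, Φ x = x) ∧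
      HasCompactSupport fun x => Φ x - x₀ := by
  let χ : ContDiffBump x₀ := default
  refine ⟨fun x => χ x • (x - x₀) + x₀, ?_, ?_, ?_⟩
  · exact (χ.contDiff.smul (contDiff_id.sub contDiff_const)).add contDiff_const
  · filter_upwards [χ.eventuallyEq_one] with x hx
    rw [hx]; simp
  · simp only [add_sub_cancel_right]
    exact χ.hasCompactSupport.smul_right

/-- The sum of a Fourier series with rapidly decaying coefficients, evaluated at the hermitian part
of `Z`, is a smooth function of `Z`. -/
theorem contDiffAt_tsum_exp [FiniteDimensional ℂ A] {c : ℤ → ℂ}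
    (hc : ∀ k : ℕ, Summable fun n : ℤ => ‖c n‖ * |(n : ℝ)| ^ k) (s : ℝ) (Z₀ : A) :
    ContDiffAt ℝ ∞ (fun Z : A => ∑' n : ℤ,
      c n • NormedSpace.exp (((s * n : ℝ) * Complex.I : ℂ) • reCLM A Z)) Z₀ := by
  have : FiniteDimensional ℝ A := FiniteDimensional.complexToReal A
  obtain ⟨Φ, hΦ, hΦeq, hΦc⟩ := exists_truncation Z₀
  let W : ℝ → A → A := fun r Z => NormedSpace.exp ((r * Complex.I : ℂ) • reCLM A (Φ Z))
  have hW : ∀ r, ContDiff ℝ ∞ (W r) := by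
    intro r
    have h1 : ContDiff ℝ ∞ (NormedSpace.exp : A → A) := by
      have : ContDiff ℂ ∞ (NormedSpace.exp : A → A) :=
        contDiff_iff_contDiffAt.2 fun x => (NormedSpace.exp_analytic (𝕂 := ℂ) x).contDiffAt
      exact this.restrict_scalars ℝ
    exact h1.comp (((reCLM A).contDiff.comp hΦ).const_smul (r * Complex.I : ℂ))
  have hb : ∀ r : ℝ, ∀ K : ℕ, ∃ C : ℝ, 0 ≤ C ∧
      ∀ k ≤ K, ∀ x, ‖iteratedFDeriv ℝ k (W r) x‖ ≤ C ^ k := by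
    intro r K
    have hcs : HasCompactSupport fun x => W r x - W r 0 +
        (W r 0 - NormedSpace.exp ((r * Complex.I : ℂ) • reCLM A Z₀)) := by
      refine hΦc.mono' (Function.support_subset_iff'.2 fun x hx => ?_)
      have hx' : Φ x - Z₀ = 0 := by
        by_contra h
        exact hx (subset_tsupport _ h)
      have : Φ x = Z₀ := sub_eq_zero.1 hx'
      simp [W, this]
    have hcs' : HasCompactSupport fun x => W r x -
        NormedSpace.exp ((r * Complex.I : ℂ) • reCLM A Z₀) := by
      simpa using hcs
    have hM : ∀ k : ℕ, ∃ M, k ≠ 0 → ∀ x, ‖iteratedFDeriv ℝ k (W r) x‖ ≤ M := by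
      intro k
      by_cases hk : k = 0
      · exact ⟨0, fun h => absurd hk h⟩
      · obtain ⟨M, hM⟩ := exists_bound_iteratedFDeriv (hW r) _ hcs' hk
        exact ⟨M, fun _ => hM⟩
    choose M hM using hM
    let C : ℝ := 1 + ∑ k ∈ Finset.range (K + 1), |M k|
    have hC1 : 1 ≤ C := le_add_of_nonneg_right (Finset.sum_nonneg fun _ _ => abs_nonneg _)
    refine ⟨C, zero_le_one.trans hC1, fun k hk x => ?_⟩
    rcases Nat.eq_zero_or_pos k with rfl | hk0
    · rw [norm_iteratedFDeriv_zero, pow_zero]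
      exact norm_exp_I_smul_le (isSelfAdjoint_reCLM _) r
    · calc _ ≤ M k := hM k hk0.ne' x
        _ ≤ |M k| := le_abs_self _
        _ ≤ ∑ k ∈ Finset.range (K + 1), |M k| :=
          Finset.single_le_sum (f := fun k => |M k|) (fun _ _ => abs_nonneg _)
            (Finset.mem_range.2 (Nat.lt_succ_iff.2 hk))
        _ ≤ C := by simp [C]
        _ ≤ C ^ k := le_self_pow₀ hC1 hk0.ne'
  -- The `n`-th exponential is the `|n|`-th power of one of the three functions `W s`, `W 0` and
  -- `W (-s)`, so its derivatives of order `k` grow at most like `|n| ^ k`.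
  have hpow : ∀ n : ℤ, (fun Z => W (s * n) Z) =
      fun Z => (W (s * SignType.sign n) Z) ^ n.natAbs := by
    intro n
    funext Z
    simp only [W]
    let _ : NormedAlgebra ℚ A := NormedAlgebra.restrictScalars ℚ ℂ A
    rw [← NormedSpace.exp_nsmul, ← Nat.cast_smul_eq_nsmul ℂ, smul_smul]
    congr 2
    have : ((SignType.sign n : ℤ) : ℂ) * (n.natAbs : ℂ) = n := by
      have := congrArg (fun z : ℤ => (z : ℂ)) (Int.sign_mul_natAbs n)
      rw [Int.sign_eq_sign] at this
      simpa only [Int.cast_mul, Int.cast_natCast] using this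
    push_cast
    calc (s : ℂ) * n * Complex.I =
          s * (((SignType.sign n : ℤ) : ℂ) * (n.natAbs : ℂ)) * Complex.I := by rw [this]
      _ = _ := by
        rcases lt_trichotomy n 0 with h | h | h <;> simp [h] <;> ring
  have hbound : ∀ k : ℕ, ∃ C : ℝ, 0 ≤ C ∧ ∀ (n : ℤ) x,
      ‖iteratedFDeriv ℝ k (fun Z => W (s * n) Z) x‖ ≤ (|(n : ℝ)| * C) ^ k := by
    intro k
    obtain ⟨C0, hC0, h0⟩ := hb 0 k
    obtain ⟨C1, hC1, h1⟩ := hb s k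
    obtain ⟨C2, hC2, h2⟩ := hb (-s) k
    refine ⟨C0 + C1 + C2, by positivity, fun n x => ?_⟩
    have key : ∀ r C : ℝ, 0 ≤ C → C ≤ C0 + C1 + C2 →
        (∀ j ≤ k, ∀ x, ‖iteratedFDeriv ℝ j (W r) x‖ ≤ C ^ j) →
        ‖iteratedFDeriv ℝ k (fun Z => W r Z ^ n.natAbs) x‖ ≤ (|(n : ℝ)| * (C0 + C1 + C2)) ^ k := by
      intro r C hC hC' hr
      have := norm_iteratedFDeriv_pow_le (norm_one_le_one A) (hW r) hC hr n.natAbs k le_rfl x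
      refine this.trans ?_
      have hn : ((n.natAbs : ℕ) : ℝ) = |(n : ℝ)| := by
        rw [Nat.cast_natAbs]; simp
      rw [hn]
      gcongr
    rw [hpow n]
    rcases lt_trichotomy n 0 with h | h | h
    · have : (s * (SignType.sign n : ℝ)) = -s := by simp [h]
      rw [this]; exact key _ C2 hC2 (by linarith) h2
    · have : (s * (SignType.sign n : ℝ)) = 0 := by simp [h]
      rw [this]; exact key _ C0 hC0 (by linarith) h0
    · have : (s * (SignType.sign n : ℝ)) = s := by simp [h]
      rw [this]; exact key _ C1 hC1 (by linarith) h1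
  choose C hC0 hC using hbound
  have hmain : ContDiff ℝ ∞ (fun Z : A => ∑' n : ℤ, c n • W (s * n) Z) := by
    refine contDiff_tsum (v := fun k n => ‖c n‖ * (|(n : ℝ)| * C k) ^ k)
      (fun n => (hW _).const_smul (c n)) (fun k _ => ?_) (fun k n x _ => ?_)
    · refine ((hc k).mul_right (C k ^ k)).congr fun n => ?_
      rw [mul_pow]; ring
    · have : iteratedFDeriv ℝ k (fun Z => c n • W (s * n) Z) x =
          c n • iteratedFDeriv ℝ k (fun Z => W (s * n) Z) x := by
        have := iteratedFDeriv_const_smul_apply (𝕜 := ℝ) (a := c n) (i := k) (x := x)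
          (f := W (s * n)) (((hW _).of_le (by exact_mod_cast le_top)).contDiffAt)
        exact this
      rw [this, norm_smul]
      gcongr
      exact hC k n x
  refine hmain.contDiffAt.congr_of_eventuallyEq ?_
  filter_upwards [hΦeq] with Z hZ
  simp only [W, hZ]

/-- A Fourier expansion of `f` on the spectrum of `T` yields one of `f(T)`. -/
theorem hasSum_cfc {c : ℤ → ℂ} {s : ℝ} {f : ℝ → ℝ} {T : A} [FiniteDimensional ℂ A]
    (hT : IsSelfAdjoint T)
    (h : ∀ x ∈ spectrum ℝ T,
      HasSum (fun n : ℤ => c n * Complex.exp ((s * n : ℝ) * Complex.I * x)) (f x : ℂ)) :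
    HasSum (fun n : ℤ => c n • NormedSpace.exp (((s * n : ℝ) * Complex.I : ℂ) • T)) (cfc f T) := by
  have hE := completeOrthogonalIdempotents_specProj hT
  have h1 : ∀ z : ℂ, NormedSpace.exp (z • T) =
      ∑ x : specFinset T, Complex.exp (z * (x : ℝ)) • specProj T (x : ℝ) := by
    intro z
    rw [← exp_sum_smul hE]
    congr 1
    conv_lhs => rw [← sum_smul_specProj hT]
    rw [Finset.smul_sum]
    exact Finset.sum_congr rfl fun x _ => by rw [mul_smul, Complex.coe_smul]
  have h2 : cfc f T = ∑ x : specFinset T, (f x : ℂ) • specProj T (x : ℝ) := by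
    conv_lhs => rw [← sum_smul_specProj hT]
    rw [cfc_sum_smul hE (fun x => isSelfAdjoint_specProj T x)]
    exact Finset.sum_congr rfl fun x _ => (Complex.coe_smul _ _).symm
  simp_rw [h1, h2, Finset.smul_sum, smul_smul]
  exact hasSum_sum fun x _ => (h x (mem_specFinset.1 x.2)).smul_const _

theorem abs_sub_lt_of_mem_spectrum {T : A} {M r : ℝ}
    (h : ‖T - algebraMap ℝ A M‖ < r) : ∀ x ∈ spectrum ℝ T, |x - M| < r := by
  intro x hx
  rcases subsingleton_or_nontrivial A with _ | _
  · simp [spectrum.of_subsingleton] at hx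
  have h1 : x - M ∈ spectrum ℝ (T - algebraMap ℝ A M) := by
    rw [← spectrum.sub_singleton_eq]
    exact ⟨x, hx, M, rfl, rfl⟩
  exact (spectrum.norm_le_norm_of_mem h1).trans_lt h

/-- The functional calculus of a smooth function on `(0,∞)` is a smooth map near every positive
definite element. -/
theorem contDiffAt_cfc [FiniteDimensional ℂ A] {f : ℝ → ℝ} (hf : ContDiffOn ℝ ∞ f (Set.Ioi 0))
    {T : A} (hT : IsSelfAdjoint T) (hpos : spectrum ℝ T ⊆ Set.Ioi 0) :
    ContDiffAt ℝ ∞ (fun Z : A => cfc f (reCLM A Z)) T := by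
  -- `M` is chosen such that `‖T - M‖ < r < M`; then `x / (2 M)` stays in `(0, 1)` for all
  -- spectral values `x` near those of `T`.
  obtain ⟨M, hM0, hM⟩ : ∃ M : ℝ, 0 < M ∧ ∀ x ∈ spectrum ℝ T, x < 2 * M := by
    obtain ⟨b, hb⟩ := (finite_real_spectrum T).bddAbove
    exact ⟨|b| + 1, by positivity, fun x hx => by
      linarith [hb hx, le_abs_self b, abs_nonneg b]⟩
  have hTM : ‖T - algebraMap ℝ A M‖ < M := by
    have : T - algebraMap ℝ A M = cfc (fun x => x - M) T := by
      rw [cfc_sub (fun x => x) (fun _ => M) T, cfc_id' ℝ T, cfc_const M T]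
    rw [this]
    refine norm_cfc_lt hM0 fun x hx => ?_
    have h0 : 0 < x := hpos hx
    rw [Real.norm_eq_abs, abs_lt]
    constructor <;> linarith [hM x hx]
  obtain ⟨r, hr1, hr2⟩ := exists_between hTM
  have hr0 : 0 < r := (norm_nonneg _).trans_lt hr1
  obtain ⟨r', hr3, hr4⟩ := exists_between hr2
  let χ : ContDiffBump (1 / 2 : ℝ) :=
    { rIn := r / (2 * M), rOut := r' / (2 * M)
      rIn_pos := by positivity
      rIn_lt_rOut := by gcongr }
  have hout : χ.rOut < 1 / 2 := by
    change r' / (2 * M) < 1 / 2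
    rw [div_lt_div_iff₀ (by positivity) (by norm_num)]; linarith
  have hsupp : ∀ x, x ∉ Set.Ioo (0 : ℝ) 1 → χ x = 0 := by
    intro x hx
    refine χ.zero_of_le_dist ?_
    rw [Real.dist_eq]
    refine hout.le.trans ?_
    by_contra hlt
    rw [not_le, abs_lt] at hlt
    exact hx ⟨by linarith [hlt.1], by linarith [hlt.2]⟩
  let g : ℝ → ℂ := fun x => ((χ x * f (2 * M * x) : ℝ) : ℂ)
  have hgs : ∀ x, x ∉ Set.Ioo (0 : ℝ) 1 → g x = 0 := fun x hx => by simp [g, hsupp x hx]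
  have hg : ContDiff ℝ ∞ g := by
    refine Complex.ofRealCLM.contDiff.comp (contDiff_iff_contDiffAt.2 fun x => ?_)
    by_cases hx : 0 < x
    · have h1 : ContDiffAt ℝ ∞ f (2 * M * x) :=
        hf.contDiffAt (Ioi_mem_nhds (by positivity))
      exact χ.contDiffAt.mul (h1.comp x (contDiffAt_const.mul contDiffAt_id))
    · have : (fun x => χ x * f (2 * M * x)) =ᶠ[𝓝 x] fun _ => 0 := by
        have h2 : x < 1 / 2 - χ.rOut := by linarith
        filter_upwards [Iio_mem_nhds h2] with y hy
        have : χ y = 0 := by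
          refine χ.zero_of_le_dist ?_
          rw [Real.dist_eq]
          have hy' : y < 1 / 2 - χ.rOut := hy
          rw [abs_of_nonpos (by linarith [χ.rOut_pos])]
          linarith
        simp [this]
      exact contDiffAt_const.congr_of_eventuallyEq this
  have hgc : HasCompactSupport g := by
    refine χ.hasCompactSupport.mono fun x hx => ?_
    intro h
    exact hx (by simp [g, h])
  obtain ⟨c, hc, hsum⟩ := exists_hasSum_fourier hg hgc hgs
  refine (contDiffAt_tsum_exp hc (2 * Real.pi / (2 * M)) T).congr_of_eventuallyEq ?_
  have hnear : ∀ᶠ Z in 𝓝 T, ‖reCLM A Z - algebraMap ℝ A M‖ < r := by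
    have hcont : Continuous fun Z => ‖reCLM A Z - algebraMap ℝ A M‖ := by fun_prop
    refine hcont.continuousAt.eventually_lt continuousAt_const ?_
    rwa [reCLM_of_isSelfAdjoint hT]
  filter_upwards [hnear] with Z hZ
  refine (hasSum_cfc (isSelfAdjoint_reCLM Z) fun x hx => ?_).tsum_eq.symm
  have hxr := abs_sub_lt_of_mem_spectrum hZ x hx
  have hxM : |x / (2 * M) - 1 / 2| < χ.rIn := by
    change _ < r / (2 * M)
    have : x / (2 * M) - 1 / 2 = (x - M) / (2 * M) := by field_simp
    rw [this, abs_div, abs_of_pos (show 0 < 2 * M by positivity)]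
    gcongr
  have hmem : x / (2 * M) ∈ Set.Ioo (0 : ℝ) 1 := by
    have := abs_lt.1 (hxM.trans (χ.rIn_lt_rOut.trans hout))
    constructor <;> linarith [this.1, this.2]
  have hval : g (x / (2 * M)) = f x := by
    have h1 : χ (x / (2 * M)) = 1 := χ.one_of_mem_closedBall (by
      rw [Metric.mem_closedBall, Real.dist_eq]; exact hxM.le)
    have h2 : 2 * M * (x / (2 * M)) = x := by field_simp
    simp only [g, h1, h2, one_mul]
  rw [← hval]
  refine (hsum _ hmem).congr_fun fun n => ?_
  congr 2
  push_cast
  field_simp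

end SmoothCalculus

end QTransport

/-! ### Jensen's operator inequality for operator monotone functions -/

namespace QTransport

section Jensen

open Matrix

variable {m n : Type*} [Fintype m] [DecidableEq m] [Fintype n] [DecidableEq n]

theorem exists_polynomial_cfc_eq (f : ℝ → ℝ) {S : Matrix m m ℂ} {T : Matrix n n ℂ}
    (hS : IsSelfAdjoint S) (hT : IsSelfAdjoint T) :
    ∃ p : Polynomial ℝ, cfc f S = Polynomial.aeval S p ∧ cfc f T = Polynomial.aeval T p := by
  obtain ⟨p, hp⟩ := exists_polynomial_eqOn
    ((Matrix.finite_real_spectrum (A := S)).union (Matrix.finite_real_spectrum (A := T))) f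
  refine ⟨p, ?_, ?_⟩
  · rw [← cfc_polynomial p S hS]
    exact cfc_congr fun x hx => (hp x (Or.inl hx)).symm
  · rw [← cfc_polynomial p T hT]
    exact cfc_congr fun x hx => (hp x (Or.inr hx)).symm

theorem aeval_mul_of_intertwine {S : Matrix m m ℂ} {T : Matrix n n ℂ} {X : Matrix m n ℂ}
    (h : S * X = X * T) (p : Polynomial ℝ) :
    Polynomial.aeval S p * X = X * Polynomial.aeval T p := by
  have hpow : ∀ k : ℕ, S ^ k * X = X * T ^ k := by
    intro k
    induction k with
    | zero => simp
    | succ k ih => rw [pow_succ, Matrix.mul_assoc, h, ← Matrix.mul_assoc, ih, pow_succ,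
        Matrix.mul_assoc]
  induction p using Polynomial.induction_on' with
  | add p q hp hq => simp only [map_add, Matrix.add_mul, Matrix.mul_add, hp, hq]
  | monomial k a =>
    rw [Polynomial.aeval_monomial, Polynomial.aeval_monomial, ← Algebra.smul_def,
      ← Algebra.smul_def, Matrix.smul_mul, Matrix.mul_smul, hpow]

theorem cfc_mul_of_intertwine (f : ℝ → ℝ) {S : Matrix m m ℂ} {T : Matrix n n ℂ}
    (hS : IsSelfAdjoint S) (hT : IsSelfAdjoint T) {X : Matrix m n ℂ} (h : S * X = X * T) :
    cfc f S * X = X * cfc f T := by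
  obtain ⟨p, h1, h2⟩ := exists_polynomial_cfc_eq f hS hT
  rw [h1, h2]
  exact aeval_mul_of_intertwine h p

/-- Operator monotonicity for matrices indexed by an arbitrary finite type. -/
theorem IsOperatorMonotone.posSemidef_cfc_sub {f : ℝ → ℝ} (hf : IsOperatorMonotone f)
    {X Y : Matrix m m ℂ} (hX : X.PosDef) (hY : Y.PosDef) (h : (Y - X).PosSemidef) :
    (cfc f Y - cfc f X).PosSemidef := by
  let e := (Fintype.equivFin m).symm
  let U : Matrix m (Fin (Fintype.card m)) ℂ := (1 : Matrix m m ℂ).submatrix id e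
  have hU : ∀ Z : Matrix m m ℂ, Z * U = U * Z.submatrix e e := by
    intro Z
    ext i j
    simpa [U, Matrix.mul_apply, Matrix.one_apply] using
      (e.sum_comp fun k => if i = k then Z k (e j) else 0).symm
  have hcfc : ∀ Z : Matrix m m ℂ, Z.PosDef → cfc f (Z.submatrix e e) = (cfc f Z).submatrix e e := by
    intro Z hZ
    have h1 : IsSelfAdjoint (Z.submatrix e e) := hZ.1.submatrix e
    have h2 := cfc_mul_of_intertwine f (S := Z) hZ.1 h1 (hU Z)
    rw [hU] at h2
    have h3 : Uᴴ * U = 1 := by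
      ext i j
      simp [U, Matrix.mul_apply, Matrix.one_apply]
    have := congrArg (fun M => Uᴴ * M) h2
    simp only [← Matrix.mul_assoc, h3, Matrix.one_mul] at this
    exact this.symm
  have hmain := hf _ (X.submatrix e e) (Y.submatrix e e) (hX.submatrix e.injective)
    (hY.submatrix e.injective) (h.submatrix e)
  rw [hcfc X hX, hcfc Y hY] at hmain
  exact (Matrix.posSemidef_submatrix_equiv e).1 hmain

theorem spectrum_subset_Ioi_of_posDef {T : Matrix m m ℂ} (hT : T.PosDef) :
    spectrum ℝ T ⊆ Set.Ioi 0 := by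
  rw [hT.1.spectrum_real_eq_range_eigenvalues]
  rintro _ ⟨i, rfl⟩
  exact hT.eigenvalues_pos i

open scoped Matrix.Norms.L2Operator in
theorem tendsto_cfc_add_smul_one {f : ℝ → ℝ} (hf : ContDiffOn ℝ ∞ f (Set.Ioi 0))
    {T : Matrix m m ℂ} (hT : T.PosDef) :
    Filter.Tendsto (fun ε : ℝ => cfc f (T + (ε : ℂ) • 1)) (𝓝[>] 0) (𝓝 (cfc f T)) := by
  have hsa : IsSelfAdjoint T := hT.1
  have h1 : ContinuousAt (fun Z : Matrix m m ℂ => cfc f (reCLM (Matrix m m ℂ) Z)) T :=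
    (contDiffAt_cfc hf hsa (spectrum_subset_Ioi_of_posDef hT)).continuousAt
  have h2 : Filter.Tendsto (fun ε : ℝ => T + (ε : ℂ) • (1 : Matrix m m ℂ)) (𝓝[>] 0) (𝓝 T) := by
    have : Continuous (fun ε : ℝ => T + (ε : ℂ) • (1 : Matrix m m ℂ)) := by fun_prop
    have := (this.tendsto 0).mono_left (nhdsWithin_le_nhds (s := Set.Ioi 0))
    simpa using this
  have h3 := h1.tendsto.comp h2
  rw [reCLM_of_isSelfAdjoint hsa] at h3
  refine h3.congr fun ε => ?_
  have : IsSelfAdjoint (T + (ε : ℂ) • (1 : Matrix m m ℂ)) := by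
    refine hsa.add ?_
    rw [isSelfAdjoint_iff, star_smul, star_one]
    simp
  simp only [Function.comp_apply, reCLM_of_isSelfAdjoint this]

/-- Jensen's inequality for a compression: `X* f(T) X ≤ f(X* T X)` for an isometry `X`. The matrix
`S = T + ε Z* Z ≥ T` below satisfies `S X = X (X* T X + ε)`, whence
`X* f(T) X ≤ X* f(S) X = f(X* T X + ε)`; then `ε → 0`. -/
theorem IsOperatorMonotone.posSemidef_cfc_compression {f : ℝ → ℝ} (hf : IsOperatorMonotone f)
    (hs : ContDiffOn ℝ ∞ f (Set.Ioi 0)) {T : Matrix m m ℂ} (hT : T.PosDef) {X : Matrix m n ℂ}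
    (hX : Xᴴ * X = 1) :
    (cfc f (Xᴴ * T * X) - Xᴴ * cfc f T * X).PosSemidef := by
  have hinj : Function.Injective X.mulVec := by
    intro u v huv
    have := congrArg (fun w => Xᴴ *ᵥ w) huv
    simpa [Matrix.mulVec_mulVec, hX] using this
  have hA : (Xᴴ * T * X).PosDef := hT.conjTranspose_mul_mul_same hinj
  have hTsa : IsSelfAdjoint T := hT.1
  have hTh : Tᴴ = T := hT.1
  have key : ∀ ε : ℝ, 0 < ε →
      (cfc f (Xᴴ * T * X + (ε : ℂ) • 1) - Xᴴ * cfc f T * X).PosSemidef := by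
    intro ε hε
    have hεc : (ε : ℂ) ≠ 0 := by exact_mod_cast hε.ne'
    let Z : Matrix n m ℂ := Xᴴ - (ε : ℂ)⁻¹ • (Xᴴ * T * (1 - X * Xᴴ))
    let S : Matrix m m ℂ := T + (ε : ℂ) • (Zᴴ * Z)
    have hεn : (0 : ℂ) ≤ (ε : ℂ) := by exact_mod_cast hε.le
    have hZZ : ((ε : ℂ) • (Zᴴ * Z)).PosSemidef :=
      (Matrix.posSemidef_conjTranspose_mul_self Z).smul hεn
    have hS : S.PosDef := hT.add_posSemidef hZZ
    have hST : (S - T).PosSemidef := by simpa [S] using hZZ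
    have hZX : Z * X = 1 := by
      simp [Z, Matrix.sub_mul, Matrix.mul_sub, Matrix.mul_assoc, hX]
    have hZh : Zᴴ = X - (ε : ℂ)⁻¹ • ((1 - X * Xᴴ) * T * X) := by
      simp [Z, Matrix.conjTranspose_sub, Matrix.conjTranspose_smul, Matrix.conjTranspose_mul, hTh,
        Matrix.mul_assoc]
    have hA' : IsSelfAdjoint (Xᴴ * T * X + (ε : ℂ) • (1 : Matrix n n ℂ)) := by
      refine IsSelfAdjoint.add hA.1 ?_
      rw [isSelfAdjoint_iff, star_smul, star_one]
      simp
    have hSX : S * X = X * (Xᴴ * T * X + (ε : ℂ) • 1) := by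
      simp only [S]
      rw [Matrix.add_mul, Matrix.smul_mul, Matrix.mul_assoc, hZX, Matrix.mul_one, hZh, smul_sub,
        smul_smul, mul_inv_cancel₀ hεc, one_smul, Matrix.mul_add, Matrix.mul_smul, Matrix.mul_one]
      simp only [Matrix.sub_mul, Matrix.one_mul, Matrix.mul_assoc]
      abel
    have h1 := cfc_mul_of_intertwine f (S := S) hS.1 hA' hSX
    have h2 := (hf.posSemidef_cfc_sub hT hS hST).conjTranspose_mul_mul_same X
    have h3 : Xᴴ * (cfc f S - cfc f T) * X =
        cfc f (Xᴴ * T * X + (ε : ℂ) • 1) - Xᴴ * cfc f T * X := by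
      rw [Matrix.mul_sub, Matrix.sub_mul, Matrix.mul_assoc _ (cfc f S), h1, ← Matrix.mul_assoc, hX,
        Matrix.one_mul]
    rwa [h3] at h2
  have hlim := (tendsto_cfc_add_smul_one hs hA).sub_const (Xᴴ * cfc f T * X)
  have hherm : (cfc f (Xᴴ * T * X) - Xᴴ * cfc f T * X).IsHermitian := by
    have h1 : IsSelfAdjoint (cfc f (Xᴴ * T * X)) := cfc_predicate _ _
    have h2 : (cfc f T).IsHermitian := cfc_predicate (p := IsSelfAdjoint) f T
    exact Matrix.IsHermitian.sub h1 (Matrix.isHermitian_conjTranspose_mul_mul X h2)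
  refine Matrix.PosSemidef.of_dotProduct_mulVec_nonneg hherm fun v => ?_
  have hcont : Continuous fun M : Matrix n n ℂ => star v ⬝ᵥ (M *ᵥ v) := by fun_prop
  refine ge_of_tendsto ((hcont.tendsto _).comp hlim) ?_
  filter_upwards [self_mem_nhdsWithin] with ε hε
  exact (key ε hε).dotProduct_mulVec_nonneg v

/-- Jensen's inequality `X₀* f(T₀) X₀ + X₁* f(T₁) X₁ ≤ f(X₀* T₀ X₀ + X₁* T₁ X₁)` for
`X₀* X₀ + X₁* X₁ = 1`. -/
theorem IsOperatorMonotone.posSemidef_cfc_jensen {f : ℝ → ℝ} (hf : IsOperatorMonotone f)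
    (hs : ContDiffOn ℝ ∞ f (Set.Ioi 0)) {T₀ T₁ : Matrix n n ℂ} (h₀ : T₀.PosDef) (h₁ : T₁.PosDef)
    {X₀ X₁ : Matrix n n ℂ} (hX : X₀ᴴ * X₀ + X₁ᴴ * X₁ = 1) :
    (cfc f (X₀ᴴ * T₀ * X₀ + X₁ᴴ * T₁ * X₁) -
      (X₀ᴴ * cfc f T₀ * X₀ + X₁ᴴ * cfc f T₁ * X₁)).PosSemidef := by
  let T : Matrix (n ⊕ n) (n ⊕ n) ℂ := Matrix.fromBlocks T₀ 0 0 T₁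
  let X : Matrix (n ⊕ n) n ℂ := Matrix.fromRows X₀ X₁
  let J₀ : Matrix (n ⊕ n) n ℂ := Matrix.fromRows 1 0
  let J₁ : Matrix (n ⊕ n) n ℂ := Matrix.fromRows 0 1
  have hT : T.PosDef := by
    refine Matrix.PosDef.of_dotProduct_mulVec_pos ?_ fun {v} hv => ?_
    · exact Matrix.IsHermitian.fromBlocks h₀.1 (by simp) h₁.1
    · have hsplit : star v ⬝ᵥ (T *ᵥ v) = star (v ∘ Sum.inl) ⬝ᵥ (T₀ *ᵥ (v ∘ Sum.inl)) +
          star (v ∘ Sum.inr) ⬝ᵥ (T₁ *ᵥ (v ∘ Sum.inr)) := by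
        simp [T, Matrix.fromBlocks_mulVec, dotProduct, Fintype.sum_sum_type]
      rw [hsplit]
      by_cases h0 : v ∘ Sum.inl = 0
      · have h1 : v ∘ Sum.inr ≠ 0 := by
          intro h1
          apply hv
          funext i
          rcases i with i | i
          · exact congrFun h0 i
          · exact congrFun h1 i
        exact add_pos_of_nonneg_of_pos (h₀.posSemidef.dotProduct_mulVec_nonneg _)
          (h₁.dotProduct_mulVec_pos h1)
      · exact add_pos_of_pos_of_nonneg (h₀.dotProduct_mulVec_pos h0)
          (h₁.posSemidef.dotProduct_mulVec_nonneg _)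
  have hXJ : X = J₀ * X₀ + J₁ * X₁ := by
    ext i j
    rcases i with i | i <;> simp [X, J₀, J₁, Matrix.fromRows_mul]
  have hXJ₀ : Xᴴ * J₀ = X₀ᴴ := by
    simp [X, J₀, Matrix.conjTranspose_fromRows_eq_fromCols_conjTranspose,
      Matrix.fromCols_mul_fromRows]
  have hXJ₁ : Xᴴ * J₁ = X₁ᴴ := by
    simp [X, J₁, Matrix.conjTranspose_fromRows_eq_fromCols_conjTranspose,
      Matrix.fromCols_mul_fromRows]
  have hTJ₀ : T * J₀ = J₀ * T₀ := by
    simp [T, J₀, Matrix.fromBlocks_mul_fromRows, Matrix.fromRows_mul]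
  have hTJ₁ : T * J₁ = J₁ * T₁ := by
    simp [T, J₁, Matrix.fromBlocks_mul_fromRows, Matrix.fromRows_mul]
  have hXX : Xᴴ * X = 1 := by
    rw [← hX]
    nth_rewrite 2 [hXJ]
    rw [Matrix.mul_add, ← Matrix.mul_assoc, ← Matrix.mul_assoc, hXJ₀, hXJ₁]
  have main := hf.posSemidef_cfc_compression hs hT hXX
  have hgen : ∀ (M : Matrix (n ⊕ n) (n ⊕ n) ℂ) (M₀ M₁ : Matrix n n ℂ), M * J₀ = J₀ * M₀ →
      M * J₁ = J₁ * M₁ → Xᴴ * M * X = X₀ᴴ * M₀ * X₀ + X₁ᴴ * M₁ * X₁ := by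
    intro M M₀ M₁ hM₀ hM₁
    nth_rewrite 2 [hXJ]
    rw [Matrix.mul_assoc, Matrix.mul_add, ← Matrix.mul_assoc M, ← Matrix.mul_assoc M, hM₀, hM₁,
      Matrix.mul_add, ← Matrix.mul_assoc, ← Matrix.mul_assoc, ← Matrix.mul_assoc,
      ← Matrix.mul_assoc, hXJ₀, hXJ₁]
  rw [hgen T T₀ T₁ hTJ₀ hTJ₁, hgen _ _ _ (cfc_mul_of_intertwine f (S := T) hT.1 h₀.1 hTJ₀)
    (cfc_mul_of_intertwine f (S := T) hT.1 h₁.1 hTJ₁)] at main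
  exact main

end Jensen

end QTransport

/-! ### The regular representation on `L²(B, τ)` -/

namespace QTransport

section RegularRepresentation

open Matrix

theorem FaithfulTrace.toLin_star {B : Type*} [CStarAlgebra B] (τ : FaithfulTrace B) (a : B) :
    τ.toLin (star a) = star (τ.toLin a) := by
  have h : ∀ x : B, (τ.toLin (star x * x)).im = 0 := fun x =>
    ((Complex.nonneg_iff.1 (τ.nonneg x)).2).symm
  -- the imaginary parts of `τ[(1 + a)* (1 + a)]` and `τ[(1 + i a)* (1 + i a)]` vanish
  have h1 := h (1 + a)
  have h2 := h (1 + Complex.I • a)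
  have h3 := h a
  have h4 := h 1
  simp only [star_add, star_one, star_smul, add_mul, mul_add, one_mul, mul_one, smul_mul_assoc,
    mul_smul_comm, map_add, map_smul, Complex.add_im] at h1 h2 h3 h4
  simp [h3, h4] at h1 h2
  apply Complex.ext
  · simp only [Complex.star_def, Complex.conj_re]; linarith
  · simp only [Complex.star_def, Complex.conj_im]; linarith

/-- The scalar product of `L²(B, τ)` as an inner product core. -/
@[reducible]
noncomputable def FaithfulTrace.core {B : Type*} [CStarAlgebra B] (τ : FaithfulTrace B) :
    InnerProductSpace.Core ℂ B where
  inner a b := τ.ip a b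
  conj_inner_symm a b := by
    change star (τ.toLin (star b * a)) = τ.toLin (star a * b)
    rw [← τ.toLin_star, star_mul, star_star]
  re_inner_nonneg a := (Complex.nonneg_iff.1 (τ.nonneg a)).1
  add_left a b c := by simp [FaithfulTrace.ip, add_mul]
  smul_left a b c := by simp [FaithfulTrace.ip]
  definite a h := τ.faithful a h

theorem exists_orthonormal_coords {E : Type*} [AddCommGroup E] [Module ℂ E]
    [FiniteDimensional ℂ E] (c : InnerProductSpace.Core ℂ E) :
    ∃ (n : ℕ) (e : E ≃ₗ[ℂ] (Fin n → ℂ)), ∀ a b : E, c.inner a b = star (e a) ⬝ᵥ e b := by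
  let _ : NormedAddCommGroup E := c.toNormedAddCommGroup
  let _ : InnerProductSpace ℂ E := InnerProductSpace.ofCore c.toCore
  let b := stdOrthonormalBasis ℂ E
  refine ⟨Module.finrank ℂ E, b.repr.toLinearEquiv.trans (WithLp.linearEquiv 2 ℂ _), fun x y => ?_⟩
  have h : c.inner x y = inner ℂ (b.repr x) (b.repr y) := (b.repr.inner_map_map x y).symm
  rw [h, EuclideanSpace.inner_eq_star_dotProduct, dotProduct_comm]
  rfl

variable {B : Type*} [CStarAlgebra B] [FiniteDimensional ℂ B] (τ : FaithfulTrace B)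

/-- The dimension of `L²(B, τ)`. -/
noncomputable def FaithfulTrace.dim : ℕ := (exists_orthonormal_coords τ.core).choose

/-- The coordinates of `L²(B, τ)` with respect to an orthonormal basis. -/
noncomputable def FaithfulTrace.coords : B ≃ₗ[ℂ] (Fin τ.dim → ℂ) :=
  (exists_orthonormal_coords τ.core).choose_spec.choose

theorem FaithfulTrace.ip_eq_dotProduct (a b : B) :
    τ.ip a b = star (τ.coords a) ⬝ᵥ τ.coords b :=
  (exists_orthonormal_coords τ.core).choose_spec.choose_spec a b

/-- The matrix of a linear operator on `L²(B, τ)` in the orthonormal basis of `τ.coords`. -/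
noncomputable def FaithfulTrace.toMat : Module.End ℂ B ≃ₐ[ℂ] Matrix (Fin τ.dim) (Fin τ.dim) ℂ :=
  (τ.coords.conjAlgEquiv ℂ).trans LinearMap.toMatrixAlgEquiv'

theorem FaithfulTrace.toMat_mulVec (T : Module.End ℂ B) (b : B) :
    τ.toMat T *ᵥ τ.coords b = τ.coords (T b) := by
  rw [← Matrix.toLin'_apply]
  change Matrix.toLin' (LinearMap.toMatrix' (τ.coords.conj T)) _ = _
  rw [Matrix.toLin'_toMatrix', LinearEquiv.conj_apply_apply, LinearEquiv.symm_apply_apply]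

theorem FaithfulTrace.ip_apply_eq (T : Module.End ℂ B) (a b : B) :
    τ.ip a (T b) = star (τ.coords a) ⬝ᵥ (τ.toMat T *ᵥ τ.coords b) := by
  rw [τ.toMat_mulVec, τ.ip_eq_dotProduct]

theorem FaithfulTrace.toMat_conjTranspose {S T : Module.End ℂ B}
    (h : ∀ a b, τ.ip a (S b) = τ.ip (T a) b) : τ.toMat S = (τ.toMat T)ᴴ := by
  have key : ∀ u v, star u ⬝ᵥ (τ.toMat S *ᵥ v) = star u ⬝ᵥ ((τ.toMat T)ᴴ *ᵥ v) := by
    intro u v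
    obtain ⟨a, rfl⟩ := τ.coords.surjective u
    obtain ⟨b, rfl⟩ := τ.coords.surjective v
    rw [← τ.ip_apply_eq, h, τ.ip_eq_dotProduct, ← τ.toMat_mulVec, Matrix.star_mulVec,
      Matrix.dotProduct_mulVec]
  ext i j
  have := key (Pi.single i 1) (Pi.single j 1)
  simpa [Pi.star_single] using this

/-- The matrix of the left multiplication by `a` on `L²(B, τ)`. -/
noncomputable def FaithfulTrace.lMat : B →ₗ[ℂ] Matrix (Fin τ.dim) (Fin τ.dim) ℂ :=
  τ.toMat.toLinearMap ∘ₗ LinearMap.mul ℂ B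

/-- The matrix of the right multiplication by `a` on `L²(B, τ)`. -/
noncomputable def FaithfulTrace.rMat : B →ₗ[ℂ] Matrix (Fin τ.dim) (Fin τ.dim) ℂ :=
  τ.toMat.toLinearMap ∘ₗ (LinearMap.mul ℂ B).flip

theorem FaithfulTrace.lMat_eq (a : B) : τ.lMat a = τ.toMat (LinearMap.mulLeft ℂ a) := rfl

theorem FaithfulTrace.rMat_eq (a : B) : τ.rMat a = τ.toMat (LinearMap.mulRight ℂ a) := rfl

theorem FaithfulTrace.lMat_one : τ.lMat 1 = 1 := by
  rw [τ.lMat_eq, LinearMap.mulLeft_one]; exact map_one τ.toMat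

theorem FaithfulTrace.rMat_one : τ.rMat 1 = 1 := by
  rw [τ.rMat_eq, LinearMap.mulRight_one]; exact map_one τ.toMat

theorem FaithfulTrace.lMat_mul (a b : B) : τ.lMat (a * b) = τ.lMat a * τ.lMat b := by
  simp only [τ.lMat_eq, LinearMap.mulLeft_mul, ← map_mul]; rfl

theorem FaithfulTrace.rMat_mul (a b : B) : τ.rMat (a * b) = τ.rMat b * τ.rMat a := by
  simp only [τ.rMat_eq, LinearMap.mulRight_mul, ← map_mul]; rfl

theorem FaithfulTrace.lMat_mul_rMat (a b : B) : τ.lMat a * τ.rMat b = τ.rMat b * τ.lMat a := by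
  simp only [τ.lMat_eq, τ.rMat_eq, ← map_mul]
  congr 1
  ext c
  simp [mul_assoc]

theorem FaithfulTrace.lMat_star (a : B) : τ.lMat (star a) = (τ.lMat a)ᴴ := by
  rw [τ.lMat_eq, τ.lMat_eq]
  refine τ.toMat_conjTranspose fun x y => ?_
  simp [FaithfulTrace.ip, mul_assoc]

theorem FaithfulTrace.rMat_star (a : B) : τ.rMat (star a) = (τ.rMat a)ᴴ := by
  rw [τ.rMat_eq, τ.rMat_eq]
  refine τ.toMat_conjTranspose fun x y => ?_
  simp only [FaithfulTrace.ip, LinearMap.mulRight_apply, star_mul]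
  rw [← mul_assoc, τ.tracial, mul_assoc]

theorem FaithfulTrace.isSelfAdjoint_lMat {a : B} (ha : IsSelfAdjoint a) :
    IsSelfAdjoint (τ.lMat a) := by
  rw [isSelfAdjoint_iff, Matrix.star_eq_conjTranspose, ← τ.lMat_star, ha.star_eq]

theorem FaithfulTrace.isSelfAdjoint_rMat {a : B} (ha : IsSelfAdjoint a) :
    IsSelfAdjoint (τ.rMat a) := by
  rw [isSelfAdjoint_iff, Matrix.star_eq_conjTranspose, ← τ.rMat_star, ha.star_eq]

end RegularRepresentation

/-! ### Double operator sums as operator means -/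

section DoubleOperatorSum

open Matrix

/-- Positive definite elements: hermitian with spectrum in `(0,∞)`. -/
def posDefElts (B : Type*) [CStarAlgebra B] : Set B :=
  {a | IsSelfAdjoint a ∧ spectrum ℝ a ⊆ Set.Ioi 0}

variable {B : Type*} [CStarAlgebra B] [FiniteDimensional ℂ B] (τ : FaithfulTrace B)

theorem cfc_eq_sum_specProj (f : ℝ → ℝ) {a : B} (ha : IsSelfAdjoint a) :
    cfc f a = ∑ x : specFinset a, f x • specProj a (x : ℝ) := by
  conv_lhs => rw [← sum_smul_specProj ha]
  exact cfc_sum_smul (completeOrthogonalIdempotents_specProj ha)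
    (fun x => isSelfAdjoint_specProj a x) _ f

/-- The joint spectral projections `c ↦ P_λ c Q_μ` of the left multiplication by `a` and the right
multiplication by `b`, as matrices. -/
noncomputable def jointProj (a b : B) (i : specFinset a × specFinset b) :
    Matrix (Fin τ.dim) (Fin τ.dim) ℂ :=
  τ.lMat (specProj a (i.1 : ℝ)) * τ.rMat (specProj b (i.2 : ℝ))

theorem isSelfAdjoint_jointProj (a b : B) (i : specFinset a × specFinset b) :
    IsSelfAdjoint (jointProj τ a b i) := by
  rw [isSelfAdjoint_iff, jointProj, star_mul,
    (τ.isSelfAdjoint_lMat (isSelfAdjoint_specProj a _)).star_eq,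
    (τ.isSelfAdjoint_rMat (isSelfAdjoint_specProj b _)).star_eq, τ.lMat_mul_rMat]

theorem sum_jointProj (a b : B) (u v : ℝ → ℝ) :
    ∑ i : specFinset a × specFinset b, (u i.1 * v i.2) • jointProj τ a b i =
      τ.lMat (∑ x : specFinset a, u x • specProj a (x : ℝ)) *
        τ.rMat (∑ y : specFinset b, v y • specProj b (y : ℝ)) := by
  have hr : ∀ (c : ℝ) (p : B), τ.lMat (c • p) = c • τ.lMat p := fun c p => by
    rw [← Complex.coe_smul, map_smul, Complex.coe_smul]
  have hr' : ∀ (c : ℝ) (p : B), τ.rMat (c • p) = c • τ.rMat p := fun c p => by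
    rw [← Complex.coe_smul, map_smul, Complex.coe_smul]
  rw [map_sum, map_sum, Finset.sum_mul_sum, Fintype.sum_prod_type]
  refine Finset.sum_congr rfl fun x _ => Finset.sum_congr rfl fun y _ => ?_
  rw [hr, hr', smul_mul_smul_comm, jointProj]

theorem sum_jointProj_cfc {a b : B} (ha : IsSelfAdjoint a) (hb : IsSelfAdjoint b) (u v : ℝ → ℝ) :
    ∑ i : specFinset a × specFinset b, (u i.1 * v i.2) • jointProj τ a b i =
      τ.lMat (cfc u a) * τ.rMat (cfc v b) := by
  rw [sum_jointProj, cfc_eq_sum_specProj u ha, cfc_eq_sum_specProj v hb]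

theorem completeOrthogonalIdempotents_jointProj {a b : B} (ha : IsSelfAdjoint a)
    (hb : IsSelfAdjoint b) : CompleteOrthogonalIdempotents (jointProj τ a b) := by
  have hA := completeOrthogonalIdempotents_specProj ha
  have hB := completeOrthogonalIdempotents_specProj hb
  have hmul : ∀ i j, jointProj τ a b i * jointProj τ a b j =
      τ.lMat (specProj a (i.1 : ℝ) * specProj a (j.1 : ℝ)) *
        τ.rMat (specProj b (j.2 : ℝ) * specProj b (i.2 : ℝ)) := by
    intro i j
    simp only [jointProj, τ.lMat_mul, τ.rMat_mul]
    rw [Matrix.mul_assoc, ← Matrix.mul_assoc (τ.rMat _) (τ.lMat _), ← τ.lMat_mul_rMat]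
    simp only [Matrix.mul_assoc]
  refine ⟨⟨fun i => ?_, fun i j hij => ?_⟩, ?_⟩
  · rw [IsIdempotentElem, hmul]
    have h1 : specProj a (i.1 : ℝ) * specProj a (i.1 : ℝ) = specProj a (i.1 : ℝ) := hA.idem i.1
    have h2 : specProj b (i.2 : ℝ) * specProj b (i.2 : ℝ) = specProj b (i.2 : ℝ) := hB.idem i.2
    rw [h1, h2, jointProj]
  · change jointProj τ a b i * jointProj τ a b j = 0
    rw [hmul]
    by_cases h : i.1 = j.1
    · have h2 : j.2 ≠ i.2 := fun h2 => hij (Prod.ext h h2.symm)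
      have : specProj b (j.2 : ℝ) * specProj b (i.2 : ℝ) = 0 := hB.ortho h2
      rw [this, map_zero, Matrix.mul_zero]
    · have : specProj a (i.1 : ℝ) * specProj a (j.1 : ℝ) = 0 := hA.ortho h
      rw [this, map_zero, Matrix.zero_mul]
  · have := sum_jointProj_cfc τ ha hb (fun _ => 1) (fun _ => 1)
    rw [cfc_const_one ℝ a ha, cfc_const_one ℝ b hb, τ.lMat_one, τ.rMat_one] at this
    simpa using this

theorem toMat_doubleOpSum (θ : ℝ → ℝ → ℝ) (a b : B) :
    τ.toMat (doubleOpSum θ a b) =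
      ∑ i : specFinset a × specFinset b, θ i.1 i.2 • jointProj τ a b i := by
  rw [doubleOpSum, map_sum, Fintype.sum_prod_type, ← Finset.sum_coe_sort]
  refine Finset.sum_congr rfl fun x _ => ?_
  rw [map_sum, ← Finset.sum_coe_sort]
  refine Finset.sum_congr rfl fun y _ => ?_
  rw [map_smul, Complex.coe_smul, jointProj, τ.lMat_eq, τ.rMat_eq, ← map_mul]
  rfl

theorem posDef_sum_smul {ι n : Type*} [Fintype ι] [Fintype n] [DecidableEq n]
    {E : ι → Matrix n n ℂ} (hE : CompleteOrthogonalIdempotents E)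
    (hsa : ∀ i, IsSelfAdjoint (E i)) {u : ι → ℝ} (hu : ∀ i, 0 < u i) :
    (∑ i, u i • E i).PosDef := by
  let S := ∑ i, Real.sqrt (u i) • E i
  have h1 : ∑ i, u i • E i = Sᴴ * S := by
    have : Sᴴ = S := (isSelfAdjoint_sum_smul hsa _ : IsSelfAdjoint S)
    rw [this, sum_smul_mul_sum_smul hE]
    simp only [Real.mul_self_sqrt (hu _).le]
  have h2 : (∑ i, (Real.sqrt (u i))⁻¹ • E i) * S = 1 := by
    rw [sum_smul_mul_sum_smul hE]
    simp [(Real.sqrt_pos.2 (hu _)).ne', hE.complete]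
  rw [h1]
  refine Matrix.PosDef.conjTranspose_mul_self S ?_
  intro x y hxy
  have := congrArg (fun w => (∑ i, (Real.sqrt (u i))⁻¹ • E i) *ᵥ w) hxy
  simpa [Matrix.mulVec_mulVec, h2] using this

/-- The relative modular operator `c ↦ a c b⁻¹` as a matrix. -/
noncomputable def modMat (a b : B) : Matrix (Fin τ.dim) (Fin τ.dim) ℂ :=
  τ.lMat a * τ.rMat (cfc (fun x : ℝ => x⁻¹) b)

theorem modMat_eq_sum {a b : B} (ha : IsSelfAdjoint a) (hb : IsSelfAdjoint b) :
    modMat τ a b = ∑ i : specFinset a × specFinset b,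
      ((i.1 : ℝ) * (i.2 : ℝ)⁻¹) • jointProj τ a b i := by
  rw [sum_jointProj_cfc τ ha hb (fun x => x) (fun y => y⁻¹), cfc_id' ℝ a, modMat]

theorem posDef_modMat {a b : B} (ha : a ∈ posDefElts B) (hb : b ∈ posDefElts B) :
    (modMat τ a b).PosDef := by
  rw [modMat_eq_sum τ ha.1 hb.1]
  refine posDef_sum_smul (completeOrthogonalIdempotents_jointProj τ ha.1 hb.1)
    (isSelfAdjoint_jointProj τ a b) fun i => ?_
  have h1 : 0 < (i.1 : ℝ) := ha.2 (mem_specFinset.1 i.1.2)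
  have h2 : 0 < (i.2 : ℝ) := hb.2 (mem_specFinset.1 i.2.2)
  positivity

/-- A double operator sum with a `1`-homogeneous function `θ` is the operator mean
`R^{1/2} f(R^{-1/2} L R^{-1/2}) R^{1/2}` of the commuting operators `L` (left multiplication by
`a`) and `R` (right multiplication by `b`), where `f(t) = θ(t, 1)`. -/
theorem toMat_doubleOpSum_eq_mean {θ : ℝ → ℝ → ℝ} (hθ : IsOneHomogeneous θ) {a b : B}
    (ha : a ∈ posDefElts B) (hb : b ∈ posDefElts B) :
    τ.toMat (doubleOpSum θ a b) =
      τ.rMat (cfc Real.sqrt b) * cfc (fun x => θ x 1) (modMat τ a b) *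
        τ.rMat (cfc Real.sqrt b) := by
  have hE := completeOrthogonalIdempotents_jointProj τ ha.1 hb.1
  have h1 : τ.rMat (cfc Real.sqrt b) = ∑ i : specFinset a × specFinset b,
      Real.sqrt (i.2 : ℝ) • jointProj τ a b i := by
    have := sum_jointProj_cfc τ ha.1 hb.1 (fun _ => 1) Real.sqrt
    rw [cfc_const_one ℝ a ha.1, τ.lMat_one, Matrix.one_mul] at this
    simpa using this.symm
  rw [toMat_doubleOpSum, modMat_eq_sum τ ha.1 hb.1,
    cfc_sum_smul hE (isSelfAdjoint_jointProj τ a b), h1, sum_smul_mul_sum_smul hE,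
    sum_smul_mul_sum_smul hE]
  refine Finset.sum_congr rfl fun i _ => ?_
  have hx : 0 < (i.1 : ℝ) := ha.2 (mem_specFinset.1 i.1.2)
  have hy : 0 < (i.2 : ℝ) := hb.2 (mem_specFinset.1 i.2.2)
  congr 1
  have h2 := hθ (i.2 : ℝ) ((i.1 : ℝ) * (i.2 : ℝ)⁻¹) 1 hy (by positivity) one_pos
  rw [mul_one, mul_comm (i.1 : ℝ), mul_inv_cancel_left₀ hy.ne'] at h2
  rw [h2, mul_right_comm, Real.mul_self_sqrt hy.le, mul_comm (i.1 : ℝ)]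

end DoubleOperatorSum

end QTransport

/-! ### Positive definite elements -/

namespace QTransport

section PositiveElements

variable {B : Type*} [CStarAlgebra B]

theorem spectrum_add_nonneg {a b : B} (ha : IsSelfAdjoint a) (hb : IsSelfAdjoint b)
    (ha' : spectrum ℝ a ⊆ Set.Ici 0) (hb' : spectrum ℝ b ⊆ Set.Ici 0) :
    spectrum ℝ (a + b) ⊆ Set.Ici 0 :=
  SpectrumRestricts.nnreal_iff.1 (SpectrumRestricts.nnreal_add ha hb
    (SpectrumRestricts.nnreal_iff.2 ha') (SpectrumRestricts.nnreal_iff.2 hb'))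

theorem spectrum_smul_nonneg {a : B} (ha' : spectrum ℝ a ⊆ Set.Ici 0) {c : ℝ} (hc : 0 ≤ c) :
    spectrum ℝ (c • a) ⊆ Set.Ici 0 := by
  rcases subsingleton_or_nontrivial B with _ | _
  · simp [spectrum.of_subsingleton]
  rcases hc.eq_or_lt with rfl | hc
  · rw [zero_smul, spectrum.zero_eq]; simp
  · have := spectrum.unit_smul_eq_smul a (Units.mk0 c hc.ne')
    rw [Units.smul_def, Units.val_mk0] at this
    rw [this]
    rintro _ ⟨y, hy, rfl⟩
    exact mul_nonneg hc.le (ha' hy)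

theorem smul_mem_posDefElts {a : B} (ha : a ∈ posDefElts B) {c : ℝ} (hc : 0 < c) :
    c • a ∈ posDefElts B := by
  refine ⟨(IsSelfAdjoint.all c).smul ha.1, ?_⟩
  have := spectrum.unit_smul_eq_smul a (Units.mk0 c hc.ne')
  rw [Units.smul_def, Units.val_mk0] at this
  rw [this]
  rintro _ ⟨y, hy, rfl⟩
  exact mul_pos hc (ha.2 hy)

theorem add_mem_posDefElts [FiniteDimensional ℂ B] {a b : B} (ha : IsSelfAdjoint a)
    (ha' : spectrum ℝ a ⊆ Set.Ici 0) (hb : b ∈ posDefElts B) : a + b ∈ posDefElts B := by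
  refine ⟨ha.add hb.1, fun x hx => ?_⟩
  rcases subsingleton_or_nontrivial B with _ | _
  · simp [spectrum.of_subsingleton] at hx
  -- a lower bound `c > 0` of the spectrum of `b`
  obtain ⟨c, hc, hcb⟩ : ∃ c : ℝ, 0 < c ∧ ∀ y ∈ spectrum ℝ b, c ≤ y := by
    rcases (spectrum ℝ b).eq_empty_or_nonempty with h | h
    · exact ⟨1, one_pos, fun y hy => by simp [h] at hy⟩
    · obtain ⟨c, hc, hmin⟩ := Set.exists_min_image _ id (finite_real_spectrum b) h
      exact ⟨c, hb.2 hc, hmin⟩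
  have h1 : spectrum ℝ (b - algebraMap ℝ B c) ⊆ Set.Ici 0 := by
    rw [← spectrum.sub_singleton_eq]
    rintro _ ⟨y, hy, _, rfl, rfl⟩
    exact sub_nonneg.2 (hcb y hy)
  have hsa : IsSelfAdjoint (b - algebraMap ℝ B c) :=
    hb.1.sub (IsSelfAdjoint.algebraMap B (IsSelfAdjoint.all c))
  have h2 := spectrum_add_nonneg ha hsa ha' h1
  rw [← add_sub_assoc, ← spectrum.sub_singleton_eq] at h2
  have : 0 ≤ x - c := h2 ⟨x, hx, c, rfl, rfl⟩
  exact lt_of_lt_of_le hc (by linarith)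

theorem posDefElts_spectrum_nonneg {a : B} (ha : a ∈ posDefElts B) : spectrum ℝ a ⊆ Set.Ici 0 :=
  fun _ hx => le_of_lt (Set.mem_Ioi.1 (ha.2 hx))

theorem convexComb_mem_posDefElts [FiniteDimensional ℂ B] {a b : B} (ha : IsSelfAdjoint a)
    (ha' : spectrum ℝ a ⊆ Set.Ici 0) (hb : b ∈ posDefElts B) {s : ℝ} (h0 : 0 < s) (h1 : s ≤ 1) :
    (1 - s) • a + s • b ∈ posDefElts B :=
  add_mem_posDefElts ((IsSelfAdjoint.all _).smul ha) (spectrum_smul_nonneg ha' (sub_nonneg.2 h1))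
    (smul_mem_posDefElts hb h0)

theorem convex_posDefElts [FiniteDimensional ℂ B] {a b : B} (ha : a ∈ posDefElts B)
    (hb : b ∈ posDefElts B) {s : ℝ} (hs : s ∈ Set.Icc (0 : ℝ) 1) :
    (1 - s) • a + s • b ∈ posDefElts B := by
  rcases hs.1.eq_or_lt with rfl | h0
  · simpa using ha
  · exact convexComb_mem_posDefElts ha.1 (posDefElts_spectrum_nonneg ha) hb h0 hs.2

theorem map_mem_posDefElts {A : Type*} [CStarAlgebra A] (φ : A →⋆ₐ[ℂ] B) {a : A}
    (ha : a ∈ posDefElts A) : φ a ∈ posDefElts B :=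
  ⟨ha.1.map φ, (AlgHom.spectrum_apply_subset (φ.toAlgHom.restrictScalars ℝ) a).trans ha.2⟩

theorem contDiffOn_cfc [FiniteDimensional ℂ B] {E : Type*} [NormedAddCommGroup E] [NormedSpace ℝ E]
    {f : ℝ → ℝ} (hf : ContDiffOn ℝ ∞ f (Set.Ioi 0)) {s : Set E} {X : E → B}
    (hX : ContDiffOn ℝ ∞ X s) (hpos : ∀ t ∈ s, X t ∈ posDefElts B) :
    ContDiffOn ℝ ∞ (fun t => cfc f (X t)) s := by
  intro t ht
  have h1 := contDiffAt_cfc hf (hpos t ht).1 (hpos t ht).2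
  refine (h1.comp_contDiffWithinAt t (hX t ht)).congr (fun y hy => ?_) ?_
  · simp only [Function.comp_apply, reCLM_of_isSelfAdjoint (hpos y hy).1]
  · simp only [Function.comp_apply, reCLM_of_isSelfAdjoint (hpos t ht).1]

end PositiveElements

/-! ### Smoothness and joint concavity of double operator sums -/

section Concavity

open Matrix

variable {B : Type*} [CStarAlgebra B] [FiniteDimensional ℂ B] (τ : FaithfulTrace B)

/-- A complex-linear map between finite-dimensional spaces is smooth over `ℝ`. -/
theorem contDiff_of_linear {E F : Type*} [NormedAddCommGroup E] [NormedSpace ℂ E]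
    [FiniteDimensional ℂ E] [NormedAddCommGroup F] [NormedSpace ℂ F] (L : E →ₗ[ℂ] F) :
    ContDiff ℝ ∞ L :=
  (L.toContinuousLinearMap.restrictScalars ℝ).contDiff

open scoped Matrix.Norms.L2Operator in
theorem contDiffOn_doubleOpSum (τ : FaithfulTrace B) {E : Type*} [NormedAddCommGroup E]
    [NormedSpace ℝ E] {θ : ℝ → ℝ → ℝ} (hθ : IsOneHomogeneous θ)
    (hs : ContDiffOn ℝ ∞ (fun x => θ x 1) (Set.Ioi 0)) {s : Set E} {a b : E → B}
    (ha : ContDiffOn ℝ ∞ a s) (hb : ContDiffOn ℝ ∞ b s) (ha' : ∀ t ∈ s, a t ∈ posDefElts B)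
    (hb' : ∀ t ∈ s, b t ∈ posDefElts B) :
    ContDiffOn ℝ ∞ (fun t => LinearMap.toContinuousLinearMap (doubleOpSum θ (a t) (b t))) s := by
  have hsqrt : ContDiffOn ℝ ∞ Real.sqrt (Set.Ioi 0) := fun x hx =>
    (Real.contDiffAt_sqrt (ne_of_gt hx)).contDiffWithinAt
  have hinv : ContDiffOn ℝ ∞ (fun x : ℝ => x⁻¹) (Set.Ioi 0) := fun x hx =>
    (contDiffAt_inv ℝ (ne_of_gt hx)).contDiffWithinAt
  have h1 : ContDiffOn ℝ ∞ (fun t => τ.rMat (cfc Real.sqrt (b t))) s :=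
    (contDiff_of_linear τ.rMat).comp_contDiffOn (contDiffOn_cfc hsqrt hb hb')
  have h2 : ContDiffOn ℝ ∞ (fun t => modMat τ (a t) (b t)) s :=
    ((contDiff_of_linear τ.lMat).comp_contDiffOn ha).mul
      ((contDiff_of_linear τ.rMat).comp_contDiffOn (contDiffOn_cfc hinv hb hb'))
  have h3 : ContDiffOn ℝ ∞ (fun t => cfc (fun x => θ x 1) (modMat τ (a t) (b t))) s :=
    contDiffOn_cfc hs h2 fun t ht =>
      ⟨(posDef_modMat τ (ha' t ht) (hb' t ht)).1,
        spectrum_subset_Ioi_of_posDef (posDef_modMat τ (ha' t ht) (hb' t ht))⟩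
  have h4 := contDiff_of_linear
    (LinearMap.toContinuousLinearMap.toLinearMap ∘ₗ τ.toMat.symm.toLinearMap :
      Matrix (Fin τ.dim) (Fin τ.dim) ℂ →ₗ[ℂ] (B →L[ℂ] B))
  refine (h4.comp_contDiffOn ((h1.mul h3).mul h1)).congr fun t ht => ?_
  have := toMat_doubleOpSum_eq_mean τ hθ (ha' t ht) (hb' t ht)
  simp only [Function.comp_apply, LinearMap.comp_apply, AlgEquiv.toLinearMap_apply]
  rw [← this, AlgEquiv.symm_apply_apply]
  rfl

/-- Joint concavity of double operator sums, by Jensen's inequality for `f(t) = θ(t, 1)` with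
`Xᵢ = (sᵢ Rᵢ)^{1/2} R^{-1/2}`, where `R = s₀ R₀ + s₁ R₁`. -/
theorem posSemidef_doubleOpSum_sub {θ : ℝ → ℝ → ℝ} (hθ : IsOneHomogeneous θ)
    (hs : ContDiffOn ℝ ∞ (fun x => θ x 1) (Set.Ioi 0)) (hm : IsOperatorMonotone fun x => θ x 1)
    {a₀ a₁ b₀ b₁ : B} (ha₀ : a₀ ∈ posDefElts B) (ha₁ : a₁ ∈ posDefElts B)
    (hb₀ : b₀ ∈ posDefElts B) (hb₁ : b₁ ∈ posDefElts B) {s : ℝ} (hs01 : s ∈ Set.Icc (0 : ℝ) 1) :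
    (τ.toMat (doubleOpSum θ ((1 - s) • a₀ + s • a₁) ((1 - s) • b₀ + s • b₁)) -
      ((1 - s : ℂ) • τ.toMat (doubleOpSum θ a₀ b₀) +
        (s : ℂ) • τ.toMat (doubleOpSum θ a₁ b₁))).PosSemidef := by
  set a := (1 - s) • a₀ + s • a₁ with ha_def
  set b := (1 - s) • b₀ + s • b₁ with hb_def
  have ha : a ∈ posDefElts B := convex_posDefElts ha₀ ha₁ hs01
  have hb : b ∈ posDefElts B := convex_posDefElts hb₀ hb₁ hs01
  have hlin : ∀ (L : B →ₗ[ℂ] Matrix (Fin τ.dim) (Fin τ.dim) ℂ) (x y : B),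
      L ((1 - s) • x + s • y) = (1 - s : ℂ) • L x + (s : ℂ) • L y := by
    intro L x y
    rw [← Complex.coe_smul, ← Complex.coe_smul, map_add, map_smul, map_smul]
    push_cast
    rfl
  -- the square root of the right multiplication by `c`
  let G : B → Matrix (Fin τ.dim) (Fin τ.dim) ℂ := fun c => τ.rMat (cfc Real.sqrt c)
  let G' := τ.rMat (cfc (fun x => (Real.sqrt x)⁻¹) b)
  have hGh : ∀ c, (G c)ᴴ = G c := fun c => τ.isSelfAdjoint_rMat (cfc_predicate Real.sqrt c)
  have hG'h : G'ᴴ = G' := τ.isSelfAdjoint_rMat (cfc_predicate (fun x => (Real.sqrt x)⁻¹) b)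
  have hmulcfc : ∀ (c : B), c ∈ posDefElts B → ∀ f g h : ℝ → ℝ, (∀ x, 0 < x → g x * f x = h x) →
      τ.rMat (cfc f c) * τ.rMat (cfc g c) = τ.rMat (cfc h c) := by
    intro c hc f g h hfg
    rw [← τ.rMat_mul, ← cfc_mul g f c (continuousOn_spectrum c _) (continuousOn_spectrum c _)]
    congr 1
    exact cfc_congr fun x hx => hfg x (hc.2 hx)
  have hcomm : ∀ x y, τ.rMat y * τ.lMat x = τ.lMat x * τ.rMat y := fun x y =>
    (τ.lMat_mul_rMat x y).symm
  have hGG : ∀ c ∈ posDefElts B, G c * G c = τ.rMat c := by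
    intro c hc
    have := hmulcfc c hc Real.sqrt Real.sqrt id fun x hx => Real.mul_self_sqrt hx.le
    rwa [cfc_id ℝ c hc.1] at this
  have hGG' : G b * G' = 1 := by
    have := hmulcfc b hb Real.sqrt (fun x => (Real.sqrt x)⁻¹) (fun _ => 1) fun x hx =>
      inv_mul_cancel₀ (Real.sqrt_pos.2 hx).ne'
    rwa [cfc_const_one ℝ b hb.1, τ.rMat_one] at this
  have hG'G : G' * G b = 1 := by
    have := hmulcfc b hb (fun x => (Real.sqrt x)⁻¹) Real.sqrt (fun _ => 1) fun x hx =>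
      mul_inv_cancel₀ (Real.sqrt_pos.2 hx).ne'
    rwa [cfc_const_one ℝ b hb.1, τ.rMat_one] at this
  have hG'G' : G' * G' = τ.rMat (cfc (fun x : ℝ => x⁻¹) b) :=
    hmulcfc b hb _ _ _ fun x hx => by
      rw [← mul_inv, Real.mul_self_sqrt hx.le]
  have hGinvG : ∀ c ∈ posDefElts B, G c * τ.rMat (cfc (fun x : ℝ => x⁻¹) c) * G c = 1 := by
    intro c hc
    have h1 := hmulcfc c hc Real.sqrt (fun x : ℝ => x⁻¹) (fun x => x⁻¹ * Real.sqrt x) fun x _ => rfl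
    have h2 := hmulcfc c hc (fun x => x⁻¹ * Real.sqrt x) Real.sqrt (fun _ => 1) fun x hx => by
      have h3 := Real.mul_self_sqrt hx.le
      calc Real.sqrt x * (x⁻¹ * Real.sqrt x) = x⁻¹ * (Real.sqrt x * Real.sqrt x) := by ring
        _ = 1 := by rw [h3, inv_mul_cancel₀ hx.ne']
    rw [cfc_const_one ℝ c hc.1, τ.rMat_one] at h2
    rw [← h2, ← h1]
  let X : ℝ → B → Matrix (Fin τ.dim) (Fin τ.dim) ℂ := fun r c =>
    ((Real.sqrt r : ℝ) : ℂ) • (G c * G')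
  have hXh : ∀ r c, (X r c)ᴴ = ((Real.sqrt r : ℝ) : ℂ) • (G' * G c) := by
    intro r c
    simp [X, Matrix.conjTranspose_smul, Matrix.conjTranspose_mul, hGh, hG'h]
  have hr : ∀ r : ℝ, 0 ≤ r → ((Real.sqrt r : ℝ) : ℂ) * ((Real.sqrt r : ℝ) : ℂ) = r := by
    intro r hr
    rw [← Complex.ofReal_mul, Real.mul_self_sqrt hr]
  have hXMX : ∀ r : ℝ, 0 ≤ r → ∀ c M, (X r c)ᴴ * M * X r c =
      (r : ℂ) • (G' * (G c * M * G c) * G') := by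
    intro r hr0 c M
    rw [hXh]
    simp only [X, Matrix.smul_mul, Matrix.mul_smul, smul_smul, hr r hr0, Matrix.mul_assoc]
  have hXX : (X (1 - s) b₀)ᴴ * X (1 - s) b₀ + (X s b₁)ᴴ * X s b₁ = 1 := by
    have h1 := hXMX (1 - s) (sub_nonneg.2 hs01.2) b₀ 1
    have h2 := hXMX s hs01.1 b₁ 1
    rw [Matrix.mul_one, Matrix.mul_one, hGG _ hb₀] at h1
    rw [Matrix.mul_one, Matrix.mul_one, hGG _ hb₁] at h2
    have h3 : (1 - s : ℂ) • τ.rMat b₀ + (s : ℂ) • τ.rMat b₁ = G b * G b := by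
      rw [hGG b hb, hb_def, hlin]
    rw [h1, h2]
    push_cast
    rw [← Matrix.smul_mul, ← Matrix.mul_smul, ← Matrix.smul_mul, ← Matrix.mul_smul,
      ← Matrix.add_mul, ← Matrix.mul_add, h3, ← Matrix.mul_assoc, hG'G, Matrix.one_mul, hGG']
  have hXT : ∀ r : ℝ, 0 ≤ r → ∀ x c, c ∈ posDefElts B → (X r c)ᴴ * modMat τ x c * X r c =
      (r : ℂ) • (τ.lMat x * (G' * G')) := by
    intro r hr0 x c hc
    have h1 : G c * modMat τ x c * G c = τ.lMat x := by
      rw [modMat, ← Matrix.mul_assoc]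
      simp only [G]
      rw [hcomm x, Matrix.mul_assoc, Matrix.mul_assoc, ← Matrix.mul_assoc (τ.rMat _)]
      have := hGinvG c hc
      simp only [G] at this
      rw [this, Matrix.mul_one]
    rw [hXMX r hr0, h1]
    simp only [G']
    rw [hcomm x, Matrix.mul_assoc]
  have hT : (X (1 - s) b₀)ᴴ * modMat τ a₀ b₀ * X (1 - s) b₀ +
      (X s b₁)ᴴ * modMat τ a₁ b₁ * X s b₁ = modMat τ a b := by
    rw [hXT _ (sub_nonneg.2 hs01.2) _ _ hb₀, hXT _ hs01.1 _ _ hb₁, modMat, ← hG'G', ha_def, hlin]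
    push_cast
    rw [Matrix.add_mul, Matrix.smul_mul, Matrix.smul_mul]
  have main := (hm.posSemidef_cfc_jensen hs (posDef_modMat τ ha₀ hb₀) (posDef_modMat τ ha₁ hb₁)
    hXX).conjTranspose_mul_mul_same (G b)
  rw [hT, hXMX _ (sub_nonneg.2 hs01.2), hXMX _ hs01.1, hGh] at main
  have hcancel : ∀ M, G b * (G' * M * G') * G b = M := by
    intro M
    rw [← Matrix.mul_assoc, ← Matrix.mul_assoc, hGG', Matrix.one_mul, Matrix.mul_assoc, hG'G,
      Matrix.mul_one]
  rw [Matrix.mul_sub, Matrix.sub_mul, Matrix.mul_add, Matrix.add_mul, Matrix.mul_smul,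
    Matrix.smul_mul, Matrix.mul_smul, Matrix.smul_mul, hcancel, hcancel] at main
  rw [toMat_doubleOpSum_eq_mean τ hθ ha hb, toMat_doubleOpSum_eq_mean τ hθ ha₀ hb₀,
    toMat_doubleOpSum_eq_mean τ hθ ha₁ hb₁]
  push_cast at main
  exact main

end Concavity

end QTransport

/-! ### The operator `𝓚_ρ` -/

namespace QTransport

namespace DifferentialStructure

section VForm

variable {A : Type*} [CStarAlgebra A] {τ : FaithfulTrace A} {K : Type*} {J : K → Type*}
  {B : K → Type*} [∀ k, CStarAlgebra (B k)] (D : DifferentialStructure τ J B)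

/-- The form `τ_j[V_j* ℓ_j(x) V_j r_j(y)]`. -/
noncomputable def vForm (k : K) (j : J k) (x y : A) : ℂ :=
  (D.traceB k).toLin (star (D.V k j) * D.left k j x * D.V k j * D.right k j y)

/-- The symmetry relation between `V_j` and `V_{j*}`. -/
theorem vForm_inv (k : K) (j : J k) (x y : A) :
    D.vForm k (D.inv k j) y x = D.vForm k j x y := by
  rw [vForm, vForm, D.symm k j x y, D.V_inv, star_star, mul_assoc, (D.traceB k).tracial,
    ← mul_assoc]

theorem star_vForm (k : K) (j : J k) (x y : A) :
    star (D.vForm k j x y) = D.vForm k j (star x) (star y) := by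
  rw [vForm, vForm, ← FaithfulTrace.toLin_star]
  simp only [star_mul, star_star, ← map_star]
  rw [(D.traceB k).tracial]
  simp only [mul_assoc]

/-- `⟨∂_j b, ℓ_j(P) (∂_j a) r_j(Q)⟩` in terms of the form `vForm`: expanding both derivatives
leaves four terms, each with one factor `V_j*` and one factor `V_j`. -/
theorem ip_partialD (k : K) (j : J k) (a b P Q : A) :
    (D.traceB k).ip (D.partialD k j b) (D.left k j P * D.partialD k j a * D.right k j Q) =
      D.vForm k j P (a * Q * star b) - D.vForm k j (P * a) (Q * star b) -
        D.vForm k j (star b * P) (a * Q) + D.vForm k j (star b * P * a) Q := by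
  have hcyc : ∀ x y : B k, (D.traceB k).toLin (star (D.right k j b) * x * y) =
      (D.traceB k).toLin (x * y * star (D.right k j b)) := fun x y => by
    rw [mul_assoc, (D.traceB k).tracial]
  simp only [FaithfulTrace.ip, partialD_apply, star_sub, star_mul, sub_mul, mul_sub, map_sub, vForm,
    map_mul, map_star]
  have h1 : (D.traceB k).toLin (star (D.right k j b) * star (D.V k j) *
      (D.left k j P * (D.V k j * D.right k j a) * D.right k j Q)) =
      (D.traceB k).toLin (star (D.V k j) * D.left k j P * D.V k j *
        (D.right k j a * D.right k j Q * star (D.right k j b))) := by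
    rw [hcyc]; simp only [mul_assoc]
  have h2 : (D.traceB k).toLin (star (D.right k j b) * star (D.V k j) *
      (D.left k j P * (D.left k j a * D.V k j) * D.right k j Q)) =
      (D.traceB k).toLin (star (D.V k j) * (D.left k j P * D.left k j a) * D.V k j *
        (D.right k j Q * star (D.right k j b))) := by
    rw [hcyc]; simp only [mul_assoc]
  rw [h1, h2]
  simp only [mul_assoc]
  ring

theorem partialD_one (k : K) (j : J k) : D.partialD k j 1 = 0 := by
  simp [partialD_apply]

theorem trace_one_ne_zero (D : DifferentialStructure τ J B) : τ.toLin 1 ≠ 0 := by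
  intro h
  have h1 : (1 : A) = 0 := τ.faithful 1 (by simpa using h)
  have h2 := D.σ_mem.2.2
  rw [← one_mul D.σ, h1, zero_mul, map_zero] at h2
  exact zero_ne_one h2

theorem star_ip {C : Type*} [CStarAlgebra C] (τ' : FaithfulTrace C) (a b : C) :
    star (τ'.ip a b) = τ'.ip b a := by
  rw [FaithfulTrace.ip, FaithfulTrace.ip, ← τ'.toLin_star, star_mul, star_star]

theorem posDef_toMat_doubleOpSum {C : Type*} [CStarAlgebra C] [FiniteDimensional ℂ C]
    (τ' : FaithfulTrace C) {θ : ℝ → ℝ → ℝ} (hpos : ∀ r s : ℝ, 0 < r → 0 < s → 0 < θ r s) {a b : C}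
    (ha : a ∈ posDefElts C) (hb : b ∈ posDefElts C) : (τ'.toMat (doubleOpSum θ a b)).PosDef := by
  rw [toMat_doubleOpSum]
  exact posDef_sum_smul (completeOrthogonalIdempotents_jointProj τ' ha.1 hb.1)
    (isSelfAdjoint_jointProj τ' a b) fun i =>
      hpos _ _ (ha.2 (mem_specFinset.1 i.1.2)) (hb.2 (mem_specFinset.1 i.2.2))

theorem posDef_toMat_mean [∀ k, FiniteDimensional ℂ (B k)] {θ : ∀ k, J k → ℝ → ℝ → ℝ}
    (hθ : D.IsMeanFamily θ) {ρ : A} (hρ : ρ ∈ posDefElts A) (k : K)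
    (j : J k) :
    ((D.traceB k).toMat (doubleOpSum (θ k j) (D.left k j ρ) (D.right k j ρ))).PosDef :=
  posDef_toMat_doubleOpSum (D.traceB k) (hθ.pos k j) (map_mem_posDefElts _ hρ)
    (map_mem_posDefElts _ hρ)

end VForm

section Ergodicity

variable {A : Type*} [CStarAlgebra A] [FiniteDimensional ℂ A] {τ : FaithfulTrace A}
  {K : Type*} [Fintype K] {J : K → Type*} [∀ k, Fintype (J k)]
  {B : K → Type*} [∀ k, CStarAlgebra (B k)] (D : DifferentialStructure τ J B)

theorem mem_span_one (hErg : D.Ergodic) {a : A} (h : ∀ k (j : J k), D.partialD k j a = 0) :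
    a ∈ Submodule.span ℂ {(1 : A)} := by
  have hE : LinearMap.ker D.generator = Submodule.span ℂ {(1 : A)} := hErg
  rw [← hE, LinearMap.mem_ker]
  simp [generator, h]

theorem eq_zero_of_trace_eq_zero (hErg : D.Ergodic) {a : A}
    (h : ∀ k (j : J k), D.partialD k j a = 0) (h0 : τ.toLin a = 0) : a = 0 := by
  obtain ⟨c, rfl⟩ := Submodule.mem_span_singleton.1 (D.mem_span_one hErg h)
  rw [map_smul, smul_eq_mul, mul_eq_zero] at h0
  rw [h0.resolve_right D.trace_one_ne_zero, zero_smul]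

/-- By ergodicity, the range of `𝓛†` consists of the elements of trace zero: the kernel of `𝓛† 𝓛`
is `ℂ 1`, so both spaces have codimension one. -/
theorem range_adjoint_generator (hErg : D.Ergodic) :
    LinearMap.range (adjoint τ τ D.generator) = LinearMap.ker τ.toLin := by
  have hE : LinearMap.ker D.generator = Submodule.span ℂ {(1 : A)} := hErg
  have hle : LinearMap.range (adjoint τ τ D.generator) ≤ LinearMap.ker τ.toLin := by
    rintro _ ⟨b, rfl⟩
    have h1 := ip_adjoint τ τ D.generator 1 b
    have h2 : D.generator 1 = 0 := by
      rw [← LinearMap.mem_ker, hE]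
      exact Submodule.mem_span_singleton_self 1
    rw [h2] at h1
    simpa [FaithfulTrace.ip] using h1
  refine Submodule.eq_of_le_of_finrank_le hle ?_
  have hker : LinearMap.ker (adjoint τ τ D.generator ∘ₗ D.generator) ≤
      LinearMap.ker D.generator := by
    intro a ha
    rw [LinearMap.mem_ker, LinearMap.comp_apply] at ha
    have h1 := ip_adjoint τ τ D.generator a (D.generator a)
    rw [ha] at h1
    rw [LinearMap.mem_ker]
    refine τ.faithful _ ?_
    simpa [FaithfulTrace.ip] using h1.symm
  have h1 := LinearMap.finrank_range_add_finrank_ker (adjoint τ τ D.generator ∘ₗ D.generator)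
  have h2 := LinearMap.finrank_range_add_finrank_ker τ.toLin
  have h3 : Module.finrank ℂ (LinearMap.ker (adjoint τ τ D.generator ∘ₗ D.generator)) ≤ 1 := by
    refine (Submodule.finrank_mono hker).trans ?_
    rw [hE]
    exact (finrank_span_le_card ({1} : Set A)).trans (by simp)
  have h4 : Module.finrank ℂ (LinearMap.range (adjoint τ τ D.generator ∘ₗ D.generator)) ≤
      Module.finrank ℂ (LinearMap.range (adjoint τ τ D.generator)) :=
    Submodule.finrank_mono (LinearMap.range_comp_le_range _ _)
  have h5 : LinearMap.range τ.toLin = ⊤ := by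
    rw [LinearMap.range_eq_top]
    intro z
    exact ⟨(z / τ.toLin 1) • 1, by
      rw [map_smul, smul_eq_mul, div_mul_cancel₀ _ D.trace_one_ne_zero]⟩
  rw [h5, finrank_top, Module.finrank_self] at h2
  omega

/-- The tangent space consists of the hermitian elements of trace zero. -/
theorem mem_tangent_iff (hErg : D.Ergodic) {a : A} :
    a ∈ D.tangent ↔ IsSelfAdjoint a ∧ τ.toLin a = 0 := by
  rw [tangent, D.range_adjoint_generator hErg, Set.mem_inter_iff, and_comm]
  rfl

end Ergodicity

section OperatorK

open Matrix

variable {A : Type*} [CStarAlgebra A] [FiniteDimensional ℂ A] {τ : FaithfulTrace A}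
  {K : Type*} [Fintype K] {J : K → Type*} [∀ k, Fintype (J k)]
  {B : K → Type*} [∀ k, CStarAlgebra (B k)] [∀ k, FiniteDimensional ℂ (B k)]
  (D : DifferentialStructure τ J B) {θ : ∀ k, J k → ℝ → ℝ → ℝ}

theorem ip_opK (θ : ∀ k, J k → ℝ → ℝ → ℝ) (ρ a b : A) :
    τ.ip a (D.opK θ ρ b) = ∑ k, ∑ j : J k, (D.traceB k).ip (D.partialD k j a)
      (doubleOpSum (θ k j) (D.left k j ρ) (D.right k j ρ) (D.partialD k j b)) := by
  have h : D.opK θ ρ b = ∑ k, ∑ j : J k, adjoint τ (D.traceB k) (D.partialD k j)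
      (doubleOpSum (θ k j) (D.left k j ρ) (D.right k j ρ) (D.partialD k j b)) := by
    simp [opK]
  rw [h, FaithfulTrace.ip, Finset.mul_sum, map_sum]
  refine Finset.sum_congr rfl fun k _ => ?_
  rw [Finset.mul_sum, map_sum]
  exact Finset.sum_congr rfl fun j _ => ip_adjoint τ (D.traceB k) (D.partialD k j) a _

theorem specProj_eq_zero {C : Type*} [CStarAlgebra C] {a : C} {x : ℝ} (hx : x ∉ spectrum ℝ a) :
    specProj a x = 0 := by
  rw [specProj, ← cfc_zero ℝ a]
  refine cfc_congr fun y hy => ?_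
  have : y ≠ x := fun h => hx (h ▸ hy)
  simp [this]

theorem map_specProj {C : Type*} [CStarAlgebra C] (φ : A →⋆ₐ[ℂ] C) {a : A}
    (ha : IsSelfAdjoint a) (x : ℝ) : φ (specProj a x) = specProj (φ a) x := by
  have hcont : Continuous φ := φ.toAlgHom.toLinearMap.continuous_of_finiteDimensional
  exact StarAlgHomClass.map_cfc (R := ℝ) (S := ℂ) φ _ a (continuousOn_spectrum a _) hcont ha
    (ha.map φ)

/-- A double operator sum of images of one element under two *-homomorphisms, as a sum over the
spectrum of that element. -/
theorem doubleOpSum_map {C : Type*} [CStarAlgebra C] [FiniteDimensional ℂ C] (φ ψ : A →⋆ₐ[ℂ] C)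
    {ρ : A} (hρ : IsSelfAdjoint ρ) (θ : ℝ → ℝ → ℝ) (c : C) :
    doubleOpSum θ (φ ρ) (ψ ρ) c = ∑ x ∈ specFinset ρ, ∑ y ∈ specFinset ρ,
      (θ x y : ℂ) • (φ (specProj ρ x) * c * ψ (specProj ρ y)) := by
  have hsub : ∀ χ : A →⋆ₐ[ℂ] C, specFinset (χ ρ) ⊆ specFinset ρ := fun χ x hx =>
    mem_specFinset.2 (AlgHom.spectrum_apply_subset (χ.toAlgHom.restrictScalars ℝ) ρ
      (mem_specFinset.1 hx))
  have hz : ∀ χ : A →⋆ₐ[ℂ] C, ∀ x, x ∉ specFinset (χ ρ) → specProj (χ ρ) x = 0 := fun χ x hx =>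
    specProj_eq_zero fun h => hx (mem_specFinset.2 h)
  simp only [doubleOpSum, LinearMap.sum_apply, LinearMap.smul_apply, LinearMap.comp_apply,
    LinearMap.mulLeft_apply, LinearMap.mulRight_apply, map_specProj _ hρ]
  rw [Finset.sum_subset (hsub φ) fun x _ hx => by simp [hz φ x hx]]
  refine Finset.sum_congr rfl fun x _ => ?_
  rw [Finset.sum_subset (hsub ψ) fun y _ hy => by simp [hz ψ y hy]]
  exact Finset.sum_congr rfl fun y _ => by rw [mul_assoc]

/-- `𝓚_ρ` preserves adjoints, because the contributions of `j` and `j*` are exchanged. -/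
theorem star_ip_opK (hθ : D.IsMeanFamily θ) {ρ : A} (hρ : ρ ∈ posDefElts A) (a b : A) :
    star (τ.ip (star b) (D.opK θ ρ (star a))) = τ.ip b (D.opK θ ρ a) := by
  rw [ip_opK, ip_opK, star_sum]
  refine Finset.sum_congr rfl fun k _ => ?_
  rw [star_sum]
  have hexp : ∀ (j : J k) (a b : A), (D.traceB k).ip (D.partialD k j b)
      (doubleOpSum (θ k j) (D.left k j ρ) (D.right k j ρ) (D.partialD k j a)) =
      ∑ x ∈ specFinset ρ, ∑ y ∈ specFinset ρ, (θ k j x y : ℂ) *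
        (D.vForm k j (specProj ρ x) (a * specProj ρ y * star b) -
          D.vForm k j (specProj ρ x * a) (specProj ρ y * star b) -
          D.vForm k j (star b * specProj ρ x) (a * specProj ρ y) +
          D.vForm k j (star b * specProj ρ x * a) (specProj ρ y)) := by
    intro j a b
    rw [doubleOpSum_map _ _ hρ.1, FaithfulTrace.ip, Finset.mul_sum, map_sum]
    refine Finset.sum_congr rfl fun x _ => ?_
    rw [Finset.mul_sum, map_sum]
    refine Finset.sum_congr rfl fun y _ => ?_
    rw [mul_smul_comm, map_smul, smul_eq_mul, ← D.ip_partialD k j a b]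
    rfl
  let e : Equiv.Perm (J k) := Function.Involutive.toPerm (D.inv k) (D.inv_inv k)
  rw [← Equiv.sum_comp e]
  refine Finset.sum_congr rfl fun j _ => ?_
  have hej : e j = D.inv k j := rfl
  rw [hej, hexp, hexp, star_sum, Finset.sum_comm]
  simp only [star_sum]
  refine Finset.sum_congr rfl fun x hx => ?_
  refine Finset.sum_congr rfl fun y hy => ?_
  have hP : ∀ z, star (specProj ρ z) = specProj ρ z := fun z => (isSelfAdjoint_specProj ρ z).star_eq
  have hx0 : 0 ≤ x := le_of_lt (Set.mem_Ioi.1 (hρ.2 (mem_specFinset.1 hx)))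
  have hy0 : 0 ≤ y := le_of_lt (Set.mem_Ioi.1 (hρ.2 (mem_specFinset.1 hy)))
  rw [← hθ.symm k j y x hy0 hx0]
  simp only [star_mul', star_add, star_sub, star_vForm, star_mul, star_star, hP, vForm_inv,
    Complex.star_def, Complex.conj_ofReal, mul_assoc]
  ring

theorem opK_star (hθ : D.IsMeanFamily θ) {ρ : A} (hρ : ρ ∈ posDefElts A) (a : A) :
    D.opK θ ρ (star a) = star (D.opK θ ρ a) := by
  rw [← sub_eq_zero]
  refine τ.faithful _ ?_
  set c := D.opK θ ρ (star a) - star (D.opK θ ρ a) with hc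
  have h := D.star_ip_opK hθ hρ a (star c)
  rw [star_star] at h
  have h2 : τ.ip c (D.opK θ ρ (star a)) = star (τ.ip (star c) (D.opK θ ρ a)) := by
    rw [← h, star_star]
  have h3 : star (τ.ip (star c) (D.opK θ ρ a)) = τ.toLin (star c * star (D.opK θ ρ a)) := by
    rw [FaithfulTrace.ip, ← τ.toLin_star, star_star, star_mul, τ.tracial]
  rw [h3, FaithfulTrace.ip] at h2
  rw [hc, mul_sub, map_sub, ← hc, h2, sub_self]

theorem ip_opK_eq_dotProduct (θ : ∀ k, J k → ℝ → ℝ → ℝ) (ρ a b : A) :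
    τ.ip a (D.opK θ ρ b) = ∑ k, ∑ j : J k,
      star ((D.traceB k).coords (D.partialD k j a)) ⬝ᵥ
        ((D.traceB k).toMat (doubleOpSum (θ k j) (D.left k j ρ) (D.right k j ρ)) *ᵥ
          (D.traceB k).coords (D.partialD k j b)) := by
  rw [ip_opK]
  exact Finset.sum_congr rfl fun k _ => Finset.sum_congr rfl fun j _ =>
    (D.traceB k).ip_apply_eq _ _ _

theorem ip_opK_symm (hθ : D.IsMeanFamily θ) {ρ : A} (hρ : ρ ∈ posDefElts A) (a b : A) :
    τ.ip (D.opK θ ρ a) b = τ.ip a (D.opK θ ρ b) := by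
  rw [← star_ip, ip_opK_eq_dotProduct, ip_opK_eq_dotProduct, star_sum]
  refine Finset.sum_congr rfl fun k _ => ?_
  rw [star_sum]
  refine Finset.sum_congr rfl fun j _ => ?_
  have h := (D.posDef_toMat_mean hθ hρ k j).1
  rw [← Matrix.star_dotProduct_star, star_star, Matrix.star_mulVec, h.eq,
    Matrix.dotProduct_mulVec]

theorem ip_opK_nonneg (hθ : D.IsMeanFamily θ) {ρ : A} (hρ : ρ ∈ posDefElts A) (a : A) :
    0 ≤ τ.ip a (D.opK θ ρ a) := by
  rw [ip_opK_eq_dotProduct]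
  exact Finset.sum_nonneg fun k _ => Finset.sum_nonneg fun j _ =>
    (D.posDef_toMat_mean hθ hρ k j).posSemidef.dotProduct_mulVec_nonneg _

/-- The double operator sums are positive definite, so `⟨a, 𝓚_ρ a⟩ = 0` forces all derivatives of
`a` to vanish. -/
theorem partialD_eq_zero (hθ : D.IsMeanFamily θ) {ρ : A} (hρ : ρ ∈ posDefElts A) {a : A}
    (h : τ.ip a (D.opK θ ρ a) = 0) (k : K) (j : J k) : D.partialD k j a = 0 := by
  rw [ip_opK_eq_dotProduct] at h
  have hnn := fun k (j : J k) =>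
    (D.posDef_toMat_mean hθ hρ k j).posSemidef.dotProduct_mulVec_nonneg
      ((D.traceB k).coords (D.partialD k j a))
  have h1 := (Finset.sum_eq_zero_iff_of_nonneg fun k _ =>
    Finset.sum_nonneg fun j _ => hnn k j).1 h k (Finset.mem_univ k)
  have h2 := (Finset.sum_eq_zero_iff_of_nonneg fun j _ => hnn k j).1 h1 j (Finset.mem_univ j)
  by_contra hne
  have hne' : (D.traceB k).coords (D.partialD k j a) ≠ 0 := by simpa using hne
  exact ((D.posDef_toMat_mean hθ hρ k j).dotProduct_mulVec_pos hne').ne' h2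

theorem trace_opK (θ : ∀ k, J k → ℝ → ℝ → ℝ) (ρ a : A) : τ.toLin (D.opK θ ρ a) = 0 := by
  have h := D.ip_opK θ ρ 1 a
  rw [FaithfulTrace.ip, star_one, one_mul] at h
  rw [h]
  exact Finset.sum_eq_zero fun k _ => Finset.sum_eq_zero fun j _ => by
    rw [partialD_one, FaithfulTrace.ip, star_zero, zero_mul, map_zero]

end OperatorK

end DifferentialStructure

end QTransport

/-! ### The metric tensor -/

namespace QTransport

namespace DifferentialStructure

theorem IsMeanFamily.contDiffOn_slice {A : Type*} [CStarAlgebra A] {τ : FaithfulTrace A}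
    {K : Type*} {J : K → Type*} {B : K → Type*} [∀ k, CStarAlgebra (B k)]
    {D : DifferentialStructure τ J B} {θ : ∀ k, J k → ℝ → ℝ → ℝ} (hθ : D.IsMeanFamily θ)
    (k : K) (j : J k) :
    ContDiffOn ℝ ∞ (fun x => θ k j x 1) (Set.Ioi 0) :=
  (hθ.smooth k j).comp (contDiffOn_id.prodMk contDiffOn_const)
    fun _ hx => ⟨hx, Set.mem_Ioi.2 one_pos⟩

section Summands

variable {A : Type*} [CStarAlgebra A] [FiniteDimensional ℂ A] {τ : FaithfulTrace A}
  {K : Type*} {J : K → Type*} {B : K → Type*} [∀ k, CStarAlgebra (B k)]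
  [∀ k, FiniteDimensional ℂ (B k)] (D : DifferentialStructure τ J B)
  {θ : ∀ k, J k → ℝ → ℝ → ℝ} {E : Type*} [NormedAddCommGroup E] [NormedSpace ℝ E]

/-- The linear map `R ↦ S R T`. -/
noncomputable def sandwich {A C : Type*} [NormedAddCommGroup A] [NormedSpace ℂ A]
    [FiniteDimensional ℂ A] [NormedAddCommGroup C] [NormedSpace ℂ C] (S : C →ₗ[ℂ] A)
    (T : A →ₗ[ℂ] C) : (C →L[ℂ] C) →ₗ[ℂ] (A →L[ℂ] A) where
  toFun R := LinearMap.toContinuousLinearMap (S ∘ₗ R.toLinearMap ∘ₗ T)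
  map_add' R R' := by ext a; simp
  map_smul' c R := by ext a; simp

/-- The summand of `𝓚_ρ` with index `j`, as a continuous linear map. -/
noncomputable def opKTerm (θ : ∀ k, J k → ℝ → ℝ → ℝ) (k : K) (j : J k) (ρ : A) : A →L[ℂ] A :=
  sandwich (adjoint τ (D.traceB k) (D.partialD k j)) (D.partialD k j)
    (LinearMap.toContinuousLinearMap (doubleOpSum (θ k j) (D.left k j ρ) (D.right k j ρ)))

theorem contDiffOn_opKTerm (hθ : D.IsMeanFamily θ)
    (hHom : ∀ k (j : J k), IsOneHomogeneous (θ k j)) {s : Set E} {X : E → A}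
    (hX : ContDiffOn ℝ ∞ X s) (hpos : ∀ t ∈ s, X t ∈ posDefElts A) (k : K) (j : J k) :
    ContDiffOn ℝ ∞ (fun t => D.opKTerm θ k j (X t)) s := by
  have h2 := contDiffOn_doubleOpSum (D.traceB k) (hHom k j) (hθ.contDiffOn_slice k j)
    ((contDiff_of_linear (D.left k j).toAlgHom.toLinearMap).comp_contDiffOn hX)
    ((contDiff_of_linear (D.right k j).toAlgHom.toLinearMap).comp_contDiffOn hX)
    (fun t ht => map_mem_posDefElts (D.left k j) (hpos t ht))
    (fun t ht => map_mem_posDefElts (D.right k j) (hpos t ht))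
  exact (contDiff_of_linear (sandwich (adjoint τ (D.traceB k) (D.partialD k j))
    (D.partialD k j))).comp_contDiffOn h2

end Summands

section MetricTensor

variable {A : Type*} [CStarAlgebra A] [FiniteDimensional ℂ A] {τ : FaithfulTrace A}
  {K : Type*} [Fintype K] {J : K → Type*} [∀ k, Fintype (J k)]
  {B : K → Type*} [∀ k, CStarAlgebra (B k)] [∀ k, FiniteDimensional ℂ (B k)]
  (D : DifferentialStructure τ J B) {θ : ∀ k, J k → ℝ → ℝ → ℝ}

/-- The hermitian elements of trace zero. -/
def traceZero {A : Type*} [CStarAlgebra A] (τ : FaithfulTrace A) : Set A :=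
  {v | IsSelfAdjoint v ∧ τ.toLin v = 0}

/-- The operator `a ↦ 𝓚_ρ a + τ[a] 1`, which is invertible on all of `A` and agrees with `𝓚_ρ` on
elements of trace zero. -/
noncomputable def opKPlus (θ : ∀ k, J k → ℝ → ℝ → ℝ) (ρ : A) : A →L[ℂ] A :=
  LinearMap.toContinuousLinearMap (D.opK θ ρ + τ.toLin.smulRight 1)

theorem opKPlus_apply (θ : ∀ k, J k → ℝ → ℝ → ℝ) (ρ a : A) :
    D.opKPlus θ ρ a = D.opK θ ρ a + τ.toLin a • 1 := rfl

theorem trace_opKPlus (θ : ∀ k, J k → ℝ → ℝ → ℝ) (ρ a : A) :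
    τ.toLin (D.opKPlus θ ρ a) = τ.toLin a * τ.toLin 1 := by
  rw [opKPlus_apply, map_add, trace_opK, zero_add, map_smul, smul_eq_mul]

/-- If `𝓚_ρ a + τ[a] 1 = 0`, then `τ[a] = 0` by taking traces and `a ∈ ℂ 1` by ergodicity. -/
theorem isUnit_opKPlus (hErg : D.Ergodic) (hθ : D.IsMeanFamily θ) {ρ : A}
    (hρ : ρ ∈ posDefElts A) : IsUnit (D.opKPlus θ ρ) := by
  have hinj : Function.Injective (D.opKPlus θ ρ).toLinearMap := by
    rw [← LinearMap.ker_eq_bot, LinearMap.ker_eq_bot']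
    intro a ha
    have ha' : D.opKPlus θ ρ a = 0 := ha
    have h0 : τ.toLin a = 0 := by
      have := D.trace_opKPlus θ ρ a
      rw [ha', map_zero, eq_comm, mul_eq_zero] at this
      exact this.resolve_right D.trace_one_ne_zero
    rw [opKPlus_apply, h0, zero_smul, add_zero] at ha'
    refine D.eq_zero_of_trace_eq_zero hErg (fun k j => ?_) h0
    refine D.partialD_eq_zero hθ hρ ?_ k j
    rw [ha', FaithfulTrace.ip, mul_zero, map_zero]
  let e := (LinearEquiv.ofInjectiveEndo _ hinj).toContinuousLinearEquiv
  exact ⟨ContinuousLinearEquiv.toUnit e, by ext a; rfl⟩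

/-- The solution `a` of `𝓚_ρ a + τ[a] 1 = v`. If `τ[v] = 0`, this is the solution of `𝓚_ρ a = v`
with `τ[a] = 0`. -/
noncomputable def potential (θ : ∀ k, J k → ℝ → ℝ → ℝ) (ρ v : A) : A :=
  Ring.inverse (D.opKPlus θ ρ) v

theorem opKPlus_potential (hErg : D.Ergodic) (hθ : D.IsMeanFamily θ) {ρ : A}
    (hρ : ρ ∈ posDefElts A) (v : A) : D.opKPlus θ ρ (D.potential θ ρ v) = v := by
  have := Ring.mul_inverse_cancel _ (D.isUnit_opKPlus hErg hθ hρ)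
  exact congrArg (fun T : A →L[ℂ] A => T v) this

theorem potential_opKPlus (hErg : D.Ergodic) (hθ : D.IsMeanFamily θ) {ρ : A}
    (hρ : ρ ∈ posDefElts A) (a : A) : D.potential θ ρ (D.opKPlus θ ρ a) = a := by
  have := Ring.inverse_mul_cancel _ (D.isUnit_opKPlus hErg hθ hρ)
  exact congrArg (fun T : A →L[ℂ] A => T a) this

theorem potential_opK (hErg : D.Ergodic) (hθ : D.IsMeanFamily θ) {ρ : A}
    (hρ : ρ ∈ posDefElts A) {a : A} (ha : a ∈ traceZero τ) :
    D.potential θ ρ (D.opK θ ρ a) = a := by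
  have h := D.potential_opKPlus hErg hθ hρ a
  rwa [opKPlus_apply, ha.2, zero_smul, add_zero] at h

theorem trace_potential (hErg : D.Ergodic) (hθ : D.IsMeanFamily θ) {ρ : A}
    (hρ : ρ ∈ posDefElts A) {v : A} (hv : v ∈ traceZero τ) : τ.toLin (D.potential θ ρ v) = 0 := by
  have := D.trace_opKPlus θ ρ (D.potential θ ρ v)
  rw [D.opKPlus_potential hErg hθ hρ, hv.2, eq_comm, mul_eq_zero] at this
  exact this.resolve_right D.trace_one_ne_zero

theorem opK_potential (hErg : D.Ergodic) (hθ : D.IsMeanFamily θ) {ρ : A}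
    (hρ : ρ ∈ posDefElts A) {v : A} (hv : v ∈ traceZero τ) :
    D.opK θ ρ (D.potential θ ρ v) = v := by
  have h := D.opKPlus_potential hErg hθ hρ v
  rwa [opKPlus_apply, D.trace_potential hErg hθ hρ hv, zero_smul, add_zero] at h

theorem potential_mem (hErg : D.Ergodic) (hθ : D.IsMeanFamily θ) {ρ : A}
    (hρ : ρ ∈ posDefElts A) {v : A} (hv : v ∈ traceZero τ) :
    D.potential θ ρ v ∈ traceZero τ := by
  have h0 := D.trace_potential hErg hθ hρ hv
  refine ⟨?_, h0⟩
  set a := D.potential θ ρ v with ha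
  have h1 : D.opKPlus θ ρ (star a) = v := by
    rw [opKPlus_apply, D.opK_star hθ hρ, D.opK_potential hErg hθ hρ hv, hv.1.star_eq, τ.toLin_star,
      h0, star_zero, zero_smul, add_zero]
  rw [isSelfAdjoint_iff, ← D.potential_opKPlus hErg hθ hρ (star a), h1]

/-- The squared length `⟨v, 𝓚_ρ⁻¹ v⟩` of a tangent vector `v` at `ρ`. It is defined for all `v`,
with `𝓚_ρ` replaced by the invertible operator `a ↦ 𝓚_ρ a + τ[a] 1`. -/
noncomputable def metric (θ : ∀ k, J k → ℝ → ℝ → ℝ) (ρ v : A) : ℝ :=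
  (τ.ip v (D.potential θ ρ v)).re

theorem metric_smul (θ : ∀ k, J k → ℝ → ℝ → ℝ) (ρ v : A) (c : ℝ) :
    D.metric θ ρ (c • v) = c ^ 2 * D.metric θ ρ v := by
  have h : D.potential θ ρ (c • v) = c • D.potential θ ρ v := by
    rw [potential, potential, ← Complex.coe_smul, map_smul, Complex.coe_smul]
  rw [metric, metric, h, FaithfulTrace.ip, FaithfulTrace.ip, star_smul, star_trivial,
    smul_mul_smul_comm, ← Complex.coe_smul, map_smul, smul_eq_mul, Complex.re_ofReal_mul, sq]

theorem metric_opK (hErg : D.Ergodic) (hθ : D.IsMeanFamily θ) {ρ : A}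
    (hρ : ρ ∈ posDefElts A) {a : A} (ha : a ∈ traceZero τ) :
    D.metric θ ρ (D.opK θ ρ a) = (τ.ip (D.opK θ ρ a) a).re := by
  rw [metric, D.potential_opK hErg hθ hρ ha]

theorem ip_opKPlus (θ : ∀ k, J k → ℝ → ℝ → ℝ) (ρ a b : A) :
    τ.ip a (D.opKPlus θ ρ b) = τ.ip a (D.opK θ ρ b) + star (τ.toLin a) * τ.toLin b := by
  rw [opKPlus_apply, FaithfulTrace.ip, mul_add, map_add, mul_smul_comm, mul_one, map_smul,
    τ.toLin_star, smul_eq_mul, mul_comm (τ.toLin b)]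
  rfl

theorem ip_opKPlus_symm (hθ : D.IsMeanFamily θ) {ρ : A} (hρ : ρ ∈ posDefElts A) (a b : A) :
    τ.ip (D.opKPlus θ ρ a) b = τ.ip a (D.opKPlus θ ρ b) := by
  rw [← star_ip, ip_opKPlus, ip_opKPlus, star_add, star_ip, D.ip_opK_symm hθ hρ, star_mul,
    star_star]

theorem ip_opKPlus_nonneg (hθ : D.IsMeanFamily θ) {ρ : A} (hρ : ρ ∈ posDefElts A) (a : A) :
    0 ≤ τ.ip a (D.opKPlus θ ρ a) := by
  rw [ip_opKPlus]
  exact add_nonneg (D.ip_opK_nonneg hθ hρ a) (star_mul_self_nonneg _)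

/-- The dual variational formula: `2 ⟨v, b⟩ - ⟨b, 𝓚_ρ b⟩ ≤ ⟨v, 𝓚_ρ⁻¹ v⟩`, with equality for
`b = 𝓚_ρ⁻¹ v`, where `𝓚_ρ` stands for `a ↦ 𝓚_ρ a + τ[a] 1`. -/
theorem two_mul_ip_sub_le_metric (hErg : D.Ergodic) (hθ : D.IsMeanFamily θ) {ρ : A}
    (hρ : ρ ∈ posDefElts A) (v b : A) :
    2 * (τ.ip v b).re - (τ.ip b (D.opKPlus θ ρ b)).re ≤ D.metric θ ρ v := by
  set a := D.potential θ ρ v with ha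
  have hKa : D.opKPlus θ ρ a = v := D.opKPlus_potential hErg hθ hρ v
  have h1 := (Complex.nonneg_iff.1 (D.ip_opKPlus_nonneg hθ hρ (b - a))).1
  have h2 : τ.ip (b - a) (D.opKPlus θ ρ (b - a)) =
      τ.ip b (D.opKPlus θ ρ b) - τ.ip b v - τ.ip v b + τ.ip v a := by
    have h3 : τ.ip a (D.opKPlus θ ρ b) = τ.ip v b := by rw [← D.ip_opKPlus_symm hθ hρ, hKa]
    have h4 : τ.ip a v = τ.ip v a := by
      conv_lhs => rw [← hKa]
      rw [← D.ip_opKPlus_symm hθ hρ, hKa]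
    rw [map_sub, hKa]
    have h5 : ∀ x y z w : A, τ.ip (x - y) (z - w) =
        τ.ip x z - τ.ip x w - τ.ip y z + τ.ip y w := by
      intro x y z w
      simp only [FaithfulTrace.ip, star_sub, sub_mul, mul_sub, map_sub]
      ring
    rw [h5, h3, h4]
  have h6 : (τ.ip b v).re = (τ.ip v b).re := by
    rw [← star_ip, Complex.star_def, Complex.conj_re]
  rw [h2] at h1
  simp only [Complex.add_re, Complex.sub_re, h6] at h1
  rw [metric, ← ha]
  linarith

/-- The case of equality in `two_mul_ip_sub_le_metric`. -/
theorem metric_eq (hErg : D.Ergodic) (hθ : D.IsMeanFamily θ) {ρ : A}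
    (hρ : ρ ∈ posDefElts A) (v : A) :
    D.metric θ ρ v = 2 * (τ.ip v (D.potential θ ρ v)).re -
      (τ.ip (D.potential θ ρ v) (D.opKPlus θ ρ (D.potential θ ρ v))).re := by
  rw [← D.ip_opKPlus_symm hθ hρ, D.opKPlus_potential hErg hθ hρ, metric]
  ring

theorem metric_nonneg (hErg : D.Ergodic) (hθ : D.IsMeanFamily θ) {ρ : A}
    (hρ : ρ ∈ posDefElts A) (v : A) : 0 ≤ D.metric θ ρ v := by
  have := D.two_mul_ip_sub_le_metric hErg hθ hρ v 0
  simpa [FaithfulTrace.ip] using this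

/-- `𝓚_ρ` is a concave function of `ρ`. -/
theorem ip_opK_concave (hθ : D.IsMeanFamily θ) (hHom : ∀ k (j : J k), IsOneHomogeneous (θ k j))
    (hMon : ∀ k (j : J k), IsOperatorMonotone (fun x => θ k j x 1)) {ρ₀ ρ₁ : A}
    (h₀ : ρ₀ ∈ posDefElts A) (h₁ : ρ₁ ∈ posDefElts A) {s : ℝ} (hs : s ∈ Set.Icc (0 : ℝ) 1) (b : A) :
    (1 - s) * (τ.ip b (D.opK θ ρ₀ b)).re + s * (τ.ip b (D.opK θ ρ₁ b)).re ≤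
      (τ.ip b (D.opK θ ((1 - s) • ρ₀ + s • ρ₁) b)).re := by
  have key : (1 - s : ℂ) * τ.ip b (D.opK θ ρ₀ b) + (s : ℂ) * τ.ip b (D.opK θ ρ₁ b) ≤
      τ.ip b (D.opK θ ((1 - s) • ρ₀ + s • ρ₁) b) := by
    simp only [ip_opK_eq_dotProduct, Finset.mul_sum, ← Finset.sum_add_distrib]
    refine Finset.sum_le_sum fun k _ => Finset.sum_le_sum fun j _ => ?_
    have hmap : ∀ φ : A →⋆ₐ[ℂ] B k, φ ((1 - s) • ρ₀ + s • ρ₁) = (1 - s) • φ ρ₀ + s • φ ρ₁ := by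
      intro φ
      rw [← Complex.coe_smul, ← Complex.coe_smul, map_add, map_smul, map_smul, Complex.coe_smul,
        Complex.coe_smul]
    have h := (posSemidef_doubleOpSum_sub (D.traceB k) (hHom k j) (hθ.contDiffOn_slice k j)
      (hMon k j) (map_mem_posDefElts (D.left k j) h₀) (map_mem_posDefElts (D.left k j) h₁)
      (map_mem_posDefElts (D.right k j) h₀) (map_mem_posDefElts (D.right k j) h₁)
      hs).dotProduct_mulVec_nonneg ((D.traceB k).coords (D.partialD k j b))
    rw [Matrix.sub_mulVec, dotProduct_sub, Matrix.add_mulVec, dotProduct_add, Matrix.smul_mulVec,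
      Matrix.smul_mulVec, dotProduct_smul, dotProduct_smul, sub_nonneg, smul_eq_mul,
      smul_eq_mul, ← hmap, ← hmap] at h
    exact h
  have := (Complex.le_def.1 key).1
  rw [Complex.add_re] at this
  have h1 : (1 - s : ℂ) = ((1 - s : ℝ) : ℂ) := by push_cast; rfl
  rwa [h1, Complex.re_ofReal_mul, Complex.re_ofReal_mul] at this

/-- The metric tensor is jointly convex, as a supremum of jointly convex functions. -/
theorem metric_convex (hErg : D.Ergodic) (hθ : D.IsMeanFamily θ)
    (hHom : ∀ k (j : J k), IsOneHomogeneous (θ k j))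
    (hMon : ∀ k (j : J k), IsOperatorMonotone (fun x => θ k j x 1)) {ρ₀ ρ₁ v₀ v₁ : A}
    (h₀ : ρ₀ ∈ posDefElts A) (h₁ : ρ₁ ∈ posDefElts A) {s : ℝ} (hs : s ∈ Set.Icc (0 : ℝ) 1) :
    D.metric θ ((1 - s) • ρ₀ + s • ρ₁) ((1 - s) • v₀ + s • v₁) ≤
      (1 - s) * D.metric θ ρ₀ v₀ + s * D.metric θ ρ₁ v₁ := by
  have hρ := convex_posDefElts h₀ h₁ hs
  have hlin : ∀ x : A, (τ.ip ((1 - s) • v₀ + s • v₁) x).re =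
      (1 - s) * (τ.ip v₀ x).re + s * (τ.ip v₁ x).re := by
    intro x
    rw [FaithfulTrace.ip, star_add, star_smul, star_smul, star_trivial (1 - s), star_trivial s,
      add_mul, smul_mul_assoc, smul_mul_assoc, ← Complex.coe_smul, ← Complex.coe_smul, map_add,
      map_smul, map_smul, smul_eq_mul, smul_eq_mul, Complex.add_re, Complex.re_ofReal_mul,
      Complex.re_ofReal_mul]
    rfl
  rw [D.metric_eq hErg hθ hρ]
  set b := D.potential θ ((1 - s) • ρ₀ + s • ρ₁) ((1 - s) • v₀ + s • v₁)
  have hc := D.ip_opK_concave hθ hHom hMon h₀ h₁ hs b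
  have g₀ := mul_le_mul_of_nonneg_left (D.two_mul_ip_sub_le_metric hErg hθ h₀ v₀ b)
    (sub_nonneg.2 hs.2)
  have g₁ := mul_le_mul_of_nonneg_left (D.two_mul_ip_sub_le_metric hErg hθ h₁ v₁ b) hs.1
  rw [hlin]
  simp only [ip_opKPlus, Complex.add_re] at g₀ g₁ ⊢
  linarith

theorem exists_metric_le (θ : ∀ k, J k → ℝ → ℝ → ℝ) (ρ : A) :
    ∃ C, 0 ≤ C ∧ ∀ v, D.metric θ ρ v ≤ C * ‖v‖ ^ 2 := by
  let L : A →L[ℂ] ℂ := LinearMap.toContinuousLinearMap τ.toLin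
  refine ⟨‖L‖ * ‖Ring.inverse (D.opKPlus θ ρ)‖, by positivity, fun v => ?_⟩
  calc D.metric θ ρ v ≤ ‖L (star v * D.potential θ ρ v)‖ := Complex.re_le_norm _
    _ ≤ ‖L‖ * (‖star v‖ * ‖D.potential θ ρ v‖) :=
      (L.le_opNorm _).trans (by gcongr; exact norm_mul_le _ _)
    _ ≤ ‖L‖ * (‖v‖ * (‖Ring.inverse (D.opKPlus θ ρ)‖ * ‖v‖)) := by
      rw [norm_star]
      gcongr
      exact ContinuousLinearMap.le_opNorm _ _
    _ = _ := by ring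

variable {E : Type*} [NormedAddCommGroup E] [NormedSpace ℝ E]

theorem opKPlus_eq_sum (θ : ∀ k, J k → ℝ → ℝ → ℝ) (ρ : A) :
    D.opKPlus θ ρ = (∑ k, ∑ j : J k, D.opKTerm θ k j ρ) +
      LinearMap.toContinuousLinearMap (τ.toLin.smulRight (1 : A)) := by
  ext a
  simp [opKPlus_apply, opK, opKTerm, sandwich]

theorem contDiffOn_opKPlus (hθ : D.IsMeanFamily θ)
    (hHom : ∀ k (j : J k), IsOneHomogeneous (θ k j)) {s : Set E} {X : E → A}
    (hX : ContDiffOn ℝ ∞ X s) (hpos : ∀ t ∈ s, X t ∈ posDefElts A) :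
    ContDiffOn ℝ ∞ (fun t => D.opKPlus θ (X t)) s := by
  simp only [opKPlus_eq_sum]
  have hk : ∀ k, ContDiffOn ℝ ∞ (fun t => ∑ j : J k, D.opKTerm θ k j (X t)) s := fun k =>
    ContDiffOn.sum fun j _ => D.contDiffOn_opKTerm hθ hHom hX hpos k j
  have hsum : ContDiffOn ℝ ∞ (fun t => ∑ k, ∑ j : J k, D.opKTerm θ k j (X t)) s :=
    ContDiffOn.sum fun k _ => hk k
  exact hsum.add contDiffOn_const

theorem contDiffOn_potential (hErg : D.Ergodic) (hθ : D.IsMeanFamily θ)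
    (hHom : ∀ k (j : J k), IsOneHomogeneous (θ k j)) {s : Set E} {X V : E → A}
    (hX : ContDiffOn ℝ ∞ X s) (hV : ContDiffOn ℝ ∞ V s) (hpos : ∀ t ∈ s, X t ∈ posDefElts A) :
    ContDiffOn ℝ ∞ (fun t => D.potential θ (X t) (V t)) s := by
  have h1 := D.contDiffOn_opKPlus hθ hHom hX hpos
  have h2 : ContDiffOn ℝ ∞ (fun t => Ring.inverse (D.opKPlus θ (X t))) s := by
    intro t ht
    obtain ⟨u, hu⟩ := D.isUnit_opKPlus hErg hθ (hpos t ht)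
    have h3 : ContDiffAt ℝ ∞ Ring.inverse (D.opKPlus θ (X t)) := by
      rw [← hu]; exact contDiffAt_ringInverse ℝ u
    exact h3.comp_contDiffWithinAt t (h1 t ht)
  exact ((ContinuousLinearMap.restrictScalarsL ℂ A A ℝ ℝ).contDiff.comp_contDiffOn h2).clm_apply hV

theorem contDiffOn_metric (hErg : D.Ergodic) (hθ : D.IsMeanFamily θ)
    (hHom : ∀ k (j : J k), IsOneHomogeneous (θ k j)) {s : Set E} {X V : E → A}
    (hX : ContDiffOn ℝ ∞ X s) (hV : ContDiffOn ℝ ∞ V s) (hpos : ∀ t ∈ s, X t ∈ posDefElts A) :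
    ContDiffOn ℝ ∞ (fun t => D.metric θ (X t) (V t)) s := by
  have h1 := D.contDiffOn_potential hErg hθ hHom hX hV hpos
  have h2 : ContDiffOn ℝ ∞ (fun t => star (V t)) s :=
    (starL' ℝ : A ≃L[ℝ] A).contDiff.comp_contDiffOn hV
  exact Complex.reCLM.contDiff.comp_contDiffOn
    ((contDiff_of_linear τ.toLin).comp_contDiffOn (h2.mul h1))

end MetricTensor

end DifferentialStructure

end QTransport

/-! ### Energies of paths for a convex metric tensor -/

namespace QTransport

open MeasureTheory Set

section Paths

variable {E : Type*} [NormedAddCommGroup E] [NormedSpace ℝ E]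

/-- A metric tensor `q` on a convex set `S`, homogeneous of degree two in the tangent vector and
jointly convex, with a base point `σ` of `S` where it is bounded. Continuity is required only along
smooth curves in `S`, and nothing is assumed about `q x v` for `x ∉ S` except homogeneity. -/
structure IsConvexMetric (S : Set E) (q : E → E → ℝ) (σ : E) : Prop where
  convex : ∀ x ∈ S, ∀ y ∈ S, ∀ s ∈ Icc (0 : ℝ) 1, (1 - s) • x + s • y ∈ S
  base_mem : σ ∈ S
  smul : ∀ x v (c : ℝ), q x (c • v) = c ^ 2 * q x v
  nonneg : ∀ x ∈ S, ∀ v, 0 ≤ q x v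
  jointly_convex : ∀ x₀ ∈ S, ∀ x₁ ∈ S, ∀ v₀ v₁, ∀ s ∈ Icc (0 : ℝ) 1,
    q ((1 - s) • x₀ + s • x₁) ((1 - s) • v₀ + s • v₁) ≤ (1 - s) * q x₀ v₀ + s * q x₁ v₁
  continuousOn : ∀ X V : ℝ → E, ContDiffOn ℝ ∞ X (Icc 0 1) → ContDiffOn ℝ ∞ V (Icc 0 1) →
    (∀ t ∈ Icc (0 : ℝ) 1, X t ∈ S) → ContinuousOn (fun t => q (X t) (V t)) (Icc 0 1)
  bounded : ∃ C, 0 ≤ C ∧ ∀ v, q σ v ≤ C * ‖v‖ ^ 2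

/-- Smooth paths in `S` from `x` to `y`, parametrized by `[0,1]`. -/
structure IsPath (S : Set E) (x y : E) (γ : ℝ → E) : Prop where
  smooth : ContDiffOn ℝ ∞ γ (Icc 0 1)
  mem : ∀ t ∈ Icc (0 : ℝ) 1, γ t ∈ S
  start : γ 0 = x
  finish : γ 1 = y

/-- The energy `∫₀¹ q(γ, γ') dt`. -/
noncomputable def energy (q : E → E → ℝ) (γ : ℝ → E) : ℝ :=
  ∫ t in (0 : ℝ)..1, q (γ t) (derivWithin γ (Icc 0 1) t)

/-- The energies of all smooth paths from `x` to `y`. -/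
def energies (S : Set E) (q : E → E → ℝ) (x y : E) : Set ℝ :=
  {e | ∃ γ, IsPath S x y γ ∧ e = energy q γ}

/-- The distance associated with a metric tensor: the square root of the infimum of the energies. -/
noncomputable def pathDist (S : Set E) (q : E → E → ℝ) (x y : E) : ℝ :=
  Real.sqrt (sInf (energies S q x y))

/-- Smooth paths from `x` to `y` that are defined on all of `ℝ` and rest outside `[0,1]`. -/
structure IsFlatPath (S : Set E) (x y : E) (γ : ℝ → E) : Prop where
  smooth : ContDiff ℝ ∞ γ
  mem : ∀ t, γ t ∈ S
  left : ∀ t ≤ 0, γ t = x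
  right : ∀ t, 1 ≤ t → γ t = y

variable {S : Set E} {q : E → E → ℝ} {σ : E}

theorem IsPath.contDiffOn_derivWithin {x y : E} {γ : ℝ → E} (h : IsPath S x y γ) :
    ContDiffOn ℝ ∞ (derivWithin γ (Icc 0 1)) (Icc 0 1) :=
  h.smooth.derivWithin (uniqueDiffOn_Icc zero_lt_one) (by simp)

theorem IsPath.hasDerivWithinAt {x y : E} {γ : ℝ → E} (h : IsPath S x y γ) {t : ℝ}
    (ht : t ∈ Icc (0 : ℝ) 1) : HasDerivWithinAt γ (derivWithin γ (Icc 0 1) t) (Icc 0 1) t :=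
  (h.smooth.differentiableOn (by simp) t ht).hasDerivWithinAt

theorem IsConvexMetric.continuousOn_path (hq : IsConvexMetric S q σ) {x y : E} {γ : ℝ → E}
    (h : IsPath S x y γ) :
    ContinuousOn (fun t => q (γ t) (derivWithin γ (Icc 0 1) t)) (Icc 0 1) :=
  hq.continuousOn _ _ h.smooth h.contDiffOn_derivWithin h.mem

theorem IsConvexMetric.energy_nonneg (hq : IsConvexMetric S q σ) {x y : E} {γ : ℝ → E}
    (h : IsPath S x y γ) : 0 ≤ energy q γ :=
  intervalIntegral.integral_nonneg zero_le_one fun t ht => hq.nonneg _ (h.mem t ht) _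

theorem IsConvexMetric.energies_nonneg (hq : IsConvexMetric S q σ) {x y : E} :
    ∀ e ∈ energies S q x y, 0 ≤ e := by
  rintro e ⟨γ, hγ, rfl⟩
  exact hq.energy_nonneg hγ

theorem IsConvexMetric.bddBelow (hq : IsConvexMetric S q σ) (x y : E) :
    BddBelow (energies S q x y) := ⟨0, hq.energies_nonneg⟩

theorem IsConvexMetric.sInf_nonneg (hq : IsConvexMetric S q σ) (x y : E) :
    0 ≤ sInf (energies S q x y) := Real.sInf_nonneg hq.energies_nonneg

theorem IsConvexMetric.pathDist_sq (hq : IsConvexMetric S q σ) (x y : E) :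
    pathDist S q x y ^ 2 = sInf (energies S q x y) := Real.sq_sqrt (hq.sInf_nonneg x y)

theorem IsConvexMetric.zero_right (hq : IsConvexMetric S q σ) (x : E) : q x 0 = 0 := by
  have := hq.smul x 0 0
  simpa using this

/-- By convexity, moving towards the base point bounds the metric tensor. -/
theorem IsConvexMetric.le_inv_mul (hq : IsConvexMetric S q σ) {x : E} (hx : x ∈ S) {s : ℝ}
    (h0 : 0 < s) (h1 : s ≤ 1) (v : E) : q ((1 - s) • x + s • σ) v ≤ s⁻¹ * q σ v := by
  have h := hq.jointly_convex x hx σ hq.base_mem 0 (s⁻¹ • v) s ⟨h0.le, h1⟩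
  rw [smul_zero, zero_add, smul_smul, mul_inv_cancel₀ h0.ne', one_smul, hq.zero_right, mul_zero,
    zero_add, hq.smul] at h
  refine h.trans (le_of_eq ?_)
  field_simp

/-- The segment from `x` to `y`, parametrized by a function `φ`. -/
theorem IsConvexMetric.isPath_segment (hq : IsConvexMetric S q σ) {x y : E} (hx : x ∈ S)
    (hy : y ∈ S) {φ : ℝ → ℝ} (hφ : ContDiff ℝ ∞ φ) (hm : ∀ t ∈ Icc (0 : ℝ) 1, φ t ∈ Icc (0 : ℝ) 1)
    (h0 : φ 0 = 0) (h1 : φ 1 = 1) : IsPath S x y fun t => (1 - φ t) • x + φ t • y where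
  smooth := (((contDiff_const.sub hφ).smul contDiff_const).add
    (hφ.smul contDiff_const)).contDiffOn
  mem t ht := hq.convex x hx y hy _ (hm t ht)
  start := by simp [h0]
  finish := by simp [h1]

/-- The energy of a segment bounds the infimum of the energies. -/
theorem IsConvexMetric.sInf_le_of_segment (hq : IsConvexMetric S q σ) {x y : E} (hx : x ∈ S)
    (hy : y ∈ S) {φ φ' : ℝ → ℝ} (hφ : ContDiff ℝ ∞ φ) (hφ' : ∀ t, HasDerivAt φ (φ' t) t)
    (hm : ∀ t ∈ Icc (0 : ℝ) 1, φ t ∈ Icc (0 : ℝ) 1) (h0 : φ 0 = 0) (h1 : φ 1 = 1) {M : ℝ}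
    (hM : ∀ t ∈ Icc (0 : ℝ) 1, q ((1 - φ t) • x + φ t • y) (φ' t • (y - x)) ≤ M) :
    sInf (energies S q x y) ≤ M := by
  have hp := hq.isPath_segment hx hy hφ hm h0 h1
  refine (csInf_le (hq.bddBelow x y) ⟨_, hp, rfl⟩).trans ?_
  have hd : ∀ t ∈ Icc (0 : ℝ) 1,
      derivWithin (fun t => (1 - φ t) • x + φ t • y) (Icc 0 1) t = φ' t • (y - x) := by
    intro t ht
    have : HasDerivAt (fun t => (1 - φ t) • x + φ t • y) ((0 - φ' t) • x + φ' t • y) t :=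
      (((hasDerivAt_const t (1 : ℝ)).sub (hφ' t)).smul_const x).add ((hφ' t).smul_const y)
    rw [this.hasDerivWithinAt.derivWithin (uniqueDiffOn_Icc zero_lt_one t ht), zero_sub, neg_smul,
      smul_sub]
    abel
  have hc := hq.continuousOn_path hp
  calc energy q _ ≤ ∫ _ in (0 : ℝ)..1, M := by
        refine intervalIntegral.integral_mono_on zero_le_one
          (hc.intervalIntegrable_of_Icc zero_le_one) intervalIntegrable_const fun t ht => ?_
        rw [hd t ht]
        exact hM t ht
    _ = M := by simp

theorem IsConvexMetric.energies_nonempty (hq : IsConvexMetric S q σ) {x y : E} (hx : x ∈ S)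
    (hy : y ∈ S) : (energies S q x y).Nonempty :=
  ⟨_, _, hq.isPath_segment hx hy contDiff_id (fun _ ht => ht) rfl rfl, rfl⟩

/-- A smooth monotone reparametrization of `[0,1]` that rests outside `[0,1]` and has almost unit
speed. -/
theorem exists_flat_reparametrization {η : ℝ} (hη : 0 < η) :
    ∃ ψ : ℝ → ℝ, ContDiff ℝ ∞ ψ ∧ (∀ t ≤ 0, ψ t = 0) ∧ (∀ t, 1 ≤ t → ψ t = 1) ∧
      (∀ t, ψ t ∈ Icc (0 : ℝ) 1) ∧ ∀ t, 0 ≤ deriv ψ t ∧ deriv ψ t ≤ 1 + η := by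
  have hr : (1 + η)⁻¹ < 1 := inv_lt_one_of_one_lt₀ (by linarith)
  let b : ContDiffBump (1 / 2 : ℝ) :=
    { rIn := (1 + η)⁻¹ / 2, rOut := 1 / 2
      rIn_pos := by positivity
      rIn_lt_rOut := by linarith }
  let g : ℝ → ℝ := b.normed volume
  have hg : ContDiff ℝ ∞ g := b.contDiff_normed
  have hg0 : ∀ x, 0 ≤ g x := b.nonneg_normed
  have hsupp : ∀ x, x ∉ Ioo (0 : ℝ) 1 → g x = 0 := by
    intro x hx
    by_contra hne
    have : x ∈ Function.support (b.normed volume) := hne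
    rw [b.support_normed_eq, Real.ball_eq_Ioo] at this
    have hro : b.rOut = 1 / 2 := rfl
    rw [hro] at this
    exact hx (by simpa using (by norm_num at this; exact this))
  let ψ : ℝ → ℝ := fun t => ∫ x in (0 : ℝ)..t, g x
  have hd : ∀ t, HasDerivAt ψ (g t) t := fun t =>
    hg.continuous.integral_hasStrictDerivAt 0 t |>.hasDerivAt
  have hderiv : deriv ψ = g := funext fun t => (hd t).deriv
  have hone : ψ 1 = 1 := by
    have h1 : ∫ x, g x = 1 := b.integral_normed
    refine Eq.trans ?_ h1
    change ∫ x in (0 : ℝ)..1, g x = _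
    rw [intervalIntegral.integral_of_le zero_le_one]
    refine setIntegral_eq_integral_of_forall_compl_eq_zero fun x hx => hsupp x fun h => ?_
    exact hx ⟨h.1, h.2.le⟩
  have hzero : ψ 0 = 0 := intervalIntegral.integral_same
  have hmono : Monotone ψ := monotone_of_deriv_nonneg (fun t => (hd t).differentiableAt)
    fun t => by rw [hderiv]; exact hg0 t
  have hleft : ∀ t ≤ 0, ψ t = 0 := by
    intro t ht
    change ∫ x in (0 : ℝ)..t, g x = 0
    rw [intervalIntegral.integral_symm, neg_eq_zero]
    refine intervalIntegral.integral_zero_ae (Filter.Eventually.of_forall fun x hx => ?_)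
    rw [uIoc_of_le ht] at hx
    exact hsupp x fun h => absurd h.1 (not_lt.2 hx.2)
  have hright : ∀ t, 1 ≤ t → ψ t = 1 := by
    intro t ht
    have : ψ t = ψ 1 + ∫ x in (1 : ℝ)..t, g x :=
      (intervalIntegral.integral_add_adjacent_intervals
        (hg.continuous.intervalIntegrable 0 1) (hg.continuous.intervalIntegrable 1 t)).symm
    rw [this, hone, intervalIntegral.integral_zero_ae, add_zero]
    refine Filter.Eventually.of_forall fun x hx => ?_
    rw [uIoc_of_le ht] at hx
    exact hsupp x fun h => absurd h.2 (not_lt.2 hx.1.le)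
  refine ⟨ψ, ?_, hleft, hright, fun t => ⟨?_, ?_⟩, fun t => ⟨?_, ?_⟩⟩
  · rw [contDiff_infty_iff_deriv, hderiv]
    exact ⟨fun t => (hd t).differentiableAt, hg⟩
  · rcases le_total t 0 with h | h
    · rw [hleft t h]
    · rw [← hzero]; exact hmono h
  · rcases le_total 1 t with h | h
    · rw [hright t h]
    · rw [← hone]; exact hmono h
  · rw [hderiv]; exact hg0 t
  · rw [hderiv]
    refine (b.normed_le_div_measure_closedBall_rIn volume t).trans (le_of_eq ?_)
    have hri : b.rIn = (1 + η)⁻¹ / 2 := rfl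
    rw [hri, Real.volume_real_closedBall (by positivity)]
    field_simp

theorem IsFlatPath.deriv_left {x y : E} {γ : ℝ → E} (h : IsFlatPath S x y γ) {t : ℝ}
    (ht : t ≤ 0) : deriv γ t = 0 := by
  have h1 : HasDerivWithinAt γ (deriv γ t) (Iic t) t :=
    ((h.smooth.differentiable (by simp)) t).hasDerivAt.hasDerivWithinAt
  have h2 : HasDerivWithinAt γ 0 (Iic t) t :=
    (hasDerivWithinAt_const t (Iic t) x).congr (fun s hs => h.left s (le_trans hs ht)) (h.left t ht)
  exact (uniqueDiffWithinAt_Iic t).eq_deriv _ h1 h2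

theorem IsFlatPath.deriv_right {x y : E} {γ : ℝ → E} (h : IsFlatPath S x y γ) {t : ℝ}
    (ht : 1 ≤ t) : deriv γ t = 0 := by
  have h1 : HasDerivWithinAt γ (deriv γ t) (Ici t) t :=
    ((h.smooth.differentiable (by simp)) t).hasDerivAt.hasDerivWithinAt
  have h2 : HasDerivWithinAt γ 0 (Ici t) t :=
    (hasDerivWithinAt_const t (Ici t) y).congr (fun s hs => h.right s (le_trans ht hs))
      (h.right t ht)
  exact (uniqueDiffWithinAt_Ici t).eq_deriv _ h1 h2

theorem IsFlatPath.isPath {x y : E} {γ : ℝ → E} (h : IsFlatPath S x y γ) : IsPath S x y γ where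
  smooth := h.smooth.contDiffOn
  mem t _ := h.mem t
  start := h.left 0 le_rfl
  finish := h.right 1 le_rfl

theorem IsFlatPath.derivWithin_eq {x y : E} {γ : ℝ → E} (h : IsFlatPath S x y γ) {t : ℝ}
    (ht : t ∈ Icc (0 : ℝ) 1) : derivWithin γ (Icc 0 1) t = deriv γ t :=
  ((h.smooth.differentiable (by simp)) t).hasDerivAt.hasDerivWithinAt.derivWithin
    (uniqueDiffOn_Icc zero_lt_one t ht)

theorem IsFlatPath.energy_eq {x y : E} {γ : ℝ → E} (h : IsFlatPath S x y γ) :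
    energy q γ = ∫ t in (0 : ℝ)..1, q (γ t) (deriv γ t) := by
  refine intervalIntegral.integral_congr fun t ht => ?_
  rw [uIcc_of_le zero_le_one] at ht
  simp only [h.derivWithin_eq ht]

/-- A path can be reparametrized to rest outside `[0,1]`, at an arbitrarily small relative cost of
energy. -/
theorem IsConvexMetric.exists_isFlatPath (hq : IsConvexMetric S q σ) {x y : E} {γ : ℝ → E}
    (h : IsPath S x y γ) {η : ℝ} (hη : 0 < η) :
    ∃ γ', IsFlatPath S x y γ' ∧ energy q γ' ≤ (1 + η) * energy q γ := by
  obtain ⟨ψ, hψ, hl, hr, hm, hd⟩ := exists_flat_reparametrization hη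
  have hflat : IsFlatPath S x y (γ ∘ ψ) :=
    { smooth := by
        rw [← contDiffOn_univ]
        exact h.smooth.comp hψ.contDiffOn fun t _ => hm t
      mem := fun t => h.mem _ (hm t)
      left := fun t ht => by rw [Function.comp_apply, hl t ht, h.start]
      right := fun t ht => by rw [Function.comp_apply, hr t ht, h.finish] }
  refine ⟨γ ∘ ψ, hflat, ?_⟩
  have hψd : ∀ t, HasDerivAt ψ (deriv ψ t) t := fun t =>
    ((hψ.differentiable (by simp)) t).hasDerivAt
  have hder : ∀ t, deriv (γ ∘ ψ) t = deriv ψ t • derivWithin γ (Icc 0 1) (ψ t) := fun t =>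
    (HasDerivWithinAt.scomp_hasDerivAt t (h.hasDerivWithinAt (hm t)) (hψd t) hm).deriv
  let g : ℝ → ℝ := fun u => q (γ u) (derivWithin γ (Icc 0 1) u)
  have hg : ContinuousOn g (Icc 0 1) := hq.continuousOn_path h
  have hψ' : Continuous (deriv ψ) := hψ.continuous_deriv (by simp)
  have hgψ : Continuous fun t => g (ψ t) := hg.comp_continuous hψ.continuous hm
  have hsubst : ∫ t in (0 : ℝ)..1, g (ψ t) * deriv ψ t = energy q γ := by
    have := intervalIntegral.integral_comp_mul_deriv'' (a := 0) (b := 1) (f := ψ) (f' := deriv ψ)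
      (g := g) hψ.continuous.continuousOn (fun t _ => (hψd t).hasDerivWithinAt)
      hψ'.continuousOn (hg.mono (by rintro _ ⟨t, _, rfl⟩; exact hm t))
    rw [hl 0 le_rfl, hr 1 le_rfl] at this
    exact this
  rw [hflat.energy_eq, ← hsubst, ← intervalIntegral.integral_const_mul]
  refine intervalIntegral.integral_mono_on zero_le_one ?_ ?_ fun t _ => ?_
  · have hc := hq.continuousOn_path hflat.isPath
    refine (ContinuousOn.congr hc fun t ht => ?_).intervalIntegrable_of_Icc zero_le_one
    simp only [hflat.derivWithin_eq ht]
  · exact (continuous_const.mul (hgψ.mul hψ')).intervalIntegrable 0 1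
  · rw [hder, hq.smul, Function.comp_apply]
    have h1 := hd t
    have h2 : 0 ≤ g (ψ t) := hq.nonneg _ (h.mem _ (hm t)) _
    change deriv ψ t ^ 2 * g (ψ t) ≤ (1 + η) * (g (ψ t) * deriv ψ t)
    have h3 : deriv ψ t * (deriv ψ t * g (ψ t)) ≤ (1 + η) * (deriv ψ t * g (ψ t)) :=
      mul_le_mul_of_nonneg_right h1.2 (mul_nonneg h1.1 h2)
    linarith

/-- Concatenation of two paths, the first traversed during `[0, δ]` and the second during
`[δ, 1]`. -/
theorem IsConvexMetric.exists_concat (hq : IsConvexMetric S q σ) {x y z : E} {γ₁ γ₂ : ℝ → E}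
    (h₁ : IsFlatPath S x y γ₁) (h₂ : IsFlatPath S y z γ₂) {δ : ℝ} (hδ0 : 0 < δ) (hδ1 : δ < 1) :
    ∃ γ, IsFlatPath S x z γ ∧
      energy q γ = δ⁻¹ * energy q γ₁ + (1 - δ)⁻¹ * energy q γ₂ := by
  have hδ' : 0 < 1 - δ := sub_pos.2 hδ1
  set c := δ⁻¹ with hc
  set d := (1 - δ)⁻¹ with hd
  have hc0 : 0 < c := inv_pos.2 hδ0
  have hd0 : 0 < d := inv_pos.2 hδ'
  have hcδ : c * δ = 1 := inv_mul_cancel₀ hδ0.ne'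
  have hdδ : d * (1 - δ) = 1 := inv_mul_cancel₀ hδ'.ne'
  -- the sum avoids a case distinction: at every time one of the two summands rests at `y`
  let γ : ℝ → E := fun t => γ₁ (c * t) + γ₂ (d * t - d * δ) - y
  have hl : ∀ t ≤ δ, d * t - d * δ ≤ 0 := fun t ht => by
    have := mul_le_mul_of_nonneg_left ht hd0.le
    linarith
  have hr : ∀ t, δ ≤ t → 1 ≤ c * t := fun t ht => by
    rw [← hcδ]; exact mul_le_mul_of_nonneg_left ht hc0.le
  have hγl : ∀ t ≤ δ, γ t = γ₁ (c * t) := fun t ht => by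
    simp only [γ, h₂.left _ (hl t ht)]; abel
  have hγr : ∀ t, δ ≤ t → γ t = γ₂ (d * t - d * δ) := fun t ht => by
    simp only [γ, h₁.right _ (hr t ht)]; abel
  have hflat : IsFlatPath S x z γ :=
    { smooth := ((h₁.smooth.comp (contDiff_const.mul contDiff_id)).add
        (h₂.smooth.comp ((contDiff_const.mul contDiff_id).sub contDiff_const))).sub contDiff_const
      mem := fun t => by
        rcases le_total t δ with h | h
        · rw [hγl t h]; exact h₁.mem _
        · rw [hγr t h]; exact h₂.mem _
      left := fun t ht => by
        rw [hγl t (ht.trans hδ0.le)]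
        exact h₁.left _ (mul_nonpos_of_nonneg_of_nonpos hc0.le ht)
      right := fun t ht => by
        rw [hγr t (hδ1.le.trans ht)]
        refine h₂.right _ ?_
        have := mul_le_mul_of_nonneg_left ht hd0.le
        linarith }
  have hder : ∀ t, deriv γ t = c • deriv γ₁ (c * t) + d • deriv γ₂ (d * t - d * δ) := by
    intro t
    have e1 : HasDerivAt (fun t => γ₁ (c * t)) (c • deriv γ₁ (c * t)) t := by
      have h := ((h₁.smooth.differentiable (by simp)) (c * t)).hasDerivAt
      have h' : HasDerivAt (fun t => c * t) c t := by simpa using (hasDerivAt_id t).const_mul c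
      exact h.scomp t h'
    have e2 : HasDerivAt (fun t => γ₂ (d * t - d * δ)) (d • deriv γ₂ (d * t - d * δ)) t := by
      have h := ((h₂.smooth.differentiable (by simp)) (d * t - d * δ)).hasDerivAt
      have h' : HasDerivAt (fun t => d * t - d * δ) d t := by
        simpa using ((hasDerivAt_id t).const_mul d).sub_const (d * δ)
      exact h.scomp t h'
    exact ((e1.add e2).sub_const y).deriv
  let g₁ : ℝ → ℝ := fun u => q (γ₁ u) (deriv γ₁ u)
  let g₂ : ℝ → ℝ := fun u => q (γ₂ u) (deriv γ₂ u)
  have hgl : ∀ t ≤ δ, q (γ t) (deriv γ t) = c ^ 2 * g₁ (c * t) := fun t ht => by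
    rw [hγl t ht, hder, h₂.deriv_left (hl t ht), smul_zero, add_zero, hq.smul]
  have hgr : ∀ t, δ ≤ t → q (γ t) (deriv γ t) = d ^ 2 * g₂ (d * t - d * δ) := fun t ht => by
    rw [hγr t ht, hder, h₁.deriv_right (hr t ht), smul_zero, zero_add, hq.smul]
  have hint : ContinuousOn (fun t => q (γ t) (deriv γ t)) (Icc 0 1) :=
    ContinuousOn.congr (hq.continuousOn_path hflat.isPath) fun t ht => by
      simp only [hflat.derivWithin_eq ht]
  refine ⟨γ, hflat, ?_⟩
  rw [hflat.energy_eq, h₁.energy_eq, h₂.energy_eq,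
    ← intervalIntegral.integral_add_adjacent_intervals (b := δ)
      ((hint.mono (Icc_subset_Icc le_rfl hδ1.le)).intervalIntegrable_of_Icc hδ0.le)
      ((hint.mono (Icc_subset_Icc hδ0.le le_rfl)).intervalIntegrable_of_Icc hδ1.le)]
  congr 1
  · have e : ∫ t in (0 : ℝ)..δ, q (γ t) (deriv γ t) = ∫ t in (0 : ℝ)..δ, c ^ 2 * g₁ (c * t) := by
      refine intervalIntegral.integral_congr fun t ht => ?_
      rw [uIcc_of_le hδ0.le] at ht
      exact hgl t ht.2
    rw [e, intervalIntegral.integral_const_mul, intervalIntegral.integral_comp_mul_left _ hc0.ne',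
      mul_zero, hcδ, smul_eq_mul]
    field_simp
    rfl
  · have e : ∫ t in δ..(1 : ℝ), q (γ t) (deriv γ t) =
        ∫ t in δ..(1 : ℝ), d ^ 2 * g₂ (d * t - d * δ) := by
      refine intervalIntegral.integral_congr fun t ht => ?_
      rw [uIcc_of_le hδ1.le] at ht
      exact hgr t ht.1
    have e1 : d * 1 - d * δ = 1 := by linarith
    rw [e, intervalIntegral.integral_const_mul, intervalIntegral.integral_comp_mul_sub _ hd0.ne',
      sub_self, e1, smul_eq_mul]
    field_simp
    rfl

end Paths

end QTransport

/-! ### Continuous extension and convexity of the distance of a convex metric tensor -/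

namespace QTransport

open MeasureTheory Set Filter

section Paths

variable {E : Type*} [NormedAddCommGroup E] [NormedSpace ℝ E]
variable {S : Set E} {q : E → E → ℝ} {σ : E}

/-- Run through the first path during `[0, δ]` and through the second during `[δ, 1]`. -/
theorem IsConvexMetric.sInf_le_concat (hq : IsConvexMetric S q σ) {x y z : E} {e₁ e₂ : ℝ}
    (h₁ : e₁ ∈ energies S q x y) (h₂ : e₂ ∈ energies S q y z) {δ : ℝ} (hδ0 : 0 < δ)
    (hδ1 : δ < 1) : sInf (energies S q x z) ≤ δ⁻¹ * e₁ + (1 - δ)⁻¹ * e₂ := by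
  have hn₁ := hq.energies_nonneg _ h₁
  have hn₂ := hq.energies_nonneg _ h₂
  obtain ⟨γ₁, hγ₁, rfl⟩ := h₁
  obtain ⟨γ₂, hγ₂, rfl⟩ := h₂
  have hδ' : 0 < 1 - δ := sub_pos.2 hδ1
  set M := δ⁻¹ * energy q γ₁ + (1 - δ)⁻¹ * energy q γ₂ with hM
  have hM0 : 0 ≤ M := by positivity
  refine le_of_forall_pos_le_add fun ε hε => ?_
  have hη : 0 < ε / (M + 1) := by positivity
  obtain ⟨g₁, hg₁, hl₁⟩ := hq.exists_isFlatPath hγ₁ hη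
  obtain ⟨g₂, hg₂, hl₂⟩ := hq.exists_isFlatPath hγ₂ hη
  obtain ⟨g, hg, he⟩ := hq.exists_concat hg₁ hg₂ hδ0 hδ1
  have hle : sInf (energies S q x z) ≤ energy q g :=
    csInf_le (hq.bddBelow x z) ⟨g, hg.isPath, rfl⟩
  have h1 : δ⁻¹ * energy q g₁ ≤ δ⁻¹ * ((1 + ε / (M + 1)) * energy q γ₁) :=
    mul_le_mul_of_nonneg_left hl₁ (by positivity)
  have h2 : (1 - δ)⁻¹ * energy q g₂ ≤ (1 - δ)⁻¹ * ((1 + ε / (M + 1)) * energy q γ₂) :=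
    mul_le_mul_of_nonneg_left hl₂ (by positivity)
  have h3 : ε / (M + 1) * M ≤ ε := by
    rw [div_mul_eq_mul_div, div_le_iff₀ (by positivity)]
    nlinarith
  have h4 : δ⁻¹ * ((1 + ε / (M + 1)) * energy q γ₁) +
      (1 - δ)⁻¹ * ((1 + ε / (M + 1)) * energy q γ₂) = M + ε / (M + 1) * M := by
    rw [hM]; ring
  linarith

/-- Concatenating almost optimal paths, run through in times proportional to their lengths, gives
the triangle inequality. -/
theorem IsConvexMetric.pathDist_triangle (hq : IsConvexMetric S q σ) {x y z : E} (hx : x ∈ S)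
    (hy : y ∈ S) (hz : z ∈ S) : pathDist S q x z ≤ pathDist S q x y + pathDist S q y z := by
  refine le_of_forall_pos_le_add fun ε hε => ?_
  have key : ∀ u ∈ S, ∀ v ∈ S, ∀ p, pathDist S q u v < p → ∃ e ∈ energies S q u v, e ≤ p ^ 2 := by
    intro u hu v hv p hp
    have h0 : 0 ≤ pathDist S q u v := Real.sqrt_nonneg _
    have : sInf (energies S q u v) < p ^ 2 := by
      rw [← hq.pathDist_sq]
      exact pow_lt_pow_left₀ hp h0 two_ne_zero
    obtain ⟨e, he, hlt⟩ := exists_lt_of_csInf_lt (hq.energies_nonempty hu hv) this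
    exact ⟨e, he, hlt.le⟩
  set p := pathDist S q x y + ε / 2 with hpdef
  set r := pathDist S q y z + ε / 2 with hrdef
  have hp0 : 0 < p := add_pos_of_nonneg_of_pos (Real.sqrt_nonneg _) (half_pos hε)
  have hr0 : 0 < r := add_pos_of_nonneg_of_pos (Real.sqrt_nonneg _) (half_pos hε)
  obtain ⟨e₁, he₁, hl₁⟩ := key x hx y hy p (by linarith)
  obtain ⟨e₂, he₂, hl₂⟩ := key y hy z hz r (by linarith)
  have hδ0 : 0 < p / (p + r) := by positivity
  have hδ1 : p / (p + r) < 1 := by rw [div_lt_one (by positivity)]; linarith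
  have h := hq.sInf_le_concat he₁ he₂ hδ0 hδ1
  have hδ : 1 - p / (p + r) = r / (p + r) := by field_simp; ring
  rw [hδ, inv_div, inv_div] at h
  have h1 : (p + r) / p * e₁ ≤ (p + r) / p * p ^ 2 :=
    mul_le_mul_of_nonneg_left hl₁ (by positivity)
  have h2 : (p + r) / r * e₂ ≤ (p + r) / r * r ^ 2 :=
    mul_le_mul_of_nonneg_left hl₂ (by positivity)
  have h3 : (p + r) / p * p ^ 2 + (p + r) / r * r ^ 2 = (p + r) ^ 2 := by field_simp
  have h4 : pathDist S q x z ≤ p + r := by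
    rw [pathDist, Real.sqrt_le_left (by positivity)]
    linarith
  linarith

theorem pathDist_le_of_sInf_le {x y : E} {c : ℝ} (hc : 0 ≤ c)
    (h : sInf (energies S q x y) ≤ c ^ 2) : pathDist S q x y ≤ c := by
  rwa [pathDist, Real.sqrt_le_left hc]

/-- The metric along a segment to the base point, parametrized quadratically, stays bounded. -/
theorem IsConvexMetric.le_of_quadratic (hq : IsConvexMetric S q σ) {x : E} (hx : x ∈ S) {ε u c : ℝ}
    (hε0 : 0 < ε) (hε1 : ε ≤ 1) (hu0 : 0 ≤ u) (hu1 : u ≤ 1) (hc : c ^ 2 = (2 * u * ε) ^ 2) :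
    q ((1 - ε * u ^ 2) • x + (ε * u ^ 2) • σ) (c • (σ - x)) ≤ 4 * ε * q σ (σ - x) := by
  have hn := hq.nonneg σ hq.base_mem (σ - x)
  rcases hu0.eq_or_lt with rfl | hu
  · have : c = 0 := by
      rw [← sq_eq_zero_iff, hc]; ring
    rw [this, zero_smul, hq.zero_right]
    positivity
  · have h1 : ε * u ^ 2 ≤ 1 := mul_le_one₀ hε1 (by positivity) (pow_le_one₀ hu0 hu1)
    refine (hq.le_inv_mul hx (by positivity) h1 _).trans (le_of_eq ?_)
    rw [hq.smul, hc]
    field_simp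
    ring

theorem IsConvexMetric.sInf_to_base (hq : IsConvexMetric S q σ) {x : E} (hx : x ∈ S) {ε : ℝ}
    (hε0 : 0 < ε) (hε1 : ε ≤ 1) :
    sInf (energies S q x ((1 - ε) • x + ε • σ)) ≤ 4 * ε * q σ (σ - x) := by
  refine hq.sInf_le_of_segment hx (hq.convex x hx σ hq.base_mem ε ⟨hε0.le, hε1⟩)
    (φ := fun t => t ^ 2) (φ' := fun t => 2 * t) (contDiff_id.pow 2)
    (fun t => by simpa using hasDerivAt_pow 2 t)
    (fun t ht => ⟨sq_nonneg t, pow_le_one₀ ht.1 ht.2⟩) (by simp) (by simp) fun t ht => ?_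
  have h := hq.le_of_quadratic hx hε0 hε1 ht.1 ht.2 rfl
  convert h using 2 <;> module

theorem IsConvexMetric.sInf_from_base (hq : IsConvexMetric S q σ) {x : E} (hx : x ∈ S) {ε : ℝ}
    (hε0 : 0 < ε) (hε1 : ε ≤ 1) :
    sInf (energies S q ((1 - ε) • x + ε • σ) x) ≤ 4 * ε * q σ (σ - x) := by
  refine hq.sInf_le_of_segment (hq.convex x hx σ hq.base_mem ε ⟨hε0.le, hε1⟩) hx
    (φ := fun t => 1 - (1 - t) ^ 2) (φ' := fun t => 2 * (1 - t))
    (contDiff_const.sub ((contDiff_const.sub contDiff_id).pow 2))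
    (fun t => by
      have h := (((hasDerivAt_const t (1 : ℝ)).sub (hasDerivAt_id t)).pow 2).const_sub 1
      refine h.congr_deriv ?_
      simp)
    (fun t ht => ⟨sub_nonneg.2 (pow_le_one₀ (sub_nonneg.2 ht.2) (sub_le_self _ ht.1)),
      sub_le_self _ (sq_nonneg _)⟩) (by simp) (by simp) fun t ht => ?_
  have h := hq.le_of_quadratic hx hε0 hε1 (u := 1 - t) (c := -(2 * (1 - t) * ε))
    (sub_nonneg.2 ht.2) (sub_le_self _ ht.1) (neg_sq _)
  convert h using 2 <;> module

theorem IsConvexMetric.sInf_interior (hq : IsConvexMetric S q σ) {x y : E} (hx : x ∈ S)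
    (hy : y ∈ S) {ε : ℝ} (hε0 : 0 < ε) (hε1 : ε ≤ 1) :
    sInf (energies S q ((1 - ε) • x + ε • σ) ((1 - ε) • y + ε • σ)) ≤ ε⁻¹ * q σ (y - x) := by
  have hm := hq.convex
  refine hq.sInf_le_of_segment (hm x hx σ hq.base_mem ε ⟨hε0.le, hε1⟩)
    (hm y hy σ hq.base_mem ε ⟨hε0.le, hε1⟩) (φ := id) (φ' := fun _ => 1) contDiff_id
    (fun t => hasDerivAt_id t) (fun t ht => ht) rfl rfl fun t ht => ?_
  have h := hq.le_inv_mul (hm x hx y hy t ht) hε0 hε1 ((1 - ε) • (y - x))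
  have hn := hq.nonneg σ hq.base_mem (y - x)
  have h2 : ε⁻¹ * q σ ((1 - ε) • (y - x)) ≤ ε⁻¹ * q σ (y - x) := by
    refine mul_le_mul_of_nonneg_left ?_ (by positivity)
    rw [hq.smul]
    exact mul_le_of_le_one_left hn (pow_le_one₀ (sub_nonneg.2 hε1) (sub_le_self _ hε0.le))
  refine le_trans (le_of_eq ?_) (h.trans h2)
  congr 1
  · simp only [id]; module
  · module

/-- The distance is uniformly small for nearby points of bounded sets: go towards the base point
for a while, then straight, then back. -/
theorem IsConvexMetric.exists_pathDist_lt (hq : IsConvexMetric S q σ) (R : ℝ) {e : ℝ}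
    (he : 0 < e) : ∃ δ > 0, ∀ x ∈ S, ∀ y ∈ S, ‖x‖ ≤ R → ‖y‖ ≤ R → ‖y - x‖ < δ →
      pathDist S q x y < e := by
  obtain ⟨C, hC0, hC⟩ := hq.bounded
  set c := Real.sqrt C + 1 with hcdef
  have hc0 : 0 < c := by positivity
  have hc : ∀ v, q σ v ≤ (c * ‖v‖) ^ 2 := fun v => by
    refine (hC v).trans ?_
    rw [mul_pow]
    refine mul_le_mul_of_nonneg_right ?_ (sq_nonneg _)
    nlinarith [Real.sq_sqrt hC0, Real.sqrt_nonneg C]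
  set M := ‖σ‖ + |R| + 1 with hMdef
  have hM0 : 0 < M := by positivity
  have hM : ∀ x, ‖x‖ ≤ R → ‖σ - x‖ ≤ M := fun x hx =>
    (norm_sub_le σ x).trans (by linarith [le_abs_self R])
  -- `a` is the square root of the fraction of the way that is gone towards the base point
  set a := min 1 (e / (8 * (c * M))) with hadef
  have ha0 : 0 < a := lt_min one_pos (by positivity)
  have ha1 : a ≤ 1 := min_le_left _ _
  have hae : 4 * (a * (c * M)) ≤ e / 2 := by
    have : a * (8 * (c * M)) ≤ e := (le_div_iff₀ (by positivity)).1 (min_le_right _ _)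
    linarith
  have hε1 : a ^ 2 ≤ 1 := pow_le_one₀ ha0.le ha1
  refine ⟨e * a / (2 * c), by positivity, fun x hx y hy hxR hyR hxy => ?_⟩
  have hm := hq.convex
  have hx' := hm x hx σ hq.base_mem (a ^ 2) ⟨by positivity, hε1⟩
  have hy' := hm y hy σ hq.base_mem (a ^ 2) ⟨by positivity, hε1⟩
  have hb : ∀ z, ‖z‖ ≤ R → 4 * a ^ 2 * q σ (σ - z) ≤ (2 * (a * (c * M))) ^ 2 := by
    intro z hz
    have h1 : q σ (σ - z) ≤ (c * M) ^ 2 := (hc _).trans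
      (pow_le_pow_left₀ (by positivity) (mul_le_mul_of_nonneg_left (hM z hz) hc0.le) 2)
    calc 4 * a ^ 2 * q σ (σ - z) ≤ 4 * a ^ 2 * (c * M) ^ 2 :=
          mul_le_mul_of_nonneg_left h1 (by positivity)
      _ = _ := by ring
  have d1 := pathDist_le_of_sInf_le (by positivity)
    ((hq.sInf_to_base hx (ε := a ^ 2) (by positivity) hε1).trans (hb x hxR))
  have d3 := pathDist_le_of_sInf_le (by positivity)
    ((hq.sInf_from_base hy (ε := a ^ 2) (by positivity) hε1).trans (hb y hyR))
  have d2 : pathDist S q ((1 - a ^ 2) • x + a ^ 2 • σ) ((1 - a ^ 2) • y + a ^ 2 • σ) ≤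
      a⁻¹ * (c * ‖y - x‖) := by
    refine pathDist_le_of_sInf_le (by positivity) ?_
    refine (hq.sInf_interior hx hy (by positivity) hε1).trans ?_
    rw [mul_pow, inv_pow]
    exact mul_le_mul_of_nonneg_left (hc _) (by positivity)
  have d2' : a⁻¹ * (c * ‖y - x‖) < e / 2 := by
    rw [lt_div_iff₀ (by positivity)] at hxy
    rw [inv_mul_eq_div, div_lt_iff₀ ha0]
    linarith
  have t1 := hq.pathDist_triangle hx hx' hy
  have t2 := hq.pathDist_triangle hx' hy' hy
  linarith

/-- The distance extends continuously: by the triangle inequality it is Cauchy along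
neighbourhoods in `S × S` of any point. -/
theorem IsConvexMetric.tendsto_extendFrom (hq : IsConvexMetric S q σ) (p : E × E) :
    Tendsto (fun p : E × E => pathDist S q p.1 p.2) (𝓝[S ×ˢ S] p)
      (𝓝 (extendFrom (S ×ˢ S) (fun p : E × E => pathDist S q p.1 p.2) p)) := by
  refine _root_.tendsto_extendFrom ?_
  rcases (𝓝[S ×ˢ S] p).eq_or_neBot with hbot | hne
  · rw [hbot]; exact ⟨0, tendsto_bot⟩
  refine cauchy_map_iff_exists_tendsto.1 (Metric.cauchy_iff.2 ⟨inferInstance, fun ε hε => ?_⟩)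
  obtain ⟨δ, hδ, hd⟩ := hq.exists_pathDist_lt (‖p‖ + 1) (e := ε / 4) (by positivity)
  set r := min 1 (δ / 2) with hr
  have hr0 : 0 < r := lt_min one_pos (half_pos hδ)
  refine ⟨(fun p : E × E => pathDist S q p.1 p.2) '' (Metric.ball p r ∩ S ×ˢ S),
    image_mem_map (inter_mem (mem_nhdsWithin_of_mem_nhds (Metric.ball_mem_nhds p hr0))
      self_mem_nhdsWithin), ?_⟩
  have hnorm : ∀ a ∈ Metric.ball p r, ‖a.1‖ ≤ ‖p‖ + 1 ∧ ‖a.2‖ ≤ ‖p‖ + 1 := by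
    intro a ha
    rw [mem_ball_iff_norm] at ha
    have h1 : ‖a‖ ≤ ‖p‖ + 1 := by
      have := norm_le_norm_add_norm_sub' a p
      have := min_le_left 1 (δ / 2)
      linarith
    exact ⟨(norm_fst_le a).trans h1, (norm_snd_le a).trans h1⟩
  have hdist : ∀ a ∈ Metric.ball p r, ∀ b ∈ Metric.ball p r, ‖a.1 - b.1‖ < δ ∧ ‖a.2 - b.2‖ < δ := by
    intro a ha b hb
    have h1 : ‖a - b‖ < δ := by
      rw [← dist_eq_norm]
      have := dist_triangle_right a b p
      rw [Metric.mem_ball] at ha hb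
      have := min_le_right 1 (δ / 2)
      linarith
    exact ⟨(norm_fst_le (a - b)).trans_lt h1, (norm_snd_le (a - b)).trans_lt h1⟩
  have key : ∀ a ∈ Metric.ball p r ∩ S ×ˢ S, ∀ b ∈ Metric.ball p r ∩ S ×ˢ S,
      pathDist S q a.1 a.2 - pathDist S q b.1 b.2 < ε / 2 := by
    rintro a ⟨ha, ha1, ha2⟩ b ⟨hb, hb1, hb2⟩
    have t1 := hq.pathDist_triangle ha1 hb1 ha2
    have t2 := hq.pathDist_triangle hb1 hb2 ha2
    have e1 := hd a.1 ha1 b.1 hb1 (hnorm a ha).1 (hnorm b hb).1 (hdist b hb a ha).1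
    have e2 := hd b.2 hb2 a.2 ha2 (hnorm b hb).2 (hnorm a ha).2 (hdist a ha b hb).2
    linarith
  rintro _ ⟨a, ha, rfl⟩ _ ⟨b, hb, rfl⟩
  rw [Real.dist_eq, abs_sub_lt_iff]
  have := key a ha b hb
  have := key b hb a ha
  constructor <;> linarith

theorem IsConvexMetric.extendFrom_eq (hq : IsConvexMetric S q σ) {p : E × E} (hp : p ∈ S ×ˢ S) :
    extendFrom (S ×ˢ S) (fun p : E × E => pathDist S q p.1 p.2) p = pathDist S q p.1 p.2 := by
  have h := (hq.tendsto_extendFrom p).mono_left (pure_le_nhdsWithin hp)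
  exact tendsto_nhds_unique h (tendsto_pure_nhds _ p)

/-- Convex combinations of paths show that the squared distance is jointly convex. -/
theorem IsConvexMetric.sInf_convex (hq : IsConvexMetric S q σ) {x₀ y₀ x₁ y₁ : E} (hx₀ : x₀ ∈ S)
    (hy₀ : y₀ ∈ S) (hx₁ : x₁ ∈ S) (hy₁ : y₁ ∈ S) {s : ℝ} (hs : s ∈ Icc (0 : ℝ) 1) :
    sInf (energies S q ((1 - s) • x₀ + s • x₁) ((1 - s) • y₀ + s • y₁)) ≤
      (1 - s) * sInf (energies S q x₀ y₀) + s * sInf (energies S q x₁ y₁) := by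
  have hs' : 0 ≤ 1 - s := sub_nonneg.2 hs.2
  have key : ∀ e₀ ∈ energies S q x₀ y₀, ∀ e₁ ∈ energies S q x₁ y₁,
      sInf (energies S q ((1 - s) • x₀ + s • x₁) ((1 - s) • y₀ + s • y₁)) ≤
        (1 - s) * e₀ + s * e₁ := by
    rintro _ ⟨γ₀, h₀, rfl⟩ _ ⟨γ₁, h₁, rfl⟩
    have hp : IsPath S ((1 - s) • x₀ + s • x₁) ((1 - s) • y₀ + s • y₁)
        (fun t => (1 - s) • γ₀ t + s • γ₁ t) :=
      { smooth := (contDiffOn_const.smul h₀.smooth).add (contDiffOn_const.smul h₁.smooth)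
        mem := fun t ht => hq.convex _ (h₀.mem t ht) _ (h₁.mem t ht) s hs
        start := by simp only [h₀.start, h₁.start]
        finish := by simp only [h₀.finish, h₁.finish] }
    refine (csInf_le (hq.bddBelow _ _) ⟨_, hp, rfl⟩).trans ?_
    have i₀ := (hq.continuousOn_path h₀).intervalIntegrable_of_Icc (μ := volume) zero_le_one
    have i₁ := (hq.continuousOn_path h₁).intervalIntegrable_of_Icc (μ := volume) zero_le_one
    rw [energy, energy, energy, ← intervalIntegral.integral_const_mul,
      ← intervalIntegral.integral_const_mul,
      ← intervalIntegral.integral_add (i₀.const_mul _) (i₁.const_mul _)]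
    refine intervalIntegral.integral_mono_on zero_le_one
      ((hq.continuousOn_path hp).intervalIntegrable_of_Icc zero_le_one)
      ((i₀.const_mul _).add (i₁.const_mul _)) fun t ht => ?_
    have hd := (((h₀.hasDerivWithinAt ht).const_smul (1 - s)).add
      ((h₁.hasDerivWithinAt ht).const_smul s)).derivWithin (uniqueDiffOn_Icc zero_lt_one t ht)
    have hj := hq.jointly_convex _ (h₀.mem t ht) _ (h₁.mem t ht) (derivWithin γ₀ (Icc 0 1) t)
      (derivWithin γ₁ (Icc 0 1) t) s hs
    rw [← hd] at hj
    exact hj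
  refine le_of_forall_pos_le_add fun ε hε => ?_
  obtain ⟨e₀, he₀, hl₀⟩ := Real.lt_sInf_add_pos (hq.energies_nonempty hx₀ hy₀) hε
  obtain ⟨e₁, he₁, hl₁⟩ := Real.lt_sInf_add_pos (hq.energies_nonempty hx₁ hy₁) hε
  have h0 := mul_le_mul_of_nonneg_left hl₀.le hs'
  have h1 := mul_le_mul_of_nonneg_left hl₁.le hs.1
  have := key e₀ he₀ e₁ he₁
  linarith

/-- Points from which the segment towards the base point lies in `S`, except for the point
itself. -/
def IsAccessible (S : Set E) (σ x : E) : Prop :=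
  ∀ ε : ℝ, 0 < ε → ε ≤ 1 → (1 - ε) • x + ε • σ ∈ S

theorem IsAccessible.convex (hq : IsConvexMetric S q σ) {x y : E} (hx : IsAccessible S σ x)
    (hy : IsAccessible S σ y) {s : ℝ} (hs : s ∈ Icc (0 : ℝ) 1) :
    IsAccessible S σ ((1 - s) • x + s • y) := by
  intro ε h0 h1
  have h := hq.convex _ (hx ε h0 h1) _ (hy ε h0 h1) s hs
  convert h using 1
  module

theorem IsConvexMetric.tendsto_accessible (hq : IsConvexMetric S q σ) {x y : E}
    (hx : IsAccessible S σ x) (hy : IsAccessible S σ y) :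
    Tendsto (fun ε : ℝ => pathDist S q ((1 - ε) • x + ε • σ) ((1 - ε) • y + ε • σ)) (𝓝[>] 0)
      (𝓝 (extendFrom (S ×ˢ S) (fun p : E × E => pathDist S q p.1 p.2) (x, y))) := by
  have hc : ∀ z : E, Tendsto (fun ε : ℝ => (1 - ε) • z + ε • σ) (𝓝[>] 0) (𝓝 z) := by
    intro z
    have h : Continuous fun ε : ℝ => (1 - ε) • z + ε • σ := by fun_prop
    have h' := h.tendsto 0
    simp only [sub_zero, one_smul, zero_smul, add_zero] at h'
    exact h'.mono_left nhdsWithin_le_nhds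
  refine (hq.tendsto_extendFrom (x, y)).comp
    (f := fun ε : ℝ => ((1 - ε) • x + ε • σ, (1 - ε) • y + ε • σ))
    (tendsto_nhdsWithin_iff.2 ⟨(hc x).prodMk_nhds (hc y), ?_⟩)
  filter_upwards [Ioc_mem_nhdsGT (zero_lt_one (α := ℝ))] with ε hε
  exact ⟨hx ε hε.1 hε.2, hy ε hε.1 hε.2⟩

/-- Joint convexity of the square of the extended distance. -/
theorem IsConvexMetric.extendFrom_sq_convex (hq : IsConvexMetric S q σ) {x₀ y₀ x₁ y₁ : E}
    (hx₀ : IsAccessible S σ x₀) (hy₀ : IsAccessible S σ y₀) (hx₁ : IsAccessible S σ x₁)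
    (hy₁ : IsAccessible S σ y₁) {s : ℝ} (hs : s ∈ Icc (0 : ℝ) 1) :
    extendFrom (S ×ˢ S) (fun p : E × E => pathDist S q p.1 p.2)
        ((1 - s) • x₀ + s • x₁, (1 - s) • y₀ + s • y₁) ^ 2 ≤
      (1 - s) * extendFrom (S ×ˢ S) (fun p : E × E => pathDist S q p.1 p.2) (x₀, y₀) ^ 2 +
        s * extendFrom (S ×ˢ S) (fun p : E × E => pathDist S q p.1 p.2) (x₁, y₁) ^ 2 := by
  refine le_of_tendsto_of_tendsto
    ((hq.tendsto_accessible (hx₀.convex hq hx₁ hs) (hy₀.convex hq hy₁ hs)).pow 2)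
    ((((hq.tendsto_accessible hx₀ hy₀).pow 2).const_mul (1 - s)).add
      (((hq.tendsto_accessible hx₁ hy₁).pow 2).const_mul s)) ?_
  filter_upwards [Ioc_mem_nhdsGT (zero_lt_one (α := ℝ))] with ε hε
  simp only [hq.pathDist_sq]
  have h := hq.sInf_convex (hx₀ ε hε.1 hε.2) (hy₀ ε hε.1 hε.2) (hx₁ ε hε.1 hε.2)
    (hy₁ ε hε.1 hε.2) hs
  have e : ∀ a b : E, (1 - ε) • ((1 - s) • a + s • b) + ε • σ =
      (1 - s) • ((1 - ε) • a + ε • σ) + s • ((1 - ε) • b + ε • σ) := fun a b => by module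
  rw [e, e]
  exact h

end Paths

end QTransport

/-! ### The transport distance as the distance of a convex metric tensor -/

namespace QTransport

namespace DifferentialStructure

theorem mem_densityPos_iff {A : Type*} [CStarAlgebra A] {τ : FaithfulTrace A} {ρ : A} :
    ρ ∈ densityPos τ ↔ ρ ∈ posDefElts A ∧ τ.toLin ρ = 1 :=
  and_assoc.symm

theorem trace_convexComb {A : Type*} [CStarAlgebra A] {τ : FaithfulTrace A} {a b : A}
    (ha : τ.toLin a = 1) (hb : τ.toLin b = 1) (s : ℝ) :
    τ.toLin ((1 - s) • a + s • b) = 1 := by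
  rw [← Complex.coe_smul, ← Complex.coe_smul, map_add, map_smul, map_smul, ha, hb, smul_eq_mul,
    smul_eq_mul, mul_one, mul_one]
  push_cast
  ring

theorem isAccessible_of_mem_density {A : Type*} [CStarAlgebra A] [FiniteDimensional ℂ A]
    {τ : FaithfulTrace A} {K : Type*} {J : K → Type*} {B : K → Type*} [∀ k, CStarAlgebra (B k)]
    (D : DifferentialStructure τ J B) {ρ : A} (hρ : ρ ∈ density τ) :
    IsAccessible (densityPos τ) D.σ ρ := fun s h0 h1 => mem_densityPos_iff.2
  ⟨convexComb_mem_posDefElts hρ.1 hρ.2.1 (mem_densityPos_iff.1 D.σ_mem).1 h0 h1,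
    trace_convexComb hρ.2.2 D.σ_mem.2.2 s⟩

section Transport

variable {A : Type*} [CStarAlgebra A] [FiniteDimensional ℂ A] {τ : FaithfulTrace A}
  {K : Type*} [Fintype K] {J : K → Type*} [∀ k, Fintype (J k)]
  {B : K → Type*} [∀ k, CStarAlgebra (B k)] [∀ k, FiniteDimensional ℂ (B k)]
  (D : DifferentialStructure τ J B) {θ : ∀ k, J k → ℝ → ℝ → ℝ}

theorem isConvexMetric (hErg : D.Ergodic) (hθ : D.IsMeanFamily θ)
    (hHom : ∀ k (j : J k), IsOneHomogeneous (θ k j))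
    (hMon : ∀ k (j : J k), IsOperatorMonotone (fun x => θ k j x 1)) :
    IsConvexMetric (densityPos τ) (D.metric θ) D.σ where
  convex _ hx _ hy s hs := mem_densityPos_iff.2
    ⟨convex_posDefElts (mem_densityPos_iff.1 hx).1 (mem_densityPos_iff.1 hy).1 hs,
      trace_convexComb hx.2.2 hy.2.2 s⟩
  base_mem := D.σ_mem
  smul x v c := D.metric_smul θ x v c
  nonneg _ hx v := D.metric_nonneg hErg hθ (mem_densityPos_iff.1 hx).1 v
  jointly_convex _ h₀ _ h₁ _ _ _ hs := D.metric_convex hErg hθ hHom hMon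
    (mem_densityPos_iff.1 h₀).1 (mem_densityPos_iff.1 h₁).1 hs
  continuousOn _ _ hX hV hm := (D.contDiffOn_metric hErg hθ hHom hX hV
    fun t ht => (mem_densityPos_iff.1 (hm t ht)).1).continuousOn
  bounded := D.exists_metric_le θ D.σ

/-- Velocities of paths of density matrices are hermitian and have trace zero. -/
theorem derivWithin_mem_traceZero {x y : A} {γ : ℝ → A} (h : IsPath (densityPos τ) x y γ) {t : ℝ}
    (ht : t ∈ Set.Icc (0 : ℝ) 1) : derivWithin γ (Set.Icc 0 1) t ∈ traceZero τ := by
  have hu := uniqueDiffOn_Icc (zero_lt_one (α := ℝ)) t ht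
  have hd := h.hasDerivWithinAt ht
  refine ⟨?_, ?_⟩
  · have h1 := ((starL' ℝ : A ≃L[ℝ] A).hasFDerivAt (x := γ t)).comp_hasDerivWithinAt t hd
    have h2 := h1.congr (f₁ := γ) (fun s hs => ((h.mem s hs).1.star_eq).symm)
      ((h.mem t ht).1.star_eq).symm
    exact hu.eq_deriv _ h2 hd
  · let L : A →L[ℝ] ℂ := (LinearMap.toContinuousLinearMap τ.toLin).restrictScalars ℝ
    have h1 := (L.hasFDerivAt (x := γ t)).comp_hasDerivWithinAt t hd
    have h2 := (hasDerivWithinAt_const t (Set.Icc (0 : ℝ) 1) (1 : ℂ)).congr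
      (f₁ := L ∘ γ) (fun s hs => (h.mem s hs).2.2) (h.mem t ht).2.2
    exact hu.eq_deriv _ h1 h2

/-- Every smooth path in `𝔓₊` solves the continuity equation for exactly one potential in `A₀`,
so the actions of admissible curves are the energies of paths. -/
theorem actions_eq_energies (hErg : D.Ergodic) (hθ : D.IsMeanFamily θ)
    (hHom : ∀ k (j : J k), IsOneHomogeneous (θ k j)) (ρ₀ ρ₁ : A) :
    D.actions θ ρ₀ ρ₁ = energies (densityPos τ) (D.metric θ) ρ₀ ρ₁ := by
  have hpos : ∀ {x : A}, x ∈ densityPos τ → x ∈ posDefElts A := fun h =>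
    (mem_densityPos_iff.1 h).1
  ext e
  constructor
  · rintro ⟨ρ, a, h, rfl⟩
    refine ⟨ρ, ⟨h.smooth_density, h.mem_density, h.start, h.finish⟩, ?_⟩
    refine intervalIntegral.integral_congr fun t ht => ?_
    rw [Set.uIcc_of_le zero_le_one] at ht
    simp only [(h.continuity_eq t ht).derivWithin (uniqueDiffOn_Icc zero_lt_one t ht)]
    exact (D.metric_opK hErg hθ (hpos (h.mem_density t ht))
      ((D.mem_tangent_iff hErg).1 (h.mem_tangent t ht))).symm
  · rintro ⟨γ, h, rfl⟩
    have hK : ∀ t ∈ Set.Icc (0 : ℝ) 1, D.opK θ (γ t)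
        (D.potential θ (γ t) (derivWithin γ (Set.Icc 0 1) t)) = derivWithin γ (Set.Icc 0 1) t :=
      fun t ht => D.opK_potential hErg hθ (hpos (h.mem t ht)) (derivWithin_mem_traceZero h ht)
    refine ⟨γ, fun t => D.potential θ (γ t) (derivWithin γ (Set.Icc 0 1) t), ?_, ?_⟩
    · exact
        { smooth_density := h.smooth
          smooth_potential := D.contDiffOn_potential hErg hθ hHom h.smooth
            h.contDiffOn_derivWithin fun t ht => hpos (h.mem t ht)
          mem_density := h.mem
          mem_tangent := fun t ht => (D.mem_tangent_iff hErg).2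
            (D.potential_mem hErg hθ (hpos (h.mem t ht)) (derivWithin_mem_traceZero h ht))
          continuity_eq := fun t ht => by
            rw [hK t ht]
            exact h.hasDerivWithinAt ht
          start := h.start
          finish := h.finish }
    · refine intervalIntegral.integral_congr fun t ht => ?_
      rw [Set.uIcc_of_le zero_le_one] at ht
      simp only [hK t ht]
      rfl

theorem distPos_eq_pathDist (hErg : D.Ergodic) (hθ : D.IsMeanFamily θ)
    (hHom : ∀ k (j : J k), IsOneHomogeneous (θ k j)) (ρ₀ ρ₁ : A) :
    D.distPos θ ρ₀ ρ₁ = pathDist (densityPos τ) (D.metric θ) ρ₀ ρ₁ := by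
  rw [distPos, D.actions_eq_energies hErg hθ hHom, pathDist]

theorem transportDist_eq_extendFrom (hErg : D.Ergodic) (hθ : D.IsMeanFamily θ)
    (hHom : ∀ k (j : J k), IsOneHomogeneous (θ k j)) (ρ₀ ρ₁ : A) :
    D.transportDist θ ρ₀ ρ₁ = extendFrom (densityPos τ ×ˢ densityPos τ)
      (fun p : A × A => pathDist (densityPos τ) (D.metric θ) p.1 p.2) (ρ₀, ρ₁) := by
  simp only [transportDist, D.distPos_eq_pathDist hErg hθ hHom]

end Transport

end DifferentialStructure

end QTransport

theorem mainTheorem5 {A : Type*} [CStarAlgebra A] [FiniteDimensional ℂ A] (τ : FaithfulTrace A)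
    {K : Type*} [Fintype K] (J : K → Type*) [∀ k, Fintype (J k)]
    (B : K → Type*) [∀ k, CStarAlgebra (B k)] [∀ k, FiniteDimensional ℂ (B k)]
    (D : DifferentialStructure τ J B) (hErg : D.Ergodic)
    (θ : ∀ k, J k → ℝ → ℝ → ℝ) (hθ : D.IsMeanFamily θ)
    (hHom : ∀ k (j : J k), IsOneHomogeneous (θ k j))
    (hMon : ∀ k (j : J k), IsOperatorMonotone (fun x => θ k j x 1)) :
    (∀ ρ₀ ∈ densityPos τ, ∀ ρ₁ ∈ densityPos τ,
      IsGLB (D.actions θ ρ₀ ρ₁) (D.transportDist θ ρ₀ ρ₁ ^ 2)) ∧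
    (∀ ρ₀ ∈ density τ, ∀ ρ₁ ∈ density τ,
      Filter.Tendsto (fun p : A × A => D.distPos θ p.1 p.2)
        (𝓝[densityPos τ ×ˢ densityPos τ] (ρ₀, ρ₁)) (𝓝 (D.transportDist θ ρ₀ ρ₁))) ∧
    (∀ ρ₀₀ ∈ density τ, ∀ ρ₁₀ ∈ density τ, ∀ ρ₀₁ ∈ density τ, ∀ ρ₁₁ ∈ density τ,
      ∀ s ∈ Set.Icc (0 : ℝ) 1,
        D.transportDist θ ((1 - s) • ρ₀₀ + s • ρ₀₁) ((1 - s) • ρ₁₀ + s • ρ₁₁) ^ 2 ≤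
          (1 - s) * D.transportDist θ ρ₀₀ ρ₁₀ ^ 2 + s * D.transportDist θ ρ₀₁ ρ₁₁ ^ 2) := by
  have hq := D.isConvexMetric hErg hθ hHom hMon
  simp only [D.transportDist_eq_extendFrom hErg hθ hHom, D.distPos_eq_pathDist hErg hθ hHom,
    D.actions_eq_energies hErg hθ hHom]
  refine ⟨fun ρ₀ h₀ ρ₁ h₁ => ?_, fun ρ₀ _ ρ₁ _ => hq.tendsto_extendFrom (ρ₀, ρ₁),
    fun ρ₀₀ h₀₀ ρ₁₀ h₁₀ ρ₀₁ h₀₁ ρ₁₁ h₁₁ s hs => ?_⟩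
  · rw [hq.extendFrom_eq (p := (ρ₀, ρ₁)) ⟨h₀, h₁⟩, hq.pathDist_sq]
    exact isGLB_csInf (hq.energies_nonempty h₀ h₁) (hq.bddBelow _ _)
  · exact hq.extendFrom_sq_convex (D.isAccessible_of_mem_density h₀₀)
      (D.isAccessible_of_mem_density h₁₀) (D.isAccessible_of_mem_density h₀₁)
      (D.isAccessible_of_mem_density h₁₁) hs
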